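/- **Setting.** Let $K$ be an algebraically closed field, $C$ a nodal curve over $K$ (connected, projective, reduced, of dimension 1, with at most nodes as singularities), $\pi:\mathcal C\to B=\operatorname{Spec}K[[t]]$ a smoothing of $C$ (a proper flat morphism with $\mathcal C$ regular and special fiber $C$), and $\sigma$ a section of $\pi$ through its smooth locus; put $P=\sigma(0)\in C$. A *subcurve* $Z$ of $C$ is a union of irreducible components, $Z^c=\overline{C\setminus Z}$ and $\mathrm{Term}_Z=Z\cap Z^c$. A *$k$-tail* is a subcurve $Z$ with $Z$ and $Z^c$ connected and $\#\mathrm{Term}_Z=k$. Write $Z\prec Z'$ if $Z\subsetneq Z'$ and $\mathrm{Term}_Z\cap\mathrm{Term}_{Z'}=\emptyset$. **Nested tails.** For components $D,D'$ of $C$: - $\mathcal T^1_{D}$ is the set of 1-tails $Z$ with $D\subseteq Z$ and $P\in Z^c$, and $\mathcal T^1_{D,D'}=\mathcal T^1_D\sqcup\mathcal T^1_{D'}$. - $\mathcal T^2_{D,D'}=\{W_0\prec W_1\prec\cdots\}$, where $W_0$ is the minimal 2-tail $Z$ with $D\cup D'\subseteq Z$ and $P\in Z^c$, and $W_t$ is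 the minimal such $Z$ with $W_{t-1}\prec Z$, as long as one exists. - $\mathcal T^3_{D,D'}$ is defined in the same way from the 3-tails $Z$ with $D\cup D'\subseteq Z$, $P\in Z^c$ and $\mathrm{Term}_Z\cap\mathrm{Term}_W=\emptyset$ for all $W\in\mathcal T^2_{D,D'}$. **Distinguished points.** Let $\mathcal C^2=\mathcal C\times_B\mathcal C$, and let $\phi:\widetilde{\mathcal C}^2\to\mathcal C^2$ be a good partial desingularization: the blowup of the diagonal followed by finitely many blowups along strict transforms of Weil divisors $Z_1\times Z_2$ ($Z_1,Z_2$ subcurves of $C$), such that the strict transform of every $Z_1\times Z_2$ is a Cartier divisor. Let $A\in\widetilde{\mathcal C}^2$ be a distinguished point over $(R_1,R_2)$ with $R_1\ne R_2$: $\phi(A)=(R_1,R_2)$, and $A$ lies on the strict transforms of $C_{\gamma_1}\times C_{\gamma_2}$, $C_{\gamma_1}\times C_{\gamma_2'}$ and $C_{\gamma_1'}\times C_{\gamma_2}$, for three distinct pairs in $\mathcal P_A=\{(\gamma_1,\gamma_2),(\gamma_1,\gamma_2'),(\gamma_1',\gamma_2)\}$ of indices of components of $C$. (So $R_1\in C_{\gamma_1}\cap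 C_{\gamma_1'}$ and $R_2\in C_{\gamma_2}\cap C_{\gamma_2'}$ are nodes.) Write $\mathcal T^s_{\alpha,\beta}$ for $\mathcal T^s_{C_\alpha,C_\beta}$ and, for $s=1,2,3$, put $$\mathcal T_A^s=\mathcal T^s_{\gamma_1,\gamma_2}\sqcup\mathcal T^s_{\gamma_1,\gamma_2'}\sqcup\mathcal T^s_{\gamma_1',\gamma_2}.$$ The point $A$ is *quasistable* if $$\#\Big(\{R_1,R_2\}\cap\bigcup_{W\in\mathcal T^2_{\gamma_1,\gamma_2}\cup\mathcal T^3_{\gamma_1,\gamma_2}}\mathrm{Term}_W\Big)\le1\quad\text{and}\quad\#\Big(\{R_1,R_2\}\cap\bigcup_{W\in\mathcal T^2_{\gamma_1',\gamma_2'}\cup\mathcal T^3_{\gamma_1',\gamma_2'}}\mathrm{Term}_W\Big)\le1 .$$ **The curve $C(2)$.** Let $\mu:C(2)\to C$ be the nodal curve obtained by replacing every node of $C$ by a chain of two smooth rational curves: $\mu$ is an isomorphism over the smooth locus of $C$, and over each node it contracts two smooth rational components that meet each other in one point and each meet the rest of $C(2)$ in one point. For a node $S\in C_\gamma\cap C_{\gamma'}$,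 with $\gamma\neq\gamma'$, let $E_{S,\gamma}$ be the component contracted to $S$ that meets the strict transform of $C_\gamma$. Let $\widehat{\mathcal T}^s_A$ ($s=1,2,3$) be the nested $s$-tails of $C(2)$ associated to $(E_{R_1,\gamma_1},E_{R_2,\gamma_2})$, defined as above on $C(2)$ with base point $\mu^{-1}(P)$ in place of $P$. **Proposition 6.2.** If $A$ is quasistable, then $A$ is synchronized: for each $s\in\{1,2,3\}$, the map $Y\mapsto\mu(Y)$ induces a bijection $\widehat{\mathcal T}_A^s\to\mathcal T_A^s$. Here $\mathcal T_A^s$ is a disjoint union, in which a tail may occur in several summands; the claim is that there is a bijection $\widehat{\mathcal T}_A^s\to\mathcal T_A^s$ sending each $Y$ to a copy of the tail $\mu(Y)$. -/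

import Mathlib

open CategoryTheory CategoryTheory.Limits AlgebraicGeometry TopologicalSpace
open scoped PowerSeries

universe u

namespace AbelJacobi

/-! ### Subcurves and tails

A curve enters here through its underlying topological space: its irreducible components, their
unions and the points where such unions meet. -/

section Tails

variable {X : Type u} [TopologicalSpace X]

/-- A subcurve is a (possibly empty) union of irreducible components. -/
def IsSubcurve (Z : Set X) : Prop :=
  ∃ S : Set (Set X), S ⊆ irreducibleComponents X ∧ Z = ⋃₀ S

/-- The complementary curve `Z^c` of a subcurve `Z`: the closure of the complement. -/
def complCurve (Z : Set X) : Set X := closure Zᶜ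

/-- The set of terminal points `Term_Z = Z ∩ Z^c`; it is empty for `Z = ∅` and for the whole
curve. -/
def Term (Z : Set X) : Set X := Z ∩ complCurve Z

/-- A tail is a subcurve `Z` such that `Z` and `Z^c` are connected (in particular nonempty, so
that `Z` is a proper nonempty subcurve). -/
def IsTail (Z : Set X) : Prop :=
  IsSubcurve Z ∧ IsConnected Z ∧ IsConnected (complCurve Z)

/-- A `k`-tail is a tail with exactly `k` terminal points. -/
def IsKTail (k : ℕ) (Z : Set X) : Prop := IsTail Z ∧ (Term Z).encard = k

/-- The pair `(Z, Z')` is free: `Z` and `Z'` have no common terminal point. -/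
def IsFree (Z Z' : Set X) : Prop := Disjoint (Term Z) (Term Z')

/-- The relation `Z ≺ Z'`: strict inclusion and no common terminal point. -/
def Prec (Z Z' : Set X) : Prop := Z ⊂ Z' ∧ IsFree Z Z'

/-- The members `W₀ ≺ W₁ ≺ …` of the nested chain extracted from a collection `𝒯` of subcurves:
`W₀` is minimal (for inclusion) in `𝒯`, and `Wₜ` is minimal among the `Z ∈ 𝒯` with
`Wₜ₋₁ ≺ Z`. -/
inductive InNestedChain (𝒯 : Set (Set X)) : Set X → Prop
  | first {W : Set X} : Minimal (fun Z => Z ∈ 𝒯) W → InNestedChain 𝒯 W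
  | next {W W' : Set X} : InNestedChain 𝒯 W →
      Minimal (fun Z => Z ∈ 𝒯 ∧ Prec W Z) W' → InNestedChain 𝒯 W'

/-- The set of nested `1`-tails associated to `D`, with respect to the base point `P`. -/
def nestedOne (P : X) (D : Set X) : Set (Set X) :=
  {Z | IsKTail 1 Z ∧ D ⊆ Z ∧ P ∈ complCurve Z}

/-- The set of nested `2`-tails associated to the pair `(D, D')`. -/
def nestedTwo (P : X) (D D' : Set X) : Set (Set X) :=
  {W | InNestedChain {Z | IsKTail 2 Z ∧ D ∪ D' ⊆ Z ∧ P ∈ complCurve Z} W}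

/-- The set of nested `3`-tails associated to the pair `(D, D')`: only the `3`-tails that are
free with respect to every nested `2`-tail of the pair are considered. -/
def nestedThree (P : X) (D D' : Set X) : Set (Set X) :=
  {W | InNestedChain {Z | IsKTail 3 Z ∧ (∀ V ∈ nestedTwo P D D', IsFree Z V) ∧
    D ∪ D' ⊆ Z ∧ P ∈ complCurve Z} W}

/-- The type of nested `s`-tails associated to the pair `(D, D')`, for `s = 1, 2, 3`. For `s = 1`
it is the disjoint union of the nested `1`-tails of `D` and of those of `D'`. -/
def NestedTail (P : X) (D D' : Set X) : ℕ → Type u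
  | 1 => nestedOne P D ⊕ nestedOne P D'
  | 2 => nestedTwo P D D'
  | 3 => nestedThree P D D'
  | _ => PEmpty

/-- The tail underlying an element of `NestedTail`. -/
def NestedTail.tail {P : X} {D D' : Set X} : {s : ℕ} → NestedTail P D D' s → Set X
  | 1, Sum.inl Z => Z.1
  | 1, Sum.inr Z => Z.1
  | 2, Z => Z.1
  | 3, Z => Z.1

/-- The disjoint union of the nested `s`-tails attached to the three pairs `(D₁, D₂)`,
`(D₁, D₂')` and `(D₁', D₂)`. -/
abbrev NestedTailA (P : X) (D₁ D₁' D₂ D₂' : Set X) (s : ℕ) : Type u :=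
  NestedTail P D₁ D₂ s ⊕ (NestedTail P D₁ D₂' s ⊕ NestedTail P D₁' D₂ s)

/-- The tail underlying an element of `NestedTailA`. -/
def NestedTailA.tail {P : X} {D₁ D₁' D₂ D₂' : Set X} {s : ℕ} :
    NestedTailA P D₁ D₁' D₂ D₂' s → Set X
  | Sum.inl Z => Z.tail
  | Sum.inr (Sum.inl Z) => Z.tail
  | Sum.inr (Sum.inr Z) => Z.tail

/-- The combinatorial condition of quasistability for a distinguished point lying over
`(R₁, R₂)` on the strict transforms of `D₁ × D₂`, `D₁ × D₂'` and `D₁' × D₂`: at most one of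
`R₁`, `R₂` is a terminal point of some nested `2`- or `3`-tail of `(D₁, D₂)`, and the same holds
for `(D₁', D₂')`. -/
def IsQuasistable (P R₁ R₂ : X) (D₁ D₁' D₂ D₂' : Set X) : Prop :=
  (({R₁, R₂} : Set X) ∩
      ⋃ W ∈ nestedTwo P D₁ D₂ ∪ nestedThree P D₁ D₂, Term W).encard ≤ 1 ∧
  (({R₁, R₂} : Set X) ∩
      ⋃ W ∈ nestedTwo P D₁' D₂' ∪ nestedThree P D₁' D₂', Term W).encard ≤ 1

/-- `s`-synchronization: the map `Z ↦ μ(Z)` induces a bijection from the nested `s`-tails of `Y`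
associated to `(E₁, E₂)` onto the disjoint union of the nested `s`-tails of `X` associated to the
three pairs. As a tail of `X` may occur in several summands, "induces" means that there is a
bijection sending every `Z` to a copy of `μ(Z)`. -/
def IsSynchronizedAt {Y : Type u} [TopologicalSpace Y] (μ : Y → X) (P' : Y) (E₁ E₂ : Set Y)
    (P : X) (D₁ D₁' D₂ D₂' : Set X) (s : ℕ) : Prop :=
  ∃ f : NestedTail P' E₁ E₂ s ≃ NestedTailA P D₁ D₁' D₂ D₂' s,
    ∀ Z : NestedTail P' E₁ E₂ s, NestedTailA.tail (f Z) = μ '' Z.tail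

end Tails

/-! ### Nodal curves -/

section Curves

variable (K : Type u) [Field K]

/-- The completion of the local ring of `X` at `x`. -/
abbrev completedStalk {X : Scheme.{u}} (x : X) : Type u :=
  AdicCompletion (IsLocalRing.maximalIdeal (X.presheaf.stalk x)) (X.presheaf.stalk x)

/-- A smooth point of a curve over an algebraically closed field: a closed point whose completed
local ring is `K⟦t⟧`. -/
def IsSmoothPoint {X : Scheme.{u}} (x : X) : Prop :=
  IsClosed ({x} : Set X) ∧ Nonempty (completedStalk x ≃+* K⟦X⟧)

/-- A node: a closed point whose completed local ring is `K⟦x, y⟧ / (x y)`. -/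
def IsNode {X : Scheme.{u}} (x : X) : Prop :=
  IsClosed ({x} : Set X) ∧
    Nonempty (completedStalk x ≃+*
      MvPowerSeries (Fin 2) K ⧸
        Ideal.span {(MvPowerSeries.X 0 * MvPowerSeries.X 1 : MvPowerSeries (Fin 2) K)})

/-- A nodal curve over the algebraically closed field `K`: a connected, reduced, one-dimensional
scheme which is proper over `K` (for curves over a field this is the same as projective), all of
whose closed points are smooth points or nodes. -/
structure IsNodalCurve {C : Scheme.{u}} (p : C ⟶ Spec (.of K)) : Prop where
  proper : IsProper p
  reduced : IsReduced C
  connected : ConnectedSpace C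
  dim_eq_one : topologicalKrullDim C = 1
  smooth_or_node : ∀ x : C, IsClosed ({x} : Set C) → IsSmoothPoint K x ∨ IsNode K x

attribute [local instance] MvPolynomial.gradedAlgebra

/-- The projective line over `K`. -/
noncomputable abbrev projLine : Scheme.{u} :=
  Proj (MvPolynomial.homogeneousSubmodule (Fin 2) K)

/-- The structure morphism of the projective line. -/
noncomputable abbrev projLineToSpec : projLine K ⟶ Spec (.of K) :=
  Proj.toSpecZero (MvPolynomial.homogeneousSubmodule (Fin 2) K) ≫
    Spec.map (CommRingCat.ofHom (algebraMap K (MvPolynomial.homogeneousSubmodule (Fin 2) K 0)))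

/-- The closed subset `E` of `X`, with its reduced structure, is a smooth rational curve, that is,
isomorphic to the projective line over `K`. -/
def IsSmoothRational {X : Scheme.{u}} (q : X ⟶ Spec (.of K)) (E : Set X) : Prop :=
  ∃ i : projLine K ⟶ X, IsClosedImmersion i ∧ i ≫ q = projLineToSpec K ∧ Set.range i = E

end Curves

/-! ### Strict transforms -/

/-- The largest open subset of the target over which `f` is an isomorphism. -/
def isoLocus {X Y : Scheme.{u}} (f : X ⟶ Y) : Y.Opens :=
  sSup {U : Y.Opens | IsIso (f ∣_ U)}

/-- The strict transform of a closed subset `W` via a birational morphism `f`. -/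
def strictTransform {X Y : Scheme.{u}} (f : X ⟶ Y) (W : Set Y) : Set X :=
  closure (f ⁻¹' (W ∩ (isoLocus f : Set Y)))

/-! ### The curve `C(2)` -/

/-- `μ : X ⟶ C` exhibits the nodal curve `X` as the curve `C(2)`: `μ` is an isomorphism over the
smooth locus of `C` (the complement of the nodes), and over every node of `C` it contracts a chain
of two smooth rational components `E`, `E'`, which meet each other in one point and each of which
meets the rest of `X` in one point. -/
structure IsContraction (K : Type u) [Field K] {C X : Scheme.{u}}
    (p : C ⟶ Spec (.of K)) (q : X ⟶ Spec (.of K)) (μ : X ⟶ C) : Prop where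
  curve : IsNodalCurve K q
  comp_eq : μ ≫ p = q
  iso_smooth : ∃ U : C.Opens, (U : Set C) = {x | IsNode K x}ᶜ ∧ IsIso (μ ∣_ U)
  chain : ∀ S : C, IsNode K S → ∃ E E' : Set X,
    E ∈ irreducibleComponents X ∧ E' ∈ irreducibleComponents X ∧
    IsSmoothRational K q E ∧ IsSmoothRational K q E' ∧
    μ ⁻¹' {S} = E ∪ E' ∧
    (∃ z, E ∩ E' = {z}) ∧
    (∃ z, E ∩ closure (μ ⁻¹' {S})ᶜ = {z}) ∧
    (∃ z, E' ∩ closure (μ ⁻¹' {S})ᶜ = {z})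

/-- The exceptional component `E_{S,D}` of `C(2)` contracted to the node `S ∈ D` and meeting the
strict transform of the component `D` of `C`. -/
def excComponent {C X : Scheme.{u}} (μ : X ⟶ C) (S : C) (D : Set C) : Set X :=
  ⋃₀ {E | E ∈ irreducibleComponents X ∧ E ⊆ μ ⁻¹' {S} ∧ (E ∩ strictTransform μ D).Nonempty}

/-! ### Smoothings, blowups and distinguished points -/

/-- `π : 𝒞 ⟶ Spec K⟦t⟧` is a smoothing of the nodal curve `p : C ⟶ Spec K`: a proper flat morphism
with regular total space whose special fiber is identified with `C` by `ι : C ⟶ 𝒞`. -/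
structure IsSmoothing (K : Type u) [Field K] {C 𝒞 : Scheme.{u}} (p : C ⟶ Spec (.of K))
    (π : 𝒞 ⟶ Spec (.of K⟦X⟧)) (ι : C ⟶ 𝒞) : Prop where
  proper : IsProper π
  flat : Flat π
  regular : ∀ x : 𝒞, IsRegularLocalRing (𝒞.presheaf.stalk x)
  isPullback : IsPullback ι p π (Spec.map (CommRingCat.ofHom (PowerSeries.constantCoeff (R := K))))

/-- The closed subscheme defined by `I` is an effective Cartier divisor: locally `I` is generated
by one nonzerodivisor. -/
def IsEffectiveCartier {X : Scheme.{u}} (I : X.IdealSheafData) : Prop :=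
  ∀ x : X, ∃ U : X.affineOpens, x ∈ (U : X.Opens) ∧
    ∃ a ∈ nonZeroDivisors Γ(X, U), I.ideal U = Ideal.span {a}

/-- `b : X' ⟶ X` is the blowup of `X` along the closed subscheme defined by `I`, by its universal
property. -/
structure IsBlowup {X X' : Scheme.{u}} (b : X' ⟶ X) (I : X.IdealSheafData) : Prop where
  cartier : IsEffectiveCartier (I.comap b)
  existsUnique_lift : ∀ {T : Scheme.{u}} (g : T ⟶ X), IsEffectiveCartier (I.comap g) →
    ∃! h : T ⟶ X', h ≫ b = g

/-- The reduced ideal sheaf of the strict transform of `W` via `f`. -/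
noncomputable def strictTransformIdeal {X Y : Scheme.{u}} (f : X ⟶ Y) (W : Set Y) :
    X.IdealSheafData :=
  Scheme.IdealSheafData.vanishingIdeal ⟨strictTransform f W, isClosed_closure⟩

section Double

variable {B C 𝒞 : Scheme.{u}} (π : 𝒞 ⟶ B) (ι : C ⟶ 𝒞)

/-- The Weil divisor `Z₁ × Z₂` of `𝒞² = 𝒞 ×_B 𝒞`, for subcurves `Z₁`, `Z₂` of the special fiber
`C`. -/
def prodDivisor (Z₁ Z₂ : Set C) : Set ↥(pullback π π) :=
  {y | pullback.fst π π y ∈ ι '' Z₁ ∧ pullback.snd π π y ∈ ι '' Z₂}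

/-- A chain of blowups over `𝒞²`: the first is the blowup along the diagonal subscheme, and each
further one is the blowup along the strict transform of a Weil divisor `Z₁ × Z₂`, for subcurves
`Z₁`, `Z₂` of `C`. -/
inductive IsBlowupChain : {X : Scheme.{u}} → (X ⟶ pullback π π) → Prop
  | diagonal {X : Scheme.{u}} (b : X ⟶ pullback π π) :
      IsBlowup b (pullback.diagonal π).ker → IsBlowupChain b
  | step {X X' : Scheme.{u}} (f : X ⟶ pullback π π) (b : X' ⟶ X) (Z₁ Z₂ : Set C) :
      IsBlowupChain f → IsSubcurve Z₁ → IsSubcurve Z₂ →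
      IsBlowup b (strictTransformIdeal f (prodDivisor π ι Z₁ Z₂)) → IsBlowupChain (b ≫ f)

/-- A good partial desingularization of `𝒞²`: a chain of blowups as above, such that the strict
transform of every divisor `Z₁ × Z₂` is a Cartier divisor. -/
structure IsGoodPartialDesingularization {T : Scheme.{u}} (φ : T ⟶ pullback π π) : Prop where
  chain : IsBlowupChain π ι φ
  cartier : ∀ Z₁ Z₂ : Set C, IsSubcurve Z₁ → IsSubcurve Z₂ →
    IsEffectiveCartier (strictTransformIdeal φ (prodDivisor π ι Z₁ Z₂))

/-- `A` is a distinguished point, lying over `(R₁, R₂)`, on the strict transforms of `D₁ × D₂`,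
`D₁ × D₂'` and `D₁' × D₂`, where these are three distinct pairs of irreducible components
of `C`. -/
structure IsDistinguishedPoint {T : Scheme.{u}} (φ : T ⟶ pullback π π) (A : T) (R₁ R₂ : C)
    (D₁ D₁' D₂ D₂' : Set C) : Prop where
  comp₁ : D₁ ∈ irreducibleComponents C
  comp₁' : D₁' ∈ irreducibleComponents C
  comp₂ : D₂ ∈ irreducibleComponents C
  comp₂' : D₂' ∈ irreducibleComponents C
  distinct : [(D₁, D₂), (D₁, D₂'), (D₁', D₂)].Nodup
  mem : A ∈ strictTransform φ (prodDivisor π ι D₁ D₂)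
  mem' : A ∈ strictTransform φ (prodDivisor π ι D₁ D₂')
  mem'' : A ∈ strictTransform φ (prodDivisor π ι D₁' D₂)
  fst_eq : pullback.fst π π (φ A) = ι R₁
  snd_eq : pullback.snd π π (φ A) = ι R₂

end Double

end AbelJacobi

/-! A curve enters only through its dual graph. A subcurve is a set of vertices and its terminal
points are the edges of its cut. For k = 2, 3, a k-tail is a set avoiding the component of P with k
outgoing edges, none of them a bridge (`isConnSet_and_compl_iff`). The dual graph of C(2) replaces
every edge by a path of three edges. The two exceptional components in question become the new
vertices next to the sources of darts d₁, d₂ lying over R₁, R₂.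

The size of a cut is submodular (`card_cut_add_card_cut`), and a proper nonempty cut without bridges
has at least two edges. Hence the 2-tails containing a given nonempty set, and then the 3-tails free
from their chain, are closed under intersection. So minimal members are least, the chains are
greedy, and every member of such a family shares an outgoing edge with a member of its chain
(`IsMeetFamily.exists_not_disjoint`).

A set U of components of C has three lifts to C(2), cut at the first, middle or last edge of each
path, and these are nested for ≺. One step S ≺ U for C amounts to three steps for C(2). The heart of
the matter is a count: U belongs to as many of the families of the three pairs as there are
positions at which it lifts into the family of C(2). Granting this, the greedy chain of C(2) runs
cyclically through the three chains of C, its m-th member lying over the (m / 3)-th member of the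
chain selected by m mod 3 (`IsInterlaced.exists_perm`). The bijection follows
(`exists_equiv_of_isInterlaced`).

For 2-tails the count depends only on which ends of d₁ and d₂ lie in U. It fails exactly when U
contains both sources and no target, or both targets and no source. Then R₁ and R₂ would both be
terminal for the first nested 2-tail of one of the two pairs in the definition of quasistability
(`isInterlaced_twoTails`).

For 3-tails the families themselves depend on the chains of 2-tails, whose shape for C(2) must be
known. A member is cut on two paths, and along the chain the position on a path moves forward by one
edge at a time (`Setup.prev_level`, `Setup.next_level`). From the first member cut uniformly at
position 0 on, all members are uniform. Let U be a 3-tail whose last lift is free. At most one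
outgoing dart of U is cut by the chain (`Setup.eq_of_used`). The chain members cutting it have
consecutive indices, which matches the spoiled positions with the spoiled residues mod 3, that is,
with the pairs for which U is not free. The boundary cases, where d₁ or d₂ leaves U or the first
member, use quasistability once more (`SyncSetup.counts`, `isInterlaced_threeTails`).

A 1-tail of C(2) is cut at one edge, hence is a uniform lift, and is matched by hand
(`exists_equiv_nestedOne`).

The geometric input is that both dual graphs are as described. Through the injection of a local ring
into its completion, a node lies on at most two components and a smooth point on exactly one. -/

namespace DualGraph

/-! ### Cuts in multigraphs

A multigraph with vertices `V` and edges `E` is given by the source map `s : E × Bool → V` of its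
darts. -/

section Cuts

variable {V E : Type*} (s : E × Bool → V)

/-- The same edge with the opposite orientation. -/
def rev (d : E × Bool) : E × Bool := (d.1, !d.2)

@[simp] lemma rev_rev (d : E × Bool) : rev (rev d) = d := by simp [rev]

@[simp] lemma rev_fst (d : E × Bool) : (rev d).1 = d.1 := rfl

lemma rev_ne (d : E × Bool) : rev d ≠ d := by
  intro h
  have := congrArg Prod.snd h
  simp [rev] at this

lemma eq_or_eq_rev_of_fst {d d' : E × Bool} (h : d'.1 = d.1) : d' = d ∨ d' = rev d := by
  obtain ⟨e, b⟩ := d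
  obtain ⟨e', b'⟩ := d'
  obtain rfl : e' = e := h
  cases b <;> cases b' <;> simp [rev]

/-- The edges with exactly one end in `S`. -/
def cut (S : Set V) : Set E := {e | ¬(s (e, false) ∈ S ↔ s (e, true) ∈ S)}

/-- The dart `d` leaves `S`. -/
def Out (S : Set V) (d : E × Bool) : Prop := s d ∈ S ∧ s (rev d) ∉ S

variable {s}

lemma mem_cut_iff {S : Set V} (d : E × Bool) :
    d.1 ∈ cut s S ↔ ¬(s d ∈ S ↔ s (rev d) ∈ S) := by
  obtain ⟨e, _ | _⟩ := d
  · simp [cut, rev]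
  · simp only [cut, rev, Set.mem_ofPred_eq, Bool.not_true]
    tauto

lemma Out.mem_cut {S : Set V} {d : E × Bool} (h : Out s S d) : d.1 ∈ cut s S := by
  rw [mem_cut_iff]
  unfold Out at h
  tauto

lemma exists_out_of_mem_cut {S : Set V} {e : E} (h : e ∈ cut s S) : ∃ d, d.1 = e ∧ Out s S d := by
  by_cases h1 : s (e, false) ∈ S
  · refine ⟨(e, false), rfl, h1, ?_⟩
    have := (mem_cut_iff (e, false)).1 h
    tauto
  · refine ⟨(e, true), rfl, ?_, ?_⟩
    · have := (mem_cut_iff (e, true)).1 h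
      simp only [rev, Bool.not_true] at this
      tauto
    · simpa [rev] using h1

lemma out_or_out_rev {S : Set V} {d : E × Bool} (h : d.1 ∈ cut s S) :
    Out s S d ∨ Out s S (rev d) := by
  rw [mem_cut_iff] at h
  simp only [Out, rev_rev]
  tauto

variable (s)

/-- Every nontrivial set of vertices has an edge leaving it. -/
def IsConn : Prop := ∀ S : Set V, cut s S = ∅ → S = ∅ ∨ S = Set.univ

/-- An edge which disconnects the graph. -/
def IsBridge (e : E) : Prop := ∃ T : Set V, cut s T = {e}

/-- The sets of vertices avoiding `P` with `k` outgoing edges, none of them a bridge. For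
`k = 2, 3` these are the `k`-tails. -/
def tails (P : V) (k : ℕ) : Set (Set V) :=
  {S | P ∉ S ∧ (cut s S).ncard = k ∧ ∀ e ∈ cut s S, ¬ IsBridge s e}

variable {s}

lemma cut_compl (S : Set V) : cut s Sᶜ = cut s S := by
  ext e; simp only [cut, Set.mem_ofPred_eq, Set.mem_compl_iff]; tauto

lemma cut_inter_subset (S T : Set V) : cut s (S ∩ T) ⊆ cut s S ∪ cut s T := by
  intro e; simp only [cut, Set.mem_ofPred_eq, Set.mem_inter_iff, Set.mem_union]; tauto

lemma cut_union_subset (S T : Set V) : cut s (S ∪ T) ⊆ cut s S ∪ cut s T := by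
  intro e; simp only [cut, Set.mem_ofPred_eq, Set.mem_union]; tauto

/-- Submodularity with its defect made explicit: the edges in both cuts either run from S ∩ T to the
complement of S ∪ T, and are counted by both terms on the right, or join S \ T to T \ S and are
counted by neither. The last term is twice the number of the latter. -/
lemma card_cut_add_card_cut [Finite E] (S T : Set V) :
    (cut s S).ncard + (cut s T).ncard = (cut s (S ∩ T)).ncard + (cut s (S ∪ T)).ncard +
      2 * ((cut s S ∩ cut s T) \ (cut s (S ∩ T) ∪ cut s (S ∪ T))).ncard := by
  set X := (cut s S ∩ cut s T) \ (cut s (S ∩ T) ∪ cut s (S ∪ T)) with hX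
  have h1 : cut s S ∪ cut s T = (cut s (S ∩ T) ∪ cut s (S ∪ T)) ∪ X := by
    ext e; simp only [hX, cut, Set.mem_ofPred_eq, Set.mem_inter_iff, Set.mem_union, Set.mem_sdiff]
    tauto
  have h2 : cut s S ∩ cut s T = (cut s (S ∩ T) ∩ cut s (S ∪ T)) ∪ X := by
    ext e; simp only [hX, cut, Set.mem_ofPred_eq, Set.mem_inter_iff, Set.mem_union, Set.mem_sdiff]
    tauto
  have d1 : Disjoint (cut s (S ∩ T) ∪ cut s (S ∪ T)) X := Set.disjoint_sdiff_right
  have d2 : Disjoint (cut s (S ∩ T) ∩ cut s (S ∪ T)) X :=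
    d1.mono_left (Set.inter_subset_left.trans Set.subset_union_left)
  have e1 := Set.ncard_union_eq d1
  have e2 := Set.ncard_union_eq d2
  rw [← h1] at e1
  rw [← h2] at e2
  have e3 := Set.ncard_union_add_ncard_inter (cut s S) (cut s T)
  have e4 := Set.ncard_union_add_ncard_inter (cut s (S ∩ T)) (cut s (S ∪ T))
  omega

/-- Connectedness excludes an empty cut, and a cut with a single edge would make that edge a bridge.
-/
lemma two_le_ncard_cut [Finite E] (hs : IsConn s) {P : V} {S : Set V} (hP : P ∉ S)
    (hne : S.Nonempty) (hb : ∀ e ∈ cut s S, ¬ IsBridge s e) : 2 ≤ (cut s S).ncard := by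
  have h0 : (cut s S).ncard ≠ 0 := by
    rw [Ne, Set.ncard_eq_zero]
    intro h
    rcases hs S h with h | h
    · exact hne.ne_empty h
    · exact hP (h ▸ Set.mem_univ P)
  have h1 : (cut s S).ncard ≠ 1 := by
    rw [Ne, Set.ncard_eq_one]
    rintro ⟨e, he⟩
    exact hb e (he ▸ rfl) ⟨S, he⟩
  omega

lemma not_isBridge_inter {S T : Set V} (hS : ∀ e ∈ cut s S, ¬ IsBridge s e)
    (hT : ∀ e ∈ cut s T, ¬ IsBridge s e) : ∀ e ∈ cut s (S ∩ T), ¬ IsBridge s e := fun e he =>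
  (cut_inter_subset S T he).elim (hS e) (hT e)

lemma not_isBridge_union {S T : Set V} (hS : ∀ e ∈ cut s S, ¬ IsBridge s e)
    (hT : ∀ e ∈ cut s T, ¬ IsBridge s e) : ∀ e ∈ cut s (S ∪ T), ¬ IsBridge s e := fun e he =>
  (cut_union_subset S T he).elim (hS e) (hT e)

variable {P : V} {S T : Set V}

/-- In 2 + 2 = a + b + 2x both a and b are at least 2, so a = b = 2. -/
lemma tails_inter_two [Finite E] (hs : IsConn s) (hS : S ∈ tails s P 2) (hT : T ∈ tails s P 2)
    (hne : (S ∩ T).Nonempty) : S ∩ T ∈ tails s P 2 := by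
  have a := card_cut_add_card_cut (s := s) S T
  have bi := not_isBridge_inter hS.2.2 hT.2.2
  have bu := not_isBridge_union hS.2.2 hT.2.2
  have h1 := two_le_ncard_cut hs (P := P) (fun h => hS.1 h.1) hne bi
  have h2 := two_le_ncard_cut hs (P := P) (S := S ∪ T) (fun h => h.elim hS.1 hT.1)
    (hne.mono (Set.inter_subset_left.trans Set.subset_union_left)) bu
  rw [hS.2.1, hT.2.1] at a
  exact ⟨fun h => hS.1 h.1, by omega, bi⟩

/-- In 3 + 2 = a + b + 2x with a, b ≥ 2 the defect x must vanish, which leaves {a, b} = {2, 3} and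
forbids edges between S \ T and T \ S. -/
lemma tails_three_two [Finite E] (hs : IsConn s) (hS : S ∈ tails s P 3) (hT : T ∈ tails s P 2)
    (hne : (S ∩ T).Nonempty) :
    ((S ∩ T ∈ tails s P 2 ∧ S ∪ T ∈ tails s P 3) ∨
      (S ∩ T ∈ tails s P 3 ∧ S ∪ T ∈ tails s P 2)) ∧
    ∀ d, s d ∈ S → s d ∉ T → s (rev d) ∈ T → s (rev d) ∈ S := by
  have a := card_cut_add_card_cut (s := s) S T
  have bi := not_isBridge_inter hS.2.2 hT.2.2
  have bu := not_isBridge_union hS.2.2 hT.2.2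
  have pi : P ∉ S ∩ T := fun h => hS.1 h.1
  have pu : P ∉ S ∪ T := fun h => h.elim hS.1 hT.1
  have h1 := two_le_ncard_cut hs (P := P) pi hne bi
  have h2 := two_le_ncard_cut hs (P := P) (S := S ∪ T) pu
    (hne.mono (Set.inter_subset_left.trans Set.subset_union_left)) bu
  rw [hS.2.1, hT.2.1] at a
  refine ⟨?_, ?_⟩
  · have : ((cut s (S ∩ T)).ncard = 2 ∧ (cut s (S ∪ T)).ncard = 3) ∨
        ((cut s (S ∩ T)).ncard = 3 ∧ (cut s (S ∪ T)).ncard = 2) := by omega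
    rcases this with ⟨x, y⟩ | ⟨x, y⟩
    · exact Or.inl ⟨⟨pi, x, bi⟩, pu, y, bu⟩
    · exact Or.inr ⟨⟨pi, x, bi⟩, pu, y, bu⟩
  · intro d hd1 hd2 hd3
    by_contra hd4
    have hX : ((cut s S ∩ cut s T) \ (cut s (S ∩ T) ∪ cut s (S ∪ T))).ncard = 0 := by omega
    rw [Set.ncard_eq_zero] at hX
    have : d.1 ∈ ((cut s S ∩ cut s T) \ (cut s (S ∩ T) ∪ cut s (S ∪ T))) := by
      simp only [Set.mem_sdiff, Set.mem_inter_iff, Set.mem_union, mem_cut_iff]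
      tauto
    rw [hX] at this
    exact this

/-- In 3 + 3 = a + b + 2x with a, b ≥ 2, a value a ≥ 4 forces b = 2. The alternatives with a 2-tail
are later excluded by freeness. -/
lemma tails_three_three [Finite E] (hs : IsConn s) (hS : S ∈ tails s P 3) (hT : T ∈ tails s P 3)
    (hne : (S ∩ T).Nonempty) :
    S ∩ T ∈ tails s P 3 ∨ S ∩ T ∈ tails s P 2 ∨ S ∪ T ∈ tails s P 2 := by
  have a := card_cut_add_card_cut (s := s) S T
  have bi := not_isBridge_inter hS.2.2 hT.2.2
  have bu := not_isBridge_union hS.2.2 hT.2.2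
  have pi : P ∉ S ∩ T := fun h => hS.1 h.1
  have pu : P ∉ S ∪ T := fun h => h.elim hS.1 hT.1
  have h1 := two_le_ncard_cut hs (P := P) pi hne bi
  have h2 := two_le_ncard_cut hs (P := P) (S := S ∪ T) pu
    (hne.mono (Set.inter_subset_left.trans Set.subset_union_left)) bu
  rw [hS.2.1, hT.2.1] at a
  have : (cut s (S ∩ T)).ncard = 3 ∨ (cut s (S ∩ T)).ncard = 2 ∨ (cut s (S ∪ T)).ncard = 2 := by
    omega
  rcases this with x | x | x
  · exact Or.inl ⟨pi, x, bi⟩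
  · exact Or.inr (Or.inl ⟨pi, x, bi⟩)
  · exact Or.inr (Or.inr ⟨pu, x, bu⟩)

/-- The symmetric difference has an empty cut and misses P, so it is empty. -/
lemma eq_of_cut_eq (hs : IsConn s) (hS : P ∉ S) (hT : P ∉ T) (h : cut s S = cut s T) :
    S = T := by
  have hD : cut s (symmDiff S T) = ∅ := by
    ext e
    have := Set.ext_iff.1 h e
    simp only [cut, Set.mem_ofPred_eq, Set.mem_symmDiff, Set.mem_empty_iff_false] at this ⊢
    tauto
  rcases hs _ hD with h | h
  · exact symmDiff_eq_bot.1 h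
  · have : P ∈ symmDiff S T := h ▸ Set.mem_univ P
    simp only [Set.mem_symmDiff] at this
    tauto

end Cuts

/-! ### Nested chains -/

section Chains

variable {V E : Type*} (s : E × Bool → V)

/-- Strict inclusion without common outgoing edge. -/
def Precedes (Z Z' : Set V) : Prop := Z ⊂ Z' ∧ Disjoint (cut s Z) (cut s Z')

/-- `IsNth s 𝓛 n W`: `W` is the `n`-th member of the nested chain extracted from `𝓛`. -/
def IsNth (𝓛 : Set (Set V)) : ℕ → Set V → Prop
  | 0, W => IsLeast 𝓛 W
  | n + 1, W' => ∃ W, IsNth 𝓛 n W ∧ IsLeast {Z | Z ∈ 𝓛 ∧ Precedes s W Z} W'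

/-- A collection closed under intersections, all of whose members have outgoing edges. -/
structure IsMeetFamily (𝓛 : Set (Set V)) : Prop where
  inter_mem : ∀ Z ∈ 𝓛, ∀ Z' ∈ 𝓛, Z ∩ Z' ∈ 𝓛
  cut_nonempty : ∀ Z ∈ 𝓛, (cut s Z).Nonempty

variable {s} {𝓛 : Set (Set V)} {W W' X Y Z : Set V}

lemma Precedes.subset (h : Precedes s X Y) : X ⊆ Y := h.1.1

lemma Precedes.not_mem (h : Precedes s X Y) {e : E} (he : e ∈ cut s X) (he' : e ∈ cut s Y) :
    False := Set.disjoint_left.1 h.2 he he'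

/-- An edge common to the outer two cuts starts in X and ends outside Z, hence also leaves Y.
Inclusions therefore preserve freeness, and ≺ is transitive and monotone. -/
lemma Precedes.trans_subset (h : Precedes s X Y) (h' : Y ⊆ Z) :
    (∀ e, e ∈ cut s X → e ∈ cut s Z → False) := by
  intro e he he'
  obtain ⟨d, rfl, h1, h2⟩ := exists_out_of_mem_cut he
  have h3 := h.subset h1
  have h4 : s (rev d) ∉ Z := by
    rw [mem_cut_iff] at he'
    have := h' h3
    tauto
  have : d.1 ∈ cut s Y := Out.mem_cut ⟨h3, fun h => h4 (h' h)⟩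
  exact Set.disjoint_left.1 h.2 he this

lemma Precedes.mono_right (h : Precedes s X Y) (h' : Y ⊆ Z) : Precedes s X Z :=
  ⟨h.1.trans_subset h', Set.disjoint_left.2 fun e he he' => h.trans_subset h' e he he'⟩

lemma Precedes.mono_left (h : Precedes s Y Z) (h' : X ⊆ Y) : Precedes s X Z := by
  refine ⟨h.1.trans_le' h', Set.disjoint_left.2 fun e he he' => ?_⟩
  obtain ⟨d, rfl, h1, h2⟩ := exists_out_of_mem_cut he
  have h3 : s d ∈ Z := h.subset (h' h1)
  have h4 : s (rev d) ∉ Z := by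
    rw [mem_cut_iff] at he'
    tauto
  exact Set.disjoint_left.1 h.2 (Out.mem_cut ⟨h' h1, fun h5 => h4 (h.subset h5)⟩) he'

lemma Precedes.trans (h : Precedes s X Y) (h' : Precedes s Y Z) : Precedes s X Z :=
  h.mono_right h'.subset

lemma precedes_of_subset (hne : (cut s X).Nonempty) (h : X ⊆ Y)
    (hd : Disjoint (cut s X) (cut s Y)) : Precedes s X Y := by
  refine ⟨⟨h, fun h' => ?_⟩, hd⟩
  obtain rfl := h.antisymm h'
  obtain ⟨e, he⟩ := hne
  exact Set.disjoint_left.1 hd he he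

lemma IsMeetFamily.precedes_inter (h𝓛 : IsMeetFamily s 𝓛) (hW : W ∈ 𝓛) :
    ∀ Z ∈ {Z | Z ∈ 𝓛 ∧ Precedes s W Z}, ∀ Z' ∈ {Z | Z ∈ 𝓛 ∧ Precedes s W Z},
      Z ∩ Z' ∈ {Z | Z ∈ 𝓛 ∧ Precedes s W Z} := by
  rintro Z ⟨hZ, hWZ⟩ Z' ⟨hZ', hWZ'⟩
  refine ⟨h𝓛.inter_mem Z hZ Z' hZ', precedes_of_subset (h𝓛.cut_nonempty W hW)
    (Set.subset_inter hWZ.subset hWZ'.subset) ?_⟩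
  exact (hWZ.2.union_right hWZ'.2).mono_right (cut_inter_subset _ _)

lemma exists_isLeast_of_inter [Finite V] {𝒮 : Set (Set V)} (hne : 𝒮.Nonempty)
    (h : ∀ Z ∈ 𝒮, ∀ Z' ∈ 𝒮, Z ∩ Z' ∈ 𝒮) : ∃ W, IsLeast 𝒮 W := by
  obtain ⟨W, hW⟩ := (Set.toFinite 𝒮).exists_minimal hne
  refine ⟨W, hW.1, fun Z hZ => ?_⟩
  exact (hW.2 (h W hW.1 Z hZ) Set.inter_subset_left).trans Set.inter_subset_right

/-- In a family closed under intersection the minimal member is unique, so the nested chain may be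
defined by `IsLeast` and indexed by natural numbers. -/
lemma minimal_iff_isLeast {𝒮 : Set (Set V)}
    (h : ∀ Z ∈ 𝒮, ∀ Z' ∈ 𝒮, Z ∩ Z' ∈ 𝒮) : Minimal (fun Z => Z ∈ 𝒮) W ↔ IsLeast 𝒮 W := by
  refine ⟨fun hW => ⟨hW.1, fun Z hZ => ?_⟩, fun hW => ⟨hW.1, fun Z hZ _ => hW.2 hZ⟩⟩
  exact (hW.2 (h W hW.1 Z hZ) Set.inter_subset_left).trans Set.inter_subset_right

lemma IsNth.mem {n : ℕ} (h : IsNth s 𝓛 n W) : W ∈ 𝓛 := by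
  cases n with
  | zero => exact h.1
  | succ n => obtain ⟨_, _, h⟩ := h; exact h.1.1

lemma IsNth.unique {n : ℕ} (h : IsNth s 𝓛 n W) (h' : IsNth s 𝓛 n W') : W = W' := by
  induction n generalizing W W' with
  | zero => exact IsLeast.unique h h'
  | succ n ih =>
    obtain ⟨A, hA, h⟩ := h
    obtain ⟨B, hB, h'⟩ := h'
    obtain rfl := ih hA hB
    exact h.unique h'

lemma IsNth.step {n : ℕ} (h : IsNth s 𝓛 n W) (h' : IsNth s 𝓛 (n + 1) W') :
    IsLeast {Z | Z ∈ 𝓛 ∧ Precedes s W Z} W' := by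
  obtain ⟨A, hA, h'⟩ := h'
  obtain rfl := h.unique hA
  exact h'

lemma IsNth.precedes_succ {n : ℕ} (h : IsNth s 𝓛 n W) (h' : IsNth s 𝓛 (n + 1) W') :
    Precedes s W W' := (h.step h').1.2

lemma IsNth.exists_of_le {m n : ℕ} (h : IsNth s 𝓛 n W) (hmn : m ≤ n) : ∃ W', IsNth s 𝓛 m W' := by
  induction n generalizing W with
  | zero => obtain rfl : m = 0 := by omega
            exact ⟨W, h⟩
  | succ n ih =>
    rcases Nat.lt_or_ge m (n + 1) with h1 | h1
    · obtain ⟨A, hA, _⟩ := h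
      exact ih hA (by omega)
    · obtain rfl : m = n + 1 := by omega
      exact ⟨W, h⟩

lemma IsNth.precedes {m n : ℕ} (h : IsNth s 𝓛 m W) (h' : IsNth s 𝓛 n W') (hmn : m < n) :
    Precedes s W W' := by
  induction n generalizing W' with
  | zero => omega
  | succ n ih =>
    obtain ⟨A, hA, _⟩ := id h'
    have h1 := hA.precedes_succ h'
    rcases Nat.lt_or_ge m n with h2 | h2
    · exact (ih hA h2).trans h1
    · obtain rfl : m = n := by omega
      obtain rfl := h.unique hA
      exact h1

lemma IsNth.subset {m n : ℕ} (h : IsNth s 𝓛 m W) (h' : IsNth s 𝓛 n W') (hmn : m ≤ n) :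
    W ⊆ W' := by
  rcases hmn.lt_or_eq with h1 | rfl
  · exact (h.precedes h' h1).subset
  · exact (h.unique h').subset

lemma IsNth.index_unique {m n : ℕ} (h : IsNth s 𝓛 m W) (h' : IsNth s 𝓛 n W) : m = n := by
  rcases lt_trichotomy m n with h1 | h1 | h1
  · exact absurd rfl (h.precedes h' h1).1.ne
  · exact h1
  · exact absurd rfl (h'.precedes h h1).1.ne

lemma IsNth.eq_of_mem_cut {m n : ℕ} (h : IsNth s 𝓛 m W) (h' : IsNth s 𝓛 n W') {e : E}
    (he : e ∈ cut s W) (he' : e ∈ cut s W') : m = n := by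
  rcases lt_trichotomy m n with h1 | h1 | h1
  · exact absurd he' (Set.disjoint_left.1 (h.precedes h' h1).2 he)
  · exact h1
  · exact absurd he (Set.disjoint_left.1 (h'.precedes h h1).2 he')

lemma IsMeetFamily.exists_zero [Finite V] (h𝓛 : IsMeetFamily s 𝓛) {U : Set V} (hU : U ∈ 𝓛) :
    ∃ W, IsNth s 𝓛 0 W ∧ W ⊆ U := by
  obtain ⟨W, hW⟩ := exists_isLeast_of_inter ⟨U, hU⟩ h𝓛.inter_mem
  exact ⟨W, hW, hW.2 hU⟩

lemma IsMeetFamily.exists_succ [Finite V] (h𝓛 : IsMeetFamily s 𝓛) {n : ℕ} {U : Set V}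
    (hW : IsNth s 𝓛 n W) (hU : U ∈ 𝓛) (h : Precedes s W U) :
    ∃ W', IsNth s 𝓛 (n + 1) W' ∧ W' ⊆ U := by
  obtain ⟨W', hW'⟩ := exists_isLeast_of_inter (𝒮 := {Z | Z ∈ 𝓛 ∧ Precedes s W Z}) ⟨U, hU, h⟩
    (h𝓛.precedes_inter hW.mem)
  exact ⟨W', ⟨W, hW, hW'⟩, hW'.2 ⟨hU, h⟩⟩

/-- Every member of the family shares an outgoing edge with some member of the chain. -/
lemma IsMeetFamily.exists_not_disjoint [Finite V] (h𝓛 : IsMeetFamily s 𝓛) {U : Set V}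
    (hU : U ∈ 𝓛) : ∃ n W, IsNth s 𝓛 n W ∧ ∃ e ∈ cut s W, e ∈ cut s U := by
  by_contra! hcon
  -- Were U free from all members, each member below U would precede U, so the chain would have a
  -- next member below U. It would never stop, although its members grow strictly in a finite set.
  have key : ∀ n, ∃ W, IsNth s 𝓛 n W ∧ W ⊆ U ∧ n ≤ W.ncard := by
    intro n
    induction n with
    | zero =>
      obtain ⟨W, hW, h⟩ := h𝓛.exists_zero hU
      exact ⟨W, hW, h, Nat.zero_le _⟩
    | succ n ih =>
      obtain ⟨W, hW, h, hn⟩ := ih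
      have hp : Precedes s W U := precedes_of_subset (h𝓛.cut_nonempty W hW.mem) h
        (Set.disjoint_left.2 fun e he he' => hcon n W hW e he he')
      obtain ⟨W', hW', h'⟩ := h𝓛.exists_succ hW hU hp
      have := Set.ncard_lt_ncard (hW.precedes_succ hW').1
      exact ⟨W', hW', h', by omega⟩
  obtain ⟨W, -, -, h⟩ := key (Nat.card V + 1)
  have := Set.ncard_le_card W
  omega

/-- If `Z` is free from the chain and `Z ∩ W` belongs to the family for a member `W` of the chain,
then `W` is contained in `Z`. -/
lemma IsMeetFamily.subset_of_inter_mem (h𝓛 : IsMeetFamily s 𝓛) {n : ℕ} (hW : IsNth s 𝓛 n W)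
    (hZ : ∀ m W', IsNth s 𝓛 m W' → Disjoint (cut s Z) (cut s W')) (hU : Z ∩ W ∈ 𝓛) : W ⊆ Z := by
  -- The cut of Z ∩ W lies in those of Z and W, both disjoint from the cut of every earlier member.
  -- So Z ∩ W is a candidate at each stage up to n, and the greedy choice stays below it.
  have key : ∀ m ≤ n, ∃ W', IsNth s 𝓛 m W' ∧ W' ⊆ Z ∩ W := by
    intro m
    induction m with
    | zero =>
      intro _
      obtain ⟨W', hW'⟩ := hW.exists_of_le (Nat.zero_le n)
      exact ⟨W', hW', (show IsLeast 𝓛 W' from hW').2 hU⟩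
    | succ m ih =>
      intro hm
      obtain ⟨W', hW', h⟩ := ih (by omega)
      obtain ⟨W'', hW''⟩ := hW.exists_of_le hm
      refine ⟨W'', hW'', (hW'.step hW'').2 ⟨hU, ?_⟩⟩
      refine precedes_of_subset (h𝓛.cut_nonempty W' hW'.mem) h ?_
      exact ((hZ m W' hW').symm.union_right (hW'.precedes hW (by omega)).2).mono_right
        (cut_inter_subset _ _)
  obtain ⟨W', hW', h⟩ := key n le_rfl
  obtain rfl := hW'.unique hW
  exact h.trans Set.inter_subset_left

end Chains

end DualGraph

namespace DualGraph

/-! ### Replacing every edge by a path of three edges -/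

section Subdivision

variable {V E : Type*} (s : E × Bool → V)

/-- The graph obtained by inserting two vertices on every edge; `Sum.inr d` is the new vertex next
to the source of the dart `d`. -/
def sub : ((E × Bool) ⊕ E) × Bool → V ⊕ (E × Bool)
  | (Sum.inl d, false) => Sum.inl (s d)
  | (Sum.inl d, true) => Sum.inr d
  | (Sum.inr e, b) => Sum.inr (e, b)

/-- The edges of the path replacing an edge, numbered from the source of the dart `d`. -/
def pos (d : E × Bool) : Fin 3 → (E × Bool) ⊕ E
  | 0 => Sum.inl d
  | 1 => Sum.inr d.1
  | 2 => Sum.inl (rev d)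

/-- The original vertices in a set of vertices of the subdivided graph. -/
def base (S : Set (V ⊕ (E × Bool))) : Set V := Sum.inl ⁻¹' S

/-- The set of vertices of the subdivided graph over `S`, whose outgoing edges are in the `p`-th
position. -/
def lift (p : Fin 3) (S : Set V) : Set (V ⊕ (E × Bool)) :=
  {x | Sum.elim (fun v => v ∈ S)
    (fun d => match p with
      | 0 => s d ∈ S ∧ s (rev d) ∈ S
      | 1 => s d ∈ S
      | 2 => s d ∈ S ∨ s (rev d) ∈ S) x}

variable {s} {S U : Set V} {T : Set (V ⊕ (E × Bool))} {d : E × Bool}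

@[simp] lemma mem_base {v : V} : v ∈ base T ↔ Sum.inl v ∈ T := Iff.rfl

@[simp] lemma inl_mem_lift {v : V} {p : Fin 3} : Sum.inl v ∈ lift s p S ↔ v ∈ S := Iff.rfl

@[simp] lemma inr_mem_lift_zero : Sum.inr d ∈ lift s 0 S ↔ s d ∈ S ∧ s (rev d) ∈ S := Iff.rfl

@[simp] lemma inr_mem_lift_one : Sum.inr d ∈ lift s 1 S ↔ s d ∈ S := Iff.rfl

@[simp] lemma inr_mem_lift_two : Sum.inr d ∈ lift s 2 S ↔ s d ∈ S ∨ s (rev d) ∈ S := Iff.rfl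

@[simp] lemma base_lift (p : Fin 3) : base (lift s p S) = S := rfl

@[simp] lemma pos_zero : pos d 0 = Sum.inl d := rfl

@[simp] lemma pos_one : pos d 1 = Sum.inr d.1 := rfl

@[simp] lemma pos_two : pos d 2 = Sum.inl (rev d) := rfl

lemma inl_mem_cut : Sum.inl d ∈ cut (sub s) T ↔ ¬(Sum.inl (s d) ∈ T ↔ Sum.inr d ∈ T) := Iff.rfl

lemma inr_mem_cut :
    Sum.inr d.1 ∈ cut (sub s) T ↔ ¬(Sum.inr d ∈ T ↔ Sum.inr (rev d) ∈ T) := by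
  obtain ⟨e, _ | _⟩ := d
  · exact Iff.rfl
  · change ¬(_ ↔ _) ↔ ¬ (_ ↔ _)
    simp only [sub, rev, Bool.not_true]
    tauto

/-- The edge of the original graph containing an edge of the subdivided graph. -/
def under : (E × Bool) ⊕ E → E := Sum.elim Prod.fst id

@[simp] lemma under_inl : under (Sum.inl d) = d.1 := rfl

@[simp] lemma under_inr {e : E} : under (Sum.inr e : (E × Bool) ⊕ E) = e := rfl

@[simp] lemma under_pos (p : Fin 3) : under (pos d p) = d.1 := by
  fin_cases p <;> rfl

lemma exists_pos (g : (E × Bool) ⊕ E) (d : E × Bool) (h : under g = d.1) : ∃ p, g = pos d p := by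
  rcases g with d' | e
  · rcases eq_or_eq_rev_of_fst h with rfl | rfl
    · exact ⟨0, rfl⟩
    · exact ⟨2, rfl⟩
  · obtain rfl : e = d.1 := h
    exact ⟨1, rfl⟩

lemma pos_injective (d : E × Bool) : Function.Injective (pos d) := by
  intro p q h
  fin_cases p <;> fin_cases q <;> simp_all [pos, rev_ne, (rev_ne _).symm]

lemma pos_mem_cut_lift {p q : Fin 3} (hd : Out s S d) :
    pos d q ∈ cut (sub s) (lift s p S) ↔ q = p := by
  obtain ⟨h1, h2⟩ := hd
  fin_cases p <;> fin_cases q <;> simp [inl_mem_cut, inr_mem_cut, h1, h2]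

lemma under_mem_of_mem_cut_lift {p : Fin 3} {g : (E × Bool) ⊕ E}
    (hg : g ∈ cut (sub s) (lift s p S)) : under g ∈ cut s S := by
  rcases g with d | e
  · rw [under_inl, mem_cut_iff]
    rw [inl_mem_cut] at hg
    fin_cases p <;> simp at hg <;> tauto
  · rw [under_inr, mem_cut_iff (e, false)]
    rw [inr_mem_cut (d := (e, false))] at hg
    fin_cases p <;> simp at hg <;> tauto

lemma mem_cut_lift_iff {p : Fin 3} {g : (E × Bool) ⊕ E} :
    g ∈ cut (sub s) (lift s p S) ↔ ∃ d, Out s S d ∧ g = pos d p := by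
  constructor
  · intro hg
    obtain ⟨d, hd, hO⟩ := exists_out_of_mem_cut (under_mem_of_mem_cut_lift hg)
    obtain ⟨q, rfl⟩ := exists_pos g d hd.symm
    rw [pos_mem_cut_lift hO] at hg
    exact ⟨d, hO, hg ▸ rfl⟩
  · rintro ⟨d, hO, rfl⟩
    exact (pos_mem_cut_lift hO).2 rfl

lemma Out.unique {d' : E × Bool} (h : Out s S d) (h' : Out s S d') (he : d.1 = d'.1) : d = d' := by
  rcases eq_or_eq_rev_of_fst he with rfl | rfl
  · rfl
  · exact absurd h.1 h'.2

lemma ncard_cut_lift [Finite E] (p : Fin 3) :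
    (cut (sub s) (lift s p S)).ncard = (cut s S).ncard := by
  refine Set.ncard_congr (fun g _ => under g) (fun g hg => under_mem_of_mem_cut_lift hg) ?_ ?_
  · intro g g' hg hg' h
    obtain ⟨d, hd, rfl⟩ := mem_cut_lift_iff.1 hg
    obtain ⟨d', hd', rfl⟩ := mem_cut_lift_iff.1 hg'
    simp only [under_pos] at h
    rw [hd.unique hd' h]
  · intro e he
    obtain ⟨d, rfl, hd⟩ := exists_out_of_mem_cut he
    exact ⟨pos d p, mem_cut_lift_iff.2 ⟨d, hd, rfl⟩, under_pos p⟩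

lemma lift_mono {p q : Fin 3} (h : p ≤ q) : lift s p S ⊆ lift s q S := by
  rintro (v | d)
  · exact id
  · fin_cases p <;> fin_cases q <;> simp at h ⊢ <;> tauto

lemma lift_precedes_lift {p q : Fin 3} (h : p < q) (hne : (cut s S).Nonempty) :
    Precedes (sub s) (lift s p S) (lift s q S) := by
  refine precedes_of_subset ?_ (lift_mono h.le) (Set.disjoint_left.2 ?_)
  · obtain ⟨e, he⟩ := hne
    obtain ⟨d, rfl, hd⟩ := exists_out_of_mem_cut he
    exact ⟨pos d p, mem_cut_lift_iff.2 ⟨d, hd, rfl⟩⟩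
  · intro g hg hg'
    obtain ⟨d, hd, rfl⟩ := mem_cut_lift_iff.1 hg
    exact h.ne ((pos_mem_cut_lift hd).1 hg')

/-- Every neighbour of a vertex of S lies in U, for otherwise an edge would leave both sets. So the
paths leaving S end in U, and the two lifted cuts lie over disjoint cuts. -/
lemma Precedes.lift_two_zero (h : Precedes s S U) (hne : (cut s S).Nonempty) :
    Precedes (sub s) (lift s 2 S) (lift s 0 U) := by
  refine precedes_of_subset ?_ ?_ (Set.disjoint_left.2 ?_)
  · obtain ⟨e, he⟩ := hne
    obtain ⟨d, rfl, hd⟩ := exists_out_of_mem_cut he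
    exact ⟨pos d 2, mem_cut_lift_iff.2 ⟨d, hd, rfl⟩⟩
  · have key : ∀ d, s d ∈ S → s (rev d) ∈ U := by
      intro d hd
      by_contra h2
      have h1 := h.subset hd
      refine h.not_mem (e := d.1) ?_ ?_
      · exact Out.mem_cut ⟨hd, fun h3 => h2 (h.subset h3)⟩
      · exact Out.mem_cut ⟨h1, h2⟩
    rintro (v | d)
    · exact fun hv => h.subset hv
    · rintro (hd | hd)
      · exact ⟨h.subset hd, key d hd⟩
      · have := key _ hd
        rw [rev_rev] at this
        exact ⟨this, h.subset hd⟩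
  · intro g hg hg'
    exact Set.disjoint_left.1 h.2 (under_mem_of_mem_cut_lift hg) (under_mem_of_mem_cut_lift hg')

lemma base_mono {T' : Set (V ⊕ (E × Bool))} (h : T ⊆ T') : base T ⊆ base T' := fun _ hv => h hv

/-- A predecessor must retreat by at least one edge on every path: a new vertex reached only through
the last edge of a path would make T and T' share that edge. The next two lemmas retreat to position
0 and then to a full step below U. -/
lemma Precedes.subset_lift_one {T' : Set (V ⊕ (E × Bool))} (h : Precedes (sub s) T T')
    (hU : T' ⊆ lift s 2 U) : T ⊆ lift s 1 U := by
  rintro (v | d) hx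
  · exact hU (h.subset hx)
  · by_contra hd
    have h1 := h.subset hx
    have h2 : (Sum.inl (s d) : V ⊕ (E × Bool)) ∉ T' := fun h2 => hd (hU h2)
    refine h.not_mem (e := Sum.inl d) ?_ ?_
    · rw [inl_mem_cut]
      have : (Sum.inl (s d) : V ⊕ (E × Bool)) ∉ T := fun h3 => h2 (h.subset h3)
      tauto
    · rw [inl_mem_cut]
      tauto

lemma Precedes.subset_lift_zero {T' : Set (V ⊕ (E × Bool))} (h : Precedes (sub s) T T')
    (hU : T' ⊆ lift s 1 U) : T ⊆ lift s 0 U := by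
  rintro (v | d) hx
  · exact hU (h.subset hx)
  · have h1 := h.subset hx
    refine ⟨hU h1, ?_⟩
    by_contra hd
    have h2 : (Sum.inr (rev d) : V ⊕ (E × Bool)) ∉ T' := fun h2 => hd (hU h2)
    refine h.not_mem (e := Sum.inr d.1) ?_ ?_
    · rw [inr_mem_cut]
      have : (Sum.inr (rev d) : V ⊕ (E × Bool)) ∉ T := fun h3 => h2 (h.subset h3)
      tauto
    · rw [inr_mem_cut]
      tauto

lemma Precedes.base_precedes {T' : Set (V ⊕ (E × Bool))} (h : Precedes (sub s) T T')
    (hU : T' ⊆ lift s 0 U) (hne : (cut s (base T)).Nonempty) : Precedes s (base T) U := by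
  refine precedes_of_subset hne ?_ (Set.disjoint_left.2 ?_)
  · exact fun v hv => hU (h.subset hv)
  · intro e he he'
    obtain ⟨d, rfl, h1, h2⟩ := exists_out_of_mem_cut he
    have h3 : s d ∈ U := hU (h.subset h1)
    have h4 : s (rev d) ∉ U := by
      rw [mem_cut_iff] at he'
      tauto
    have h5 : (Sum.inr d : V ⊕ (E × Bool)) ∉ T' := fun h6 => h4 (hU h6).2
    refine h.not_mem (e := Sum.inl d) ?_ ?_
    · rw [inl_mem_cut]
      have := fun h6 => h5 (h.subset h6)
      have : (Sum.inl (s d) : V ⊕ (E × Bool)) ∈ T := h1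
      tauto
    · rw [inl_mem_cut]
      have : (Sum.inl (s d) : V ⊕ (E × Bool)) ∈ T' := h.subset h1
      tauto

/-! ### Interlacing three nested chains. -/

variable (s) in
/-- The conditions under which the nested chain of a collection `𝓜` on the subdivided graph is
obtained by interlacing the nested chains of three collections on the original graph. -/
structure IsInterlaced (𝓜 : Set (Set (V ⊕ (E × Bool)))) (F : Fin 3 → Set (Set V)) : Prop where
  hat : IsMeetFamily (sub s) 𝓜
  fam : ∀ i, IsMeetFamily s (F i)
  subset_lift : ∀ Z ∈ 𝓜, Z ⊆ lift s 2 (base Z)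
  lift_two : ∀ Z ∈ 𝓜, lift s 2 (base Z) ∈ 𝓜
  lift_mem : ∀ Z ∈ 𝓜, ∀ U p, Z ⊆ lift s p U → lift s 2 U ∈ 𝓜 → lift s p U ∈ 𝓜
  lift_of_mem : ∀ i, ∀ U ∈ F i, lift s 2 U ∈ 𝓜
  upper : ∀ i, ∀ U ∈ F i, ∀ U', U ⊆ U' → lift s 2 U' ∈ 𝓜 → U' ∈ F i
  -- The remaining conditions are the count: as many families contain U as there are positions at
  -- which U lifts into the collection.
  one : ∀ U, lift s 2 U ∈ 𝓜 → ∃ i, U ∈ F i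
  two : ∀ U, lift s 2 U ∈ 𝓜 → (lift s 1 U ∈ 𝓜 ↔ ∃ i j, i ≠ j ∧ U ∈ F i ∧ U ∈ F j)
  three : ∀ U, lift s 2 U ∈ 𝓜 → (lift s 0 U ∈ 𝓜 ↔ ∀ i, U ∈ F i)

namespace IsInterlaced

variable {𝓜 : Set (Set (V ⊕ (E × Bool)))} {F : Fin 3 → Set (Set V)}

lemma cut_base_nonempty (h : IsInterlaced s 𝓜 F) (hT : T ∈ 𝓜) : (cut s (base T)).Nonempty := by
  obtain ⟨i, hi⟩ := h.one _ (h.lift_two T hT)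
  exact (h.fam i).cut_nonempty _ hi

lemma cut_nonempty_of_lift (h : IsInterlaced s 𝓜 F) (hU : lift s 2 U ∈ 𝓜) :
    (cut s U).Nonempty := h.cut_base_nonempty hU

/-- If W follows the base of T in the i-th family, then T ≺ lift 0 W ≺ lift 1 W ≺ lift 2 W, so the
greedy chain makes three steps below lift 2 W. Conversely, three steps retreat through positions 1
and 0 to base T ≺ base T₃, so the base of T₃ is itself a candidate for W. -/
lemma isLeast_step [Finite V] [Finite E] (h : IsInterlaced s 𝓜 F) {j : ℕ} {i : Fin 3}
    (hT : IsNth (sub s) 𝓜 j T) (hi : base T ∈ F i) {W : Set V} :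
    IsLeast {Z | Z ∈ F i ∧ Precedes s (base T) Z} W ↔
      ∃ T', IsNth (sub s) 𝓜 (j + 3) T' ∧ base T' = W := by
  have fwd : ∀ W, IsLeast {Z | Z ∈ F i ∧ Precedes s (base T) Z} W →
      ∃ T', IsNth (sub s) 𝓜 (j + 3) T' ∧ base T' = W := by
    intro W hW
    have hW2 := h.lift_of_mem i W hW.1.1
    have hcW := h.cut_nonempty_of_lift hW2
    have hp0 : Precedes (sub s) T (lift s 0 W) :=
      (hW.1.2.lift_two_zero (h.cut_base_nonempty hT.mem)).mono_left (h.subset_lift T hT.mem)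
    have hW0 := h.lift_mem T hT.mem W 0 hp0.subset hW2
    have hW1 := h.lift_mem T hT.mem W 1 (hp0.subset.trans (lift_mono (by decide))) hW2
    obtain ⟨T1, hT1, hs1⟩ := h.hat.exists_succ hT hW0 hp0
    obtain ⟨T2, hT2, hs2⟩ := h.hat.exists_succ hT1 hW1
      ((lift_precedes_lift (by decide) hcW).mono_left hs1)
    obtain ⟨T3, hT3, hs3⟩ := h.hat.exists_succ hT2 hW2
      ((lift_precedes_lift (by decide) hcW).mono_left hs2)
    refine ⟨T3, hT3, ?_⟩
    have hsub : base T3 ⊆ W := fun v hv => hs3 hv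
    refine hsub.antisymm (hW.2 ⟨?_, ?_⟩)
    · exact h.upper i _ hi _ (base_mono (hT.subset hT3 (by omega))) (h.lift_two _ hT3.mem)
    · have a2 := (hT2.precedes_succ hT3).subset_lift_one (h.subset_lift _ hT3.mem)
      have a1 := (hT1.precedes_succ hT2).subset_lift_zero a2
      exact (hT.precedes_succ hT1).base_precedes a1 (h.cut_base_nonempty hT.mem)
  refine ⟨fwd W, ?_⟩
  rintro ⟨T3, hT3, rfl⟩
  obtain ⟨T1, hT1⟩ := hT3.exists_of_le (m := j + 1) (by omega)
  obtain ⟨T2, hT2⟩ := hT3.exists_of_le (m := j + 2) (by omega)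
  have a2 := (hT2.precedes_succ hT3).subset_lift_one (h.subset_lift _ hT3.mem)
  have a1 := (hT1.precedes_succ hT2).subset_lift_zero a2
  have a0 := (hT.precedes_succ hT1).base_precedes a1 (h.cut_base_nonempty hT.mem)
  have a3 := h.upper i _ hi _ (base_mono (hT.subset hT3 (by omega))) (h.lift_two _ hT3.mem)
  obtain ⟨W, hW⟩ := exists_isLeast_of_inter (𝒮 := {Z | Z ∈ F i ∧ Precedes s (base T) Z})
    ⟨_, a3, a0⟩ ((h.fam i).precedes_inter hi)
  obtain ⟨T', hT', rfl⟩ := fwd W hW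
  rwa [hT3.unique hT']

/-- The member has one predecessor, so its base also lifts at position 1. By the count the base then
lies in at least two families. -/
lemma lift_one_mem (h : IsInterlaced s 𝓜 F) (hT : IsNth (sub s) 𝓜 1 T) :
    lift s 1 (base T) ∈ 𝓜 := by
  obtain ⟨T0, hT0⟩ := hT.exists_of_le (m := 0) (by omega)
  exact h.lift_mem T0 hT0.mem _ _
    ((hT0.precedes_succ hT).subset_lift_one (h.subset_lift _ hT.mem)) (h.lift_two _ hT.mem)

lemma lift_zero_mem (h : IsInterlaced s 𝓜 F) (hT : IsNth (sub s) 𝓜 2 T) :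
    lift s 0 (base T) ∈ 𝓜 := by
  obtain ⟨T0, hT0⟩ := hT.exists_of_le (m := 0) (by omega)
  obtain ⟨T1, hT1⟩ := hT.exists_of_le (m := 1) (by omega)
  exact h.lift_mem T0 hT0.mem _ _ ((hT0.precedes_succ hT1).subset_lift_zero
    ((hT1.precedes_succ hT).subset_lift_one (h.subset_lift _ hT.mem))) (h.lift_two _ hT.mem)

lemma exists_nth_zero [Finite V] [Finite E] (h : IsInterlaced s 𝓜 F) (hU : lift s 2 U ∈ 𝓜) :
    ∃ T, IsNth (sub s) 𝓜 0 T ∧ base T ⊆ U := by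
  obtain ⟨T, hT, hs⟩ := h.hat.exists_zero hU
  exact ⟨T, hT, fun v hv => hs hv⟩

lemma exists_nth_one [Finite V] [Finite E] (h : IsInterlaced s 𝓜 F) (hU : lift s 2 U ∈ 𝓜)
    (hU1 : lift s 1 U ∈ 𝓜) : ∃ T, IsNth (sub s) 𝓜 1 T ∧ base T ⊆ U := by
  obtain ⟨T, hT, hs⟩ := h.hat.exists_zero hU1
  obtain ⟨T1, hT1, hs1⟩ := h.hat.exists_succ hT hU
    ((lift_precedes_lift (by decide) (h.cut_nonempty_of_lift hU)).mono_left hs)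
  exact ⟨T1, hT1, fun v hv => hs1 hv⟩

lemma exists_nth_two [Finite V] [Finite E] (h : IsInterlaced s 𝓜 F) (hU : lift s 2 U ∈ 𝓜)
    (hU1 : lift s 1 U ∈ 𝓜) (hU0 : lift s 0 U ∈ 𝓜) :
    ∃ T, IsNth (sub s) 𝓜 2 T ∧ base T ⊆ U := by
  obtain ⟨T, hT, hs⟩ := h.hat.exists_zero hU0
  obtain ⟨T1, hT1, hs1⟩ := h.hat.exists_succ hT hU1
    ((lift_precedes_lift (by decide) (h.cut_nonempty_of_lift hU)).mono_left hs)
  obtain ⟨T2, hT2, hs2⟩ := h.hat.exists_succ hT1 hU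
    ((lift_precedes_lift (by decide) (h.cut_nonempty_of_lift hU)).mono_left hs1)
  exact ⟨T2, hT2, fun v hv => hs2 hv⟩

/-- The first member lies over a set of some family a. The second has a base in two families, one of
which is b ≠ a, and the third has a base in all three families. Conversely, a member U of a family
lies above the first base, hence belongs to a. If its family is not a, the count provides lift 1 U
and a second member below, and so on. -/
lemma exists_perm_zero [Finite V] [Finite E] (h : IsInterlaced s 𝓜 F) :
    ∃ σ : Equiv.Perm (Fin 3), ∀ i W, IsLeast (F i) W ↔
      ∃ T, IsNth (sub s) 𝓜 (σ i).val T ∧ base T = W := by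
  have ha : ∃ a, ∀ T, IsNth (sub s) 𝓜 0 T → base T ∈ F a := by
    by_cases h0 : ∃ T, IsNth (sub s) 𝓜 0 T
    · obtain ⟨T, hT⟩ := h0
      obtain ⟨a, ha⟩ := h.one _ (h.lift_two T hT.mem)
      exact ⟨a, fun T' hT' => hT.unique hT' ▸ ha⟩
    -- If the chain is empty the choice of a family is immaterial; the same applies to `a + 1`
    -- below.
    · exact ⟨0, fun T hT => absurd ⟨T, hT⟩ h0⟩
  obtain ⟨a, ha⟩ := ha
  have hne : ∀ a : Fin 3, a ≠ a + 1 := by decide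
  have hb : ∃ b, a ≠ b ∧ ∀ T, IsNth (sub s) 𝓜 1 T → base T ∈ F b := by
    by_cases h1 : ∃ T, IsNth (sub s) 𝓜 1 T
    · obtain ⟨T, hT⟩ := h1
      obtain ⟨i, j, hij, hi, hj⟩ := (h.two _ (h.lift_two T hT.mem)).1 (h.lift_one_mem hT)
      by_cases hai : a = i
      · exact ⟨j, hai ▸ hij, fun T' hT' => hT.unique hT' ▸ hj⟩
      · exact ⟨i, hai, fun T' hT' => hT.unique hT' ▸ hi⟩
    · exact ⟨a + 1, hne a, fun T hT => absurd ⟨T, hT⟩ h1⟩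
  obtain ⟨b, hab, hb⟩ := hb
  have hperm : ∀ a b : Fin 3, a ≠ b → ∃ σ : Equiv.Perm (Fin 3), ∃ c, σ a = 0 ∧ σ b = 1 ∧ σ c = 2 ∧
      a ≠ c ∧ ∀ x, x = a ∨ x = b ∨ x = c := by decide
  obtain ⟨σ, c, hσa, hσb, hσc, hac, hx⟩ := hperm a b hab
  -- every member of a family contains the least members that come earlier
  have sub_a : ∀ i, ∀ U ∈ F i, U ∈ F a ∧ ∃ T, IsNth (sub s) 𝓜 0 T ∧ base T ⊆ U := by
    intro i U hU
    have hU2 := h.lift_of_mem i U hU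
    obtain ⟨T, hT, hs⟩ := h.exists_nth_zero hU2
    exact ⟨h.upper a _ (ha T hT) U hs hU2, T, hT, hs⟩
  have sub_b : ∀ i, i ≠ a → ∀ U ∈ F i, U ∈ F b ∧ ∃ T, IsNth (sub s) 𝓜 1 T ∧ base T ⊆ U := by
    intro i hi U hU
    have hU2 := h.lift_of_mem i U hU
    obtain ⟨T, hT, hs⟩ := h.exists_nth_one hU2
      ((h.two U hU2).2 ⟨i, a, hi, hU, (sub_a i U hU).1⟩)
    exact ⟨h.upper b _ (hb T hT) U hs hU2, T, hT, hs⟩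
  have sub_c : ∀ U ∈ F c, ∃ T, IsNth (sub s) 𝓜 2 T ∧ base T ⊆ U := by
    intro U hU
    have hU2 := h.lift_of_mem c U hU
    refine h.exists_nth_two hU2 ((h.two U hU2).2 ⟨c, a, hac.symm, hU, (sub_a c U hU).1⟩)
      ((h.three U hU2).2 fun i => ?_)
    rcases hx i with rfl | rfl | rfl
    · exact (sub_a c U hU).1
    · exact (sub_b c hac.symm U hU).1
    · exact hU
  have main : ∀ (i : Fin 3) (n : ℕ), (∀ U ∈ F i, ∃ T, IsNth (sub s) 𝓜 n T ∧ base T ⊆ U) →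
      (∀ T, IsNth (sub s) 𝓜 n T → base T ∈ F i) → ∀ W, IsLeast (F i) W ↔
        ∃ T, IsNth (sub s) 𝓜 n T ∧ base T = W := by
    intro i n h1 h2 W
    constructor
    · intro hW
      obtain ⟨T, hT, hs⟩ := h1 W hW.1
      exact ⟨T, hT, hs.antisymm (hW.2 (h2 T hT))⟩
    · rintro ⟨T, hT, rfl⟩
      refine ⟨h2 T hT, fun U hU => ?_⟩
      obtain ⟨T', hT', hs⟩ := h1 U hU
      rwa [hT.unique hT']
  refine ⟨σ, fun i => ?_⟩
  rcases hx i with rfl | rfl | rfl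
  · rw [hσa]
    exact main _ 0 (fun U hU => (sub_a _ U hU).2) ha
  · rw [hσb]
    exact main _ 1 (fun U hU => (sub_b _ hab.symm U hU).2) hb
  · rw [hσc]
    exact main _ 2 sub_c fun T hT => (h.three _ (h.lift_two T hT.mem)).1 (h.lift_zero_mem hT) _

/-- The nested chain on the subdivided graph runs cyclically through the three nested chains on
the original graph. -/
theorem exists_perm [Finite V] [Finite E] (h : IsInterlaced s 𝓜 F) :
    ∃ σ : Equiv.Perm (Fin 3), ∀ i n W, IsNth s (F i) n W ↔
      ∃ T, IsNth (sub s) 𝓜 (3 * n + (σ i).val) T ∧ base T = W := by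
  obtain ⟨σ, hσ⟩ := h.exists_perm_zero
  refine ⟨σ, fun i n => ?_⟩
  induction n with
  | zero => simpa [IsNth] using hσ i
  | succ n ih =>
    intro W
    have e : 3 * (n + 1) + (σ i).val = 3 * n + (σ i).val + 3 := by ring
    rw [e]
    constructor
    · rintro ⟨W', hW', hW⟩
      obtain ⟨T, hT, rfl⟩ := (ih _).1 hW'
      exact (h.isLeast_step hT hW'.mem).1 hW
    · rintro ⟨T', hT', rfl⟩
      obtain ⟨T, hT⟩ := hT'.exists_of_le (m := 3 * n + (σ i).val) (by omega)
      have hn := (ih _).2 ⟨T, hT, rfl⟩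
      exact ⟨_, hn, (h.isLeast_step hT hn.mem).2 ⟨T', hT', rfl⟩⟩

end IsInterlaced

end Subdivision

end DualGraph

namespace DualGraph

/-! ### Tails of the subdivided graph -/

section SubdividedTails

variable {V E : Type*} {s : E × Bool → V} {P : V} {S U : Set V} {T : Set (V ⊕ (E × Bool))}
  {d d₁ d₂ : E × Bool}

lemma isConn_sub (hs : IsConn s) : IsConn (sub s) := by
  intro T hT
  have h1 : ∀ d, (Sum.inl (s d) : V ⊕ (E × Bool)) ∈ T ↔ Sum.inr d ∈ T := by
    intro d
    by_contra h
    have := inl_mem_cut.2 h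
    rw [hT] at this
    exact this
  have h2 : ∀ d, (Sum.inr d : V ⊕ (E × Bool)) ∈ T ↔ Sum.inr (rev d) ∈ T := by
    intro d
    by_contra h
    have := (inr_mem_cut (s := s)).2 h
    rw [hT] at this
    exact this
  have h3 : cut s (base T) = ∅ := by
    ext e
    rw [mem_cut_iff (e, false)]
    have := h1 (e, false)
    have := h1 (rev (e, false))
    have := h2 (e, false)
    simp only [mem_base, Set.mem_empty_iff_false]
    tauto
  rcases hs _ h3 with h | h
  · left
    ext (v | d)
    · have := Set.ext_iff.1 h v
      simpa using this
    · have := Set.ext_iff.1 h (s d)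
      rw [← h1]
      simpa using this
  · right
    ext (v | d)
    · have := Set.ext_iff.1 h v
      simpa using this
    · have := Set.ext_iff.1 h (s d)
      rw [← h1]
      simpa using this

/-- An original edge is cut by the base exactly when an odd number of the three edges of its path
are cut. -/
lemma mem_cut_base_iff :
    d.1 ∈ cut s (base T) ↔ ¬((pos d 0 ∈ cut (sub s) T ↔ pos d 1 ∈ cut (sub s) T) ↔
      ¬ pos d 2 ∈ cut (sub s) T) := by
  rw [mem_cut_iff, pos_zero, pos_one, pos_two, inl_mem_cut, inr_mem_cut, inl_mem_cut]
  simp only [mem_base]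
  tauto

lemma exists_mem_cut_of_mem_cut_base {e : E} (he : e ∈ cut s (base T)) :
    ∃ g ∈ cut (sub s) T, under g = e := by
  have := (mem_cut_base_iff (d := (e, false))).1 he
  by_cases h0 : pos (e, false) 0 ∈ cut (sub s) T
  · exact ⟨_, h0, under_pos _⟩
  · by_cases h1 : pos (e, false) 1 ∈ cut (sub s) T
    · exact ⟨_, h1, under_pos _⟩
    · refine ⟨pos (e, false) 2, ?_, under_pos _⟩
      by_contra h2
      rw [iff_false_intro h0, iff_false_intro h1, iff_false_intro h2] at this
      simp at this

/-- A one-edge cut has a one-edge base by parity, and conversely a one-edge cut can be lifted at the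
position of the given edge. -/
lemma isBridge_sub_iff (g : (E × Bool) ⊕ E) : IsBridge (sub s) g ↔ IsBridge s (under g) := by
  constructor
  · rintro ⟨T, hT⟩
    refine ⟨base T, ?_⟩
    ext e
    constructor
    · intro he
      obtain ⟨g', hg', rfl⟩ := exists_mem_cut_of_mem_cut_base he
      rw [hT] at hg'
      rw [Set.mem_singleton_iff.1 hg']
      rfl
    · intro he
      obtain ⟨p, rfl⟩ := exists_pos g (e, false) (Eq.symm he)
      refine (mem_cut_base_iff (d := (e, false))).2 ?_
      rw [hT]
      simp only [Set.mem_singleton_iff, (pos_injective _).eq_iff]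
      clear hT he
      fin_cases p <;> decide
  · rintro ⟨S, hS⟩
    obtain ⟨d, hd, hO⟩ := exists_out_of_mem_cut (s := s) (S := S) (hS ▸ rfl : under g ∈ cut s S)
    obtain ⟨p, rfl⟩ := exists_pos g d hd.symm
    refine ⟨lift s p S, ?_⟩
    ext g'
    rw [mem_cut_lift_iff]
    constructor
    · rintro ⟨d', hd', rfl⟩
      have h1 := hd'.mem_cut
      rw [hS] at h1
      rw [hd'.unique hO (by simpa using h1)]
      rfl
    · intro hg'
      exact ⟨d, hO, hg'⟩

/-! ### Sets cutting every path at most once, and their positions. -/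

variable (s) in
/-- Each edge of the original graph is cut at most once. -/
def IsClean (T : Set (V ⊕ (E × Bool))) : Prop := Set.InjOn under (cut (sub s) T)

lemma isClean_lift (p : Fin 3) : IsClean s (lift s p S) := by
  intro g hg g' hg' h
  obtain ⟨d, hd, rfl⟩ := mem_cut_lift_iff.1 hg
  obtain ⟨d', hd', rfl⟩ := mem_cut_lift_iff.1 hg'
  simp only [under_pos] at h
  rw [hd.unique hd' h]

namespace IsClean

lemma eq_of_pos (hT : IsClean s T) {p q : Fin 3} (hp : pos d p ∈ cut (sub s) T)
    (hq : pos d q ∈ cut (sub s) T) : p = q :=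
  pos_injective d (hT hp hq (by simp))

lemma under_mem (hT : IsClean s T) {g : (E × Bool) ⊕ E} (hg : g ∈ cut (sub s) T) :
    under g ∈ cut s (base T) := by
  obtain ⟨p, hp⟩ := exists_pos g (under g, false) rfl
  generalize (under g, false) = d at hp
  subst hp
  rw [under_pos, mem_cut_base_iff]
  have h := fun q (hq : pos d q ∈ cut (sub s) T) => hT.eq_of_pos hg hq
  have h0 := h 0
  have h1 := h 1
  have h2 := h 2
  fin_cases p <;> simp_all

lemma image_under (hT : IsClean s T) : under '' cut (sub s) T = cut s (base T) := by
  ext e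
  constructor
  · rintro ⟨g, hg, rfl⟩
    exact hT.under_mem hg
  · intro he
    obtain ⟨g, hg, rfl⟩ := exists_mem_cut_of_mem_cut_base he
    exact ⟨g, hg, rfl⟩

lemma ncard_cut (hT : IsClean s T) : (cut (sub s) T).ncard = (cut s (base T)).ncard := by
  rw [← hT.image_under, hT.ncard_image]

lemma mem_tails_iff (hT : IsClean s T) {k : ℕ} :
    T ∈ tails (sub s) (Sum.inl P) k ↔ base T ∈ tails s P k := by
  unfold tails
  simp only [Set.mem_ofPred_eq, hT.ncard_cut, mem_base, isBridge_sub_iff]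
  rw [← hT.image_under, Set.forall_mem_image]

lemma subset_lift_two (hT : IsClean s T) : T ⊆ lift s 2 (base T) := by
  rintro (v | d) hx
  · exact hx
  · by_contra h
    simp only [inr_mem_lift_two, mem_base, not_or] at h
    have h0 : pos d 0 ∈ cut (sub s) T := by rw [pos_zero, inl_mem_cut]; tauto
    by_cases h1 : (Sum.inr (rev d) : V ⊕ (E × Bool)) ∈ T
    · have h2 : pos d 2 ∈ cut (sub s) T := by rw [pos_two, inl_mem_cut]; tauto
      exact absurd (hT.eq_of_pos h0 h2) (by decide)
    · have h2 : pos d 1 ∈ cut (sub s) T := by rw [pos_one, inr_mem_cut]; tauto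
      exact absurd (hT.eq_of_pos h0 h2) (by decide)

lemma lift_zero_subset (hT : IsClean s T) : lift s 0 (base T) ⊆ T := by
  rintro (v | d) hx
  · exact hx
  · by_contra h
    simp only [inr_mem_lift_zero, mem_base] at hx
    have h0 : pos d 0 ∈ cut (sub s) T := by rw [pos_zero, inl_mem_cut]; tauto
    by_cases h1 : (Sum.inr (rev d) : V ⊕ (E × Bool)) ∈ T
    · have h2 : pos d 1 ∈ cut (sub s) T := by rw [pos_one, inr_mem_cut]; tauto
      exact absurd (hT.eq_of_pos h0 h2) (by decide)
    · have h2 : pos d 2 ∈ cut (sub s) T := by rw [pos_two, inl_mem_cut]; tauto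
      exact absurd (hT.eq_of_pos h0 h2) (by decide)

/-- The position at which a dart leaving `base T` is cut. -/
lemma exists_level (hT : IsClean s T) (hd : Out s (base T) d) :
    ∃ p, pos d p ∈ cut (sub s) T ∧
      ((Sum.inr d : V ⊕ (E × Bool)) ∈ T ↔ p ≠ 0) ∧
      ((Sum.inr (rev d) : V ⊕ (E × Bool)) ∈ T ↔ p = 2) := by
  obtain ⟨g, hg, hgd⟩ := exists_mem_cut_of_mem_cut_base hd.mem_cut
  obtain ⟨p, rfl⟩ := exists_pos g d hgd
  refine ⟨p, hg, ?_⟩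
  have h0 : pos d 0 ∈ cut (sub s) T → p = 0 := fun h => hT.eq_of_pos hg h
  have h1 : pos d 1 ∈ cut (sub s) T → p = 1 := fun h => hT.eq_of_pos hg h
  have h2 : pos d 2 ∈ cut (sub s) T → p = 2 := fun h => hT.eq_of_pos hg h
  rw [pos_zero, inl_mem_cut] at h0
  rw [pos_one, inr_mem_cut] at h1
  rw [pos_two, inl_mem_cut] at h2
  obtain ⟨a, b⟩ := hd
  simp only [mem_base] at a b
  fin_cases p <;> simp at h0 h1 h2 ⊢ <;> tauto

lemma level (hT : IsClean s T) (hd : Out s (base T) d) {p : Fin 3}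
    (hp : pos d p ∈ cut (sub s) T) :
      ((Sum.inr d : V ⊕ (E × Bool)) ∈ T ↔ p ≠ 0) ∧
      ((Sum.inr (rev d) : V ⊕ (E × Bool)) ∈ T ↔ p = 2) := by
  obtain ⟨q, hq, h⟩ := hT.exists_level hd
  rwa [hT.eq_of_pos hp hq]

end IsClean

/-- Tails containing two of the new vertices, on different edges, are clean. -/
lemma isClean_of_mem_tails [Finite E] (hs : IsConn s) {k : ℕ} (hk : k ≤ 3)
    (hT : T ∈ tails (sub s) (Sum.inl P) k) (h1 : Sum.inr d₁ ∈ T) (h2 : Sum.inr d₂ ∈ T)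
    (h12 : d₁.1 ≠ d₂.1) : IsClean s T ∧ base T ∈ tails s P k ∧ (base T).Nonempty := by
  have hcard : (cut (sub s) T).ncard ≤ 3 := hT.2.1.trans_le hk
  have hb : ∀ e ∈ cut s (base T), ¬ IsBridge s e := by
    intro e he
    obtain ⟨g, hg, rfl⟩ := exists_mem_cut_of_mem_cut_base he
    rw [← isBridge_sub_iff]
    exact hT.2.2 g hg
  have hne : (base T).Nonempty := by
    by_contra hne
    rw [Set.not_nonempty_iff_eq_empty] at hne
    -- With empty base each of the two paths, having a new vertex inside and both ends outside, is
    -- cut twice. This gives four outgoing edges, but a k-tail with k ≤ 3 has at most three.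
    have key : ∀ d, (Sum.inr d : V ⊕ (E × Bool)) ∈ T → ∃ p, p ≠ 0 ∧ pos d 0 ∈ cut (sub s) T ∧
        pos d p ∈ cut (sub s) T := by
      intro d hd
      have e1 : (Sum.inl (s d) : V ⊕ (E × Bool)) ∉ T := fun h => by
        have : s d ∈ base T := h
        rw [hne] at this
        exact this
      have e2 : (Sum.inl (s (rev d)) : V ⊕ (E × Bool)) ∉ T := fun h => by
        have : s (rev d) ∈ base T := h
        rw [hne] at this
        exact this
      have h0 : pos d 0 ∈ cut (sub s) T := by rw [pos_zero, inl_mem_cut]; tauto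
      by_cases h1 : (Sum.inr (rev d) : V ⊕ (E × Bool)) ∈ T
      · exact ⟨2, by decide, h0, by rw [pos_two, inl_mem_cut]; tauto⟩
      · exact ⟨1, by decide, h0, by rw [pos_one, inr_mem_cut]; tauto⟩
    obtain ⟨p, hp, a, b⟩ := key d₁ h1
    obtain ⟨q, hq, a', b'⟩ := key d₂ h2
    have hd : ∀ p q, pos d₁ p ≠ pos d₂ q := fun p q h => h12 (by
      have := congrArg under h
      simpa using this)
    have hsub : ({pos d₁ 0, pos d₁ p} ∪ {pos d₂ 0, pos d₂ q} : Set _) ⊆ cut (sub s) T := by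
      rintro x ((rfl | rfl) | (rfl | rfl)) <;> assumption
    have hc := Set.ncard_le_ncard hsub
    rw [Set.ncard_union_eq, Set.ncard_pair ((pos_injective d₁).ne hp.symm),
      Set.ncard_pair ((pos_injective d₂).ne hq.symm)] at hc
    · omega
    · rw [Set.disjoint_left]
      rintro x (rfl | rfl) (h | h) <;> exact hd _ _ h
  have hclean : IsClean s T := by
    intro g hg g' hg' hgg'
    by_contra hne'
    have h2 := two_le_ncard_cut hs (P := P) (S := base T) hT.1 hne hb
    -- By parity, two cut edges of one path contribute nothing to the cut of the base unless the
    -- third is cut too. The base would then have at most one outgoing edge.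
    have hsub : cut s (base T) ⊆ under '' (cut (sub s) T \ {g, g'}) := by
      intro e he
      by_cases heg : under g = e
      · obtain ⟨p, rfl⟩ := exists_pos g (e, false) heg
        obtain ⟨q, rfl⟩ := exists_pos g' (e, false) (hgg' ▸ heg)
        have h3 := (mem_cut_base_iff (d := (e, false))).1 he
        obtain ⟨r, hr⟩ : ∃ r, pos (e, false) r ∈ cut (sub s) T ∧ r ≠ p ∧ r ≠ q := by
          have hpq : p ≠ q := fun h => hne' (by rw [h])
          fin_cases p <;> fin_cases q <;> simp at hpq hg hg' <;> 
            first
            | exact ⟨0, by simp_all, by decide, by decide⟩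
            | exact ⟨1, by simp_all, by decide, by decide⟩
            | exact ⟨2, by simp_all, by decide, by decide⟩
        refine ⟨pos (e, false) r, ⟨hr.1, ?_⟩, under_pos _⟩
        simp only [Set.mem_insert_iff, Set.mem_singleton_iff, (pos_injective _).eq_iff]
        tauto
      · obtain ⟨g'', hg'', rfl⟩ := exists_mem_cut_of_mem_cut_base he
        refine ⟨g'', ⟨hg'', ?_⟩, rfl⟩
        rintro (rfl | rfl)
        · exact heg rfl
        · exact heg hgg'
    have h3 := Set.ncard_le_ncard hsub
    have h4 := Set.ncard_image_le (f := under) (s := cut (sub s) T \ {g, g'})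
    have h5 := Set.ncard_sdiff_add_ncard_of_subset (s := {g, g'}) (t := cut (sub s) T)
      (by rintro x (rfl | rfl) <;> assumption)
    rw [Set.ncard_pair hne'] at h5
    omega
  exact ⟨hclean, hclean.mem_tails_iff.1 hT, hne⟩

/-- Changes the position at which the dart `d` is cut to `q`. -/
def setLevel (T : Set (V ⊕ (E × Bool))) (d : E × Bool) (q : Fin 3) : Set (V ⊕ (E × Bool)) :=
  {x | (x ∈ T ∧ x ≠ Sum.inr d ∧ x ≠ Sum.inr (rev d)) ∨ (x = Sum.inr d ∧ q ≠ 0) ∨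
    (x = Sum.inr (rev d) ∧ q = 2)}

@[simp] lemma base_setLevel (q : Fin 3) : base (setLevel T d q) = base T := by
  ext v; simp [setLevel]

lemma inr_mem_setLevel {q : Fin 3} : Sum.inr d ∈ setLevel T d q ↔ q ≠ 0 := by
  have := (rev_ne d).symm
  simp [setLevel, this]

lemma inr_rev_mem_setLevel {q : Fin 3} : Sum.inr (rev d) ∈ setLevel T d q ↔ q = 2 := by
  simp [setLevel, rev_ne d]

lemma inr_mem_setLevel_of_ne {q : Fin 3} {d' : E × Bool} (h : d'.1 ≠ d.1) :
    Sum.inr d' ∈ setLevel T d q ↔ Sum.inr d' ∈ T := by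
  have h1 : d' ≠ d := fun h' => h (h' ▸ rfl)
  have h2 : d' ≠ rev d := fun h' => h (h' ▸ rfl)
  simp [setLevel, h1, h2]

lemma mem_cut_setLevel_of_ne {q : Fin 3} {g : (E × Bool) ⊕ E} (h : under g ≠ d.1) :
    g ∈ cut (sub s) (setLevel T d q) ↔ g ∈ cut (sub s) T := by
  have hb : ∀ v, (Sum.inl v : V ⊕ (E × Bool)) ∈ setLevel T d q ↔ Sum.inl v ∈ T := fun v =>
    Set.ext_iff.1 (base_setLevel (T := T) (d := d) q) v
  rcases g with d' | e
  · rw [inl_mem_cut, inl_mem_cut, hb, inr_mem_setLevel_of_ne h]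
  · have := inr_mem_cut (s := s) (d := (e, false)) (T := setLevel T d q)
    have := inr_mem_cut (s := s) (d := (e, false)) (T := T)
    rw [inr_mem_setLevel_of_ne h, inr_mem_setLevel_of_ne (by exact h)] at *
    tauto

lemma pos_mem_cut_setLevel {q r : Fin 3} (hd : Out s (base T) d) :
    pos d r ∈ cut (sub s) (setLevel T d q) ↔ r = q := by
  have hb : ∀ v, (Sum.inl v : V ⊕ (E × Bool)) ∈ setLevel T d q ↔ Sum.inl v ∈ T := fun v =>
    Set.ext_iff.1 (base_setLevel (T := T) (d := d) q) v
  obtain ⟨h1, h2⟩ := hd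
  simp only [mem_base] at h1 h2
  fin_cases r
  · simp only [Fin.zero_eta, pos_zero, inl_mem_cut, hb, inr_mem_setLevel, h1]
    simp [eq_comm]
  · simp only [Fin.mk_one, pos_one, inr_mem_cut, inr_mem_setLevel, inr_rev_mem_setLevel]
    fin_cases q <;> decide
  · simp only [Fin.reduceFinMk, pos_two, inl_mem_cut, hb, inr_rev_mem_setLevel, h2]
    simp [eq_comm]

lemma isClean_setLevel {q : Fin 3} (hT : IsClean s T) (hd : Out s (base T) d) :
    IsClean s (setLevel T d q) := by
  intro g hg g' hg' h
  by_cases h1 : under g = d.1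
  · obtain ⟨p, rfl⟩ := exists_pos g d h1
    obtain ⟨p', rfl⟩ := exists_pos g' d (h ▸ h1)
    rw [(pos_mem_cut_setLevel hd).1 hg, (pos_mem_cut_setLevel hd).1 hg']
  · rw [mem_cut_setLevel_of_ne h1] at hg
    rw [mem_cut_setLevel_of_ne (h ▸ h1)] at hg'
    exact hT hg hg' h

lemma setLevel_mem_tails {q : Fin 3} {k : ℕ} (hT : IsClean s T) (hd : Out s (base T) d)
    (hk : T ∈ tails (sub s) (Sum.inl P) k) : setLevel T d q ∈ tails (sub s) (Sum.inl P) k := by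
  rw [(isClean_setLevel hT hd).mem_tails_iff, base_setLevel, ← hT.mem_tails_iff]
  exact hk

/-! ### The families of 2-tails and of free 3-tails -/

variable (s) in
/-- The `2`-tails containing `X` and avoiding `P`. -/
def twoTails (P : V) (X : Set V) : Set (Set V) := {Z | Z ∈ tails s P 2 ∧ X ⊆ Z}

variable (s) in
/-- The `3`-tails containing `X` and avoiding `P` which are free with respect to the nested chain
of `2`-tails. -/
def threeTails (P : V) (X : Set V) : Set (Set V) :=
  {Z | Z ∈ tails s P 3 ∧
    (∀ n W, IsNth s (twoTails s P X) n W → Disjoint (cut s Z) (cut s W)) ∧ X ⊆ Z}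

lemma cut_nonempty_of_mem_tails {k : ℕ} (hk : k ≠ 0) (hS : S ∈ tails s P k) :
    (cut s S).Nonempty := by
  rw [Set.nonempty_iff_ne_empty]
  intro h
  have := hS.2.1
  rw [h, Set.ncard_empty] at this
  exact hk this.symm

lemma isMeetFamily_twoTails [Finite E] (hs : IsConn s) {X : Set V} (hX : X.Nonempty) :
    IsMeetFamily s (twoTails s P X) where
  inter_mem := fun Z hZ Z' hZ' => ⟨tails_inter_two hs hZ.1 hZ'.1
    (hX.mono (Set.subset_inter hZ.2 hZ'.2)), Set.subset_inter hZ.2 hZ'.2⟩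
  cut_nonempty := fun Z hZ => cut_nonempty_of_mem_tails (by decide) hZ.1

lemma isMeetFamily_threeTails [Finite V] [Finite E] (hs : IsConn s) {X : Set V}
    (hX : X.Nonempty) : IsMeetFamily s (threeTails s P X) where
  inter_mem := by
    intro Z hZ Z' hZ'
    have hX' := Set.subset_inter hZ.2.2 hZ'.2.2
    -- A 2-tail containing X shares an edge with the chain, while all edges of Z and Z' are free
    -- from it. This excludes a 2-tail as the intersection or the union.
    have hfree : ∀ U, U ∈ twoTails s P X → ¬ cut s U ⊆ cut s Z ∪ cut s Z' := by
      intro U hU hsub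
      obtain ⟨n, W, hW, e, heW, heU⟩ := (isMeetFamily_twoTails hs hX).exists_not_disjoint hU
      rcases hsub heU with h | h
      · exact Set.disjoint_left.1 (hZ.2.1 n W hW) h heW
      · exact Set.disjoint_left.1 (hZ'.2.1 n W hW) h heW
    refine ⟨?_, fun n W hW => ?_, hX'⟩
    · rcases tails_three_three hs hZ.1 hZ'.1 (hX.mono hX') with h | h | h
      · exact h
      · exact absurd (cut_inter_subset _ _) (hfree _ ⟨h, hX'⟩)
      · exact absurd (cut_union_subset _ _) (hfree _ ⟨h, hX'.trans
          (Set.inter_subset_left.trans Set.subset_union_left)⟩)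
    · exact ((hZ.2.1 n W hW).union_left (hZ'.2.1 n W hW)).mono_left (cut_inter_subset _ _)
  cut_nonempty := fun Z hZ => cut_nonempty_of_mem_tails (by decide) hZ.1

variable (s) in
/-- The edge `e` is an outgoing edge of some nested `2`- or `3`-tail of `X`. -/
def IsTerminal (P : V) (X : Set V) (e : E) : Prop :=
  ∃ n W, (IsNth s (twoTails s P X) n W ∨ IsNth s (threeTails s P X) n W) ∧ e ∈ cut s W

/-- Chains only depend on the first member. -/
lemma isNth_twoTails_congr {X X' : Set V}
    (h : ∀ W, IsLeast (twoTails s P X) W ↔ IsLeast (twoTails s P X') W) (n : ℕ) (W : Set V) :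
    IsNth s (twoTails s P X) n W ↔ IsNth s (twoTails s P X') n W := by
  induction n generalizing W with
  | zero => exact h W
  | succ n ih =>
    have : ∀ Y, IsNth s (twoTails s P X) n Y → X ⊆ Y ∧ X' ⊆ Y := by
      intro Y hY
      exact ⟨hY.mem.2, ((ih Y).1 hY).mem.2⟩
    constructor
    · rintro ⟨Y, hY, hW⟩
      refine ⟨Y, (ih Y).1 hY, ?_⟩
      convert hW using 1
      ext Z
      simp only [twoTails, Set.mem_ofPred_eq]
      have := this Y hY
      constructor
      · rintro ⟨⟨a, -⟩, b⟩
        exact ⟨⟨a, this.1.trans b.subset⟩, b⟩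
      · rintro ⟨⟨a, -⟩, b⟩
        exact ⟨⟨a, this.2.trans b.subset⟩, b⟩
    · rintro ⟨Y, hY, hW⟩
      have hY := (ih Y).2 hY
      refine ⟨Y, hY, ?_⟩
      convert hW using 1
      ext Z
      simp only [twoTails, Set.mem_ofPred_eq]
      have := this Y hY
      constructor
      · rintro ⟨⟨a, -⟩, b⟩
        exact ⟨⟨a, this.2.trans b.subset⟩, b⟩
      · rintro ⟨⟨a, -⟩, b⟩
        exact ⟨⟨a, this.1.trans b.subset⟩, b⟩

/-! ### The chains of 2-tails are interlaced -/

variable (s) in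
/-- The three pairs of vertices attached to the darts `d₁`, `d₂`. -/
def pairs (d₁ d₂ : E × Bool) : Fin 3 → Set V
  | 0 => {s d₁, s d₂}
  | 1 => {s d₁, s (rev d₂)}
  | 2 => {s (rev d₁), s d₂}

lemma pairs_nonempty (d₁ d₂ : E × Bool) (i : Fin 3) : (pairs s d₁ d₂ i).Nonempty := by
  fin_cases i <;> exact Set.insert_nonempty _ _

lemma pairs_subset_iff {i : Fin 3} : pairs s d₁ d₂ i ⊆ S ↔
    (i = 0 ∧ s d₁ ∈ S ∧ s d₂ ∈ S) ∨ (i = 1 ∧ s d₁ ∈ S ∧ s (rev d₂) ∈ S) ∨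
    (i = 2 ∧ s (rev d₁) ∈ S ∧ s d₂ ∈ S) := by
  fin_cases i <;> simp [pairs, Set.insert_subset_iff]

lemma subset_lift_iff (p : Fin 3) :
    ({Sum.inr d₁, Sum.inr d₂} : Set (V ⊕ (E × Bool))) ⊆ lift s p S ↔
      Sum.inr d₁ ∈ lift s p S ∧ Sum.inr d₂ ∈ lift s p S := by
  simp [Set.insert_subset_iff]

lemma lift_mem_tails_iff {p : Fin 3} {k : ℕ} :
    lift s p S ∈ tails (sub s) (Sum.inl P) k ↔ S ∈ tails s P k := by
  rw [(isClean_lift p).mem_tails_iff, base_lift]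

/-- Membership of U in the families and of its lifts in the collection is decided by the four ends
of d₁ and d₂. The count holds in all configurations except both sources without targets and both
targets without sources. -/
lemma isInterlaced_twoTails [Finite V] [Finite E] (hs : IsConn s) (h12 : d₁.1 ≠ d₂.1)
    (hA : ¬ (IsTerminal s P {s d₁, s d₂} d₁.1 ∧ IsTerminal s P {s d₁, s d₂} d₂.1))
    (hC : ¬ (IsTerminal s P {s (rev d₁), s (rev d₂)} d₁.1 ∧
      IsTerminal s P {s (rev d₁), s (rev d₂)} d₂.1)) :
    IsInterlaced s (twoTails (sub s) (Sum.inl P) {Sum.inr d₁, Sum.inr d₂})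
      (fun i => twoTails s P (pairs s d₁ d₂ i)) := by
  have mem_lift : ∀ p U, lift s p U ∈ twoTails (sub s) (Sum.inl P) {Sum.inr d₁, Sum.inr d₂} ↔
      U ∈ tails s P 2 ∧ Sum.inr d₁ ∈ lift s p U ∧ Sum.inr d₂ ∈ lift s p U := fun p U => by
    rw [← subset_lift_iff, ← lift_mem_tails_iff (p := p)]
    rfl
  have mem_F : ∀ i U, U ∈ twoTails s P (pairs s d₁ d₂ i) ↔ U ∈ tails s P 2 ∧
    ((i = 0 ∧ s d₁ ∈ U ∧ s d₂ ∈ U) ∨ (i = 1 ∧ s d₁ ∈ U ∧ s (rev d₂) ∈ U) ∨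
    (i = 2 ∧ s (rev d₁) ∈ U ∧ s d₂ ∈ U)) := fun i U => by
    rw [← pairs_subset_iff]
    rfl
  have clean : ∀ Z ∈ twoTails (sub s) (Sum.inl P) {Sum.inr d₁, Sum.inr d₂}, IsClean s Z := by
    intro Z hZ
    exact (isClean_of_mem_tails hs (by decide) hZ.1 (hZ.2 (by simp)) (hZ.2 (by simp)) h12).1
  -- If both darts leave U, they also leave the first nested 2-tail of their sources, which is
  -- contained in U. Both edges are then terminal, against quasistability.
  have clash : ∀ (δ₁ δ₂ : E × Bool), δ₁.1 = d₁.1 → δ₂.1 = d₂.1 →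
      ¬ (IsTerminal s P {s δ₁, s δ₂} d₁.1 ∧ IsTerminal s P {s δ₁, s δ₂} d₂.1) →
      ∀ U ∈ tails s P 2, ¬ (Out s U δ₁ ∧ Out s U δ₂) := by
    rintro δ₁ δ₂ e₁ e₂ h U hU ⟨o₁, o₂⟩
    have hU' : U ∈ twoTails s P {s δ₁, s δ₂} := ⟨hU, by
      rintro x (rfl | rfl)
      exacts [o₁.1, o₂.1]⟩
    obtain ⟨W, hW, hWU⟩ := (isMeetFamily_twoTails hs (Set.insert_nonempty _ _)).exists_zero hU'
    refine h ⟨⟨0, W, Or.inl hW, ?_⟩, ⟨0, W, Or.inl hW, ?_⟩⟩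
    · rw [← e₁]
      exact Out.mem_cut ⟨hW.mem.2 (by simp), fun h => o₁.2 (hWU h)⟩
    · rw [← e₂]
      exact Out.mem_cut ⟨hW.mem.2 (by simp), fun h => o₂.2 (hWU h)⟩
  have clashA := clash d₁ d₂ rfl rfl hA
  have clashC := clash (rev d₁) (rev d₂) rfl rfl hC
  simp only [Out, rev_rev] at clashA clashC
  refine
    { hat := isMeetFamily_twoTails (isConn_sub hs) (Set.insert_nonempty _ _)
      fam := fun i => isMeetFamily_twoTails hs (pairs_nonempty _ _ _)
      subset_lift := fun Z hZ => (clean Z hZ).subset_lift_two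
      lift_two := ?_, lift_mem := ?_, lift_of_mem := ?_, upper := ?_, one := ?_, two := ?_
      three := ?_ }
  · intro Z hZ
    exact ⟨lift_mem_tails_iff.2 ((clean Z hZ).mem_tails_iff.1 hZ.1),
      hZ.2.trans (clean Z hZ).subset_lift_two⟩
  · intro Z hZ U p hZU hU
    exact ⟨lift_mem_tails_iff.2 (lift_mem_tails_iff.1 hU.1), hZ.2.trans hZU⟩
  · intro i U hU
    rw [mem_lift]
    rw [mem_F] at hU
    simp only [inr_mem_lift_two]
    tauto
  · intro i U hU U' hUU' hU'
    exact ⟨lift_mem_tails_iff.1 hU'.1, hU.2.trans hUU'⟩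
  · intro U hU
    rw [mem_lift] at hU
    simp only [inr_mem_lift_two] at hU
    have := clashC U hU.1
    by_cases h0 : s d₁ ∈ U ∧ s d₂ ∈ U
    · exact ⟨0, (mem_F _ _).2 ⟨hU.1, Or.inl ⟨rfl, h0⟩⟩⟩
    by_cases h1 : s d₁ ∈ U ∧ s (rev d₂) ∈ U
    · exact ⟨1, (mem_F _ _).2 ⟨hU.1, Or.inr (Or.inl ⟨rfl, h1⟩)⟩⟩
    · exact ⟨2, (mem_F _ _).2 ⟨hU.1, Or.inr (Or.inr ⟨rfl, by tauto⟩)⟩⟩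
  · intro U hU
    have hU2 := (mem_lift _ _).1 hU
    rw [mem_lift]
    simp only [mem_F, inr_mem_lift_one]
    have := clashA U hU2.1
    constructor
    · rintro ⟨-, h1, h2⟩
      by_cases h3 : s (rev d₂) ∈ U
      · exact ⟨0, 1, by decide, by tauto, by tauto⟩
      · exact ⟨0, 2, by decide, by tauto, by tauto⟩
    · rintro ⟨i, j, hij, hi, hj⟩
      refine ⟨hU2.1, ?_⟩
      fin_cases i <;> fin_cases j <;> simp at hi hj hij <;> tauto
  · intro U hU
    have hU2 := (mem_lift _ _).1 hU
    rw [mem_lift]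
    simp only [mem_F, inr_mem_lift_zero]
    constructor
    · rintro ⟨-, h1, h2⟩ i
      fin_cases i <;> simp <;> tauto
    · intro h
      have h0 := h 0
      have h1 := h 1
      have h2 := h 2
      simp at h0 h1 h2
      tauto

end SubdividedTails

end DualGraph

namespace DualGraph

/-! ### The chain of 2-tails of the subdivided graph -/

section HatChain

variable {V E : Type*} {s : E × Bool → V} {P : V} {S U : Set V} {T T' Z : Set (V ⊕ (E × Bool))}
  {d d' d₁ d₂ : E × Bool} {p q : Fin 3} {n : ℕ}

variable (s) in
/-- The end of the edge `pos d p` on the side of the source of `d`. -/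
def inner (d : E × Bool) : Fin 3 → V ⊕ (E × Bool)
  | 0 => Sum.inl (s d)
  | 1 => Sum.inr d
  | 2 => Sum.inr (rev d)

variable (s) in
/-- The end of the edge `pos d p` on the side of the target of `d`. -/
def outer (d : E × Bool) : Fin 3 → V ⊕ (E × Bool)
  | 0 => Sum.inr d
  | 1 => Sum.inr (rev d)
  | 2 => Sum.inl (s (rev d))

lemma pos_mem_cut_iff : pos d p ∈ cut (sub s) T ↔ ¬ (inner s d p ∈ T ↔ outer s d p ∈ T) := by
  fin_cases p
  · exact inl_mem_cut
  · exact inr_mem_cut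
  · simp only [Fin.reduceFinMk, pos_two, inl_mem_cut, inner, outer]
    tauto

lemma inner_succ (hp : p ≠ 2) : inner s d (p + 1) = outer s d p := by
  fin_cases p
  · rfl
  · rfl
  · exact absurd rfl hp

lemma sub_one_ne_two (hp : p ≠ 0) : p - 1 ≠ 2 := by revert p; decide

lemma inner_mem_outer_notMem (hT : IsClean s T) (hd : Out s (base T) d)
    (hp : pos d p ∈ cut (sub s) T) : inner s d p ∈ T ∧ outer s d p ∉ T := by
  have h := hT.level hd hp
  obtain ⟨h1, h2⟩ := hd
  simp only [mem_base] at h1 h2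
  fin_cases p <;> simp [inner, outer] at h ⊢ <;> tauto

/-- A clean set is a uniform lift if all darts are cut at the same position. -/
lemma eq_lift_of_level (hT : IsClean s T)
    (h : ∀ d, Out s (base T) d → pos d p ∈ cut (sub s) T) : T = lift s p (base T) := by
  ext (v | d)
  · rfl
  · by_cases h1 : s d ∈ base T <;> by_cases h2 : s (rev d) ∈ base T
    · have a : (Sum.inr d : V ⊕ (E × Bool)) ∈ T := hT.lift_zero_subset ⟨h1, h2⟩
      have b := lift_mono (Fin.zero_le p) (hT.lift_zero_subset (s := s) |> fun _ =>
        (show (Sum.inr d : V ⊕ (E × Bool)) ∈ lift s 0 (base T) from ⟨h1, h2⟩))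
      tauto
    · have := (hT.level ⟨h1, h2⟩ (h d ⟨h1, h2⟩)).1
      rw [this]
      fin_cases p <;> simp [-mem_base, h1, h2]
    · have ho : Out s (base T) (rev d) := ⟨h2, by rwa [rev_rev]⟩
      have := (hT.level ho (h _ ho)).2
      rw [rev_rev] at this
      rw [this]
      fin_cases p <;> simp [-mem_base, h1, h2]
    · have a : (Sum.inr d : V ⊕ (E × Bool)) ∉ T := fun hx => by
        have := hT.subset_lift_two hx
        rw [inr_mem_lift_two] at this
        tauto
      have b : Sum.inr d ∉ lift s p (base T) := fun hx => by
        have := lift_mono (Fin.le_last p) hx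
        simp only [Fin.reduceLast, inr_mem_lift_two] at this
        tauto
      tauto

lemma subset_setLevel (hT : IsClean s T) (hd : Out s (base T) d)
    (hp : pos d p ∈ cut (sub s) T) (hpq : p ≤ q) : T ⊆ setLevel T d q := by
  have h := hT.level hd hp
  rintro (v | x) hx
  · exact Or.inl ⟨hx, by simp, by simp⟩
  · by_cases hxd : x.1 = d.1
    · rcases eq_or_eq_rev_of_fst hxd with rfl | rfl
      · rw [inr_mem_setLevel]
        rw [h.1] at hx
        fin_cases p <;> fin_cases q <;> simp_all
      · rw [inr_rev_mem_setLevel]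
        rw [h.2] at hx
        fin_cases p <;> fin_cases q <;> simp_all
    · rwa [inr_mem_setLevel_of_ne hxd]

variable (s P d₁ d₂) in
/-- The `2`-tails of the subdivided graph containing the new vertices `d₁` and `d₂`. -/
abbrev hatTwo : Set (Set (V ⊕ (E × Bool))) :=
  twoTails (sub s) (Sum.inl P) {Sum.inr d₁, Sum.inr d₂}

variable (s P d₁ d₂) in
/-- The free `3`-tails of the subdivided graph containing the new vertices `d₁` and `d₂`. -/
abbrev hatThree : Set (Set (V ⊕ (E × Bool))) :=
  threeTails (sub s) (Sum.inl P) {Sum.inr d₁, Sum.inr d₂}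

variable (s P d₁ d₂) in
/-- The outgoing edges of the nested `2`-tails of the subdivided graph. -/
def Used (g : (E × Bool) ⊕ E) : Prop :=
  ∃ n W, IsNth (sub s) (hatTwo s P d₁ d₂) n W ∧ g ∈ cut (sub s) W

/-- The standing assumptions: a finite connected graph and two darts on different edges. -/
structure Setup [Finite V] [Finite E] (s : E × Bool → V) (d₁ d₂ : E × Bool) : Prop where
  conn : IsConn s
  ne : d₁.1 ≠ d₂.1

namespace Setup

variable [Finite V] [Finite E] (h : Setup s d₁ d₂)
include h

lemma symm : Setup s d₂ d₁ := ⟨h.conn, h.ne.symm⟩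

lemma fam : IsMeetFamily (sub s) (hatTwo s P d₁ d₂) :=
  isMeetFamily_twoTails (isConn_sub h.conn) (Set.insert_nonempty _ _)

lemma clean_two (hT : T ∈ hatTwo s P d₁ d₂) : IsClean s T :=
  (isClean_of_mem_tails h.conn (by decide) hT.1 (hT.2 (by simp)) (hT.2 (by simp)) h.ne).1

lemma base_two (hT : T ∈ hatTwo s P d₁ d₂) : base T ∈ tails s P 2 :=
  (isClean_of_mem_tails h.conn (by decide) hT.1 (hT.2 (by simp)) (hT.2 (by simp)) h.ne).2.1

lemma clean_three (hT : T ∈ hatThree s P d₁ d₂) : IsClean s T :=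
  (isClean_of_mem_tails h.conn (by decide) hT.1 (hT.2.2 (by simp)) (hT.2.2 (by simp)) h.ne).1

lemma base_three (hT : T ∈ hatThree s P d₁ d₂) : base T ∈ tails s P 3 :=
  (isClean_of_mem_tails h.conn (by decide) hT.1 (hT.2.2 (by simp)) (hT.2.2 (by simp)) h.ne).2.1

omit h in
lemma not_used (hZ : Z ∈ hatThree s P d₁ d₂) {g : (E × Bool) ⊕ E} (hg : g ∈ cut (sub s) Z) :
    ¬ Used s P d₁ d₂ g := by
  rintro ⟨n, W, hW, hgW⟩
  exact Set.disjoint_left.1 (hZ.2.1 n W hW) hg hgW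

/-- Two-tails and three-tails cut no edge in opposite directions. -/
lemma no_cross (hZ : Z ∈ tails (sub s) (Sum.inl P) 3) (hX : {Sum.inr d₁, Sum.inr d₂} ⊆ Z)
    (hT : T ∈ hatTwo s P d₁ d₂) (hd : Out s (base Z) d) : ¬ Out s (base T) (rev d) := by
  have hi : ({Sum.inr d₁, Sum.inr d₂} : Set (V ⊕ (E × Bool))) ⊆ Z ∩ T := Set.subset_inter hX hT.2
  -- The intersection in the subdivided graph is a tail containing both new vertices, so its base is
  -- not empty. `tails_three_two` then applies to the bases.
  have hne : (base Z ∩ base T).Nonempty := by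
    rcases (tails_three_two (isConn_sub h.conn) hZ hT.1 ⟨_, hi (by simp : Sum.inr d₁ ∈ _)⟩).1 with
      h1 | h1
    · exact (isClean_of_mem_tails h.conn (by decide) h1.1 (hi (by simp)) (hi (by simp)) h.ne).2.2
    · exact (isClean_of_mem_tails h.conn (by decide) h1.1 (hi (by simp)) (hi (by simp)) h.ne).2.2
  have hZ' := (isClean_of_mem_tails h.conn (by decide) hZ (hX (by simp)) (hX (by simp)) h.ne).2.1
  rintro ⟨a, b⟩
  rw [rev_rev] at b
  exact hd.2 ((tails_three_two h.conn hZ' (h.base_two hT) hne).2 d hd.1 b a)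

lemma out_of_mem_cut (hZ : Z ∈ tails (sub s) (Sum.inl P) 3) (hX : {Sum.inr d₁, Sum.inr d₂} ⊆ Z)
    (hT : T ∈ hatTwo s P d₁ d₂) (hd : Out s (base Z) d) (he : d.1 ∈ cut s (base T)) :
    Out s (base T) d :=
  (out_or_out_rev he).resolve_right (h.no_cross hZ hX hT hd)

/-- The two darts leaving a `2`-tail. -/
lemma eq_or_eq (hT : T ∈ hatTwo s P d₁ d₂) (hd : Out s (base T) d) (hd' : Out s (base T) d')
    (hne : d ≠ d') {x : E × Bool} (hx : Out s (base T) x) : x = d ∨ x = d' := by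
  by_contra! hcon
  have h2 := (h.base_two hT).2.1
  have hsub : ({x.1, d.1, d'.1} : Set E) ⊆ cut s (base T) := by
    rintro e (rfl | rfl | rfl)
    exacts [hx.mem_cut, hd.mem_cut, hd'.mem_cut]
  have h3 := Set.ncard_le_ncard hsub
  have : ({x.1, d.1, d'.1} : Set E).ncard = 3 := Set.ncard_eq_three.2
    ⟨x.1, d.1, d'.1, fun e => hcon.1 (hx.unique hd e), fun e => hcon.2 (hx.unique hd' e),
      fun e => hne (hd.unique hd' e), rfl⟩
  omega

lemma exists_other (hT : T ∈ hatTwo s P d₁ d₂) (hd : Out s (base T) d) :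
    ∃ d', d' ≠ d ∧ Out s (base T) d' := by
  obtain ⟨a, b, hab, hc⟩ := Set.ncard_eq_two.1 (h.base_two hT).2.1
  obtain ⟨x, hx, hox⟩ := exists_out_of_mem_cut (s := s) (hc ▸ (by simp : a ∈ ({a, b} : Set E)))
  obtain ⟨y, hy, hoy⟩ := exists_out_of_mem_cut (s := s) (hc ▸ (by simp : b ∈ ({a, b} : Set E)))
  by_cases h1 : x = d
  · refine ⟨y, fun h2 => hab ?_, hoy⟩
    rw [← hx, ← hy, h1, h2]
  · exact ⟨x, h1, hox⟩

/-- The positions at which the first member of the chain is cut. -/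
lemma first_level (hT : IsNth (sub s) (hatTwo s P d₁ d₂) 0 T) (hd : Out s (base T) d)
    (hp : pos d p ∈ cut (sub s) T) :
    (p = 1 → d = d₁ ∨ d = d₂) ∧ (p = 2 → rev d = d₁ ∨ rev d = d₂) := by
  have hc := h.clean_two hT.mem
  have hl := hc.level hd hp
  -- Moving the cut back to q must lose one of the two prescribed new vertices, or the result would
  -- be a smaller member of the collection.
  have key : ∀ q, q < p → ∃ x, (x = d₁ ∨ x = d₂) ∧ Sum.inr x ∈ T ∧ Sum.inr x ∉ setLevel T d q := by
    intro q hq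
    by_contra! hcon
    have hQ : setLevel T d q ∈ hatTwo s P d₁ d₂ := by
      refine ⟨setLevel_mem_tails hc hd hT.mem.1, ?_⟩
      rintro x (rfl | rfl)
      · exact hcon d₁ (Or.inl rfl) (hT.mem.2 (by simp))
      · exact hcon d₂ (Or.inr rfl) (hT.mem.2 (by simp))
    have hsub : T ⊆ setLevel T d q := (show IsLeast _ T from hT).2 hQ
    fin_cases p
    · exact absurd hq (by simp)
    · have := hsub (hl.1.2 (by decide))
      rw [inr_mem_setLevel] at this
      fin_cases q <;> simp at hq this
    · have := hsub (hl.2.2 (by decide))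
      rw [inr_rev_mem_setLevel] at this
      fin_cases q <;> simp at hq this
  constructor
  · rintro rfl
    obtain ⟨x, hx, hxT, hxQ⟩ := key 0 (by decide)
    have hxd : x.1 = d.1 := by
      by_contra hne
      rw [inr_mem_setLevel_of_ne hne] at hxQ
      exact hxQ hxT
    rcases eq_or_eq_rev_of_fst hxd with rfl | rfl
    · exact hx
    · exact absurd (hl.2.1 hxT) (by decide)
  · rintro rfl
    obtain ⟨x, hx, hxT, hxQ⟩ := key 1 (by decide)
    have hxd : x.1 = d.1 := by
      by_contra hne
      rw [inr_mem_setLevel_of_ne hne] at hxQ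
      exact hxQ hxT
    rcases eq_or_eq_rev_of_fst hxd with rfl | rfl
    · exact absurd (inr_mem_setLevel.2 (by decide)) hxQ
    · exact hx

/-- A later member of the chain which is not cut at the first position of an edge comes directly
after one which is cut at the previous position. -/
lemma prev_level (hT : IsNth (sub s) (hatTwo s P d₁ d₂) n T)
    (hT' : IsNth (sub s) (hatTwo s P d₁ d₂) (n + 1) T') (hd : Out s (base T') d)
    (hp : pos d p ∈ cut (sub s) T') (hp0 : p ≠ 0) :
    pos d (p - 1) ∈ cut (sub s) T ∧ Out s (base T) d := by
  have hc' := h.clean_two hT'.mem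
  have hl := hc'.level hd hp
  have hpre := hT.precedes_succ hT'
  have hin := inner_mem_outer_notMem hc' hd hp
  have hnin : inner s d p ∉ T := by
    intro h1
    refine hpre.not_mem (e := pos d p) ?_ hp
    rw [pos_mem_cut_iff]
    have := fun h2 => hin.2 (hpre.subset h2)
    tauto
  -- Otherwise moving the cut of T' back by one edge gives a smaller set which still follows T.
  have main : pos d (p - 1) ∈ cut (sub s) T := by
    by_contra hcon
    have hsub : T ⊆ setLevel T' d (p - 1) := by
      rintro (v | x) hx
      · exact Or.inl ⟨hpre.subset hx, by simp, by simp⟩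
      · by_cases hxd : x.1 = d.1
        · have hx' := hpre.subset hx
          rcases eq_or_eq_rev_of_fst hxd with rfl | rfl
          · rw [inr_mem_setLevel]
            rintro h1
            have : p = 1 := by
              clear hp hl hin hnin hcon
              revert p; decide
            subst this
            exact hnin hx
          · exfalso
            have := hl.2.1 hx'
            subst this
            exact hnin hx
        · rw [inr_mem_setLevel_of_ne hxd]
          exact hpre.subset hx
    have hQ : setLevel T' d (p - 1) ∈ hatTwo s P d₁ d₂ :=
      ⟨setLevel_mem_tails hc' hd hT'.mem.1, hT.mem.2.trans hsub⟩
    have hpQ : Precedes (sub s) T (setLevel T' d (p - 1)) := by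
      refine precedes_of_subset (h.fam.cut_nonempty T hT.mem) hsub (Set.disjoint_left.2 ?_)
      intro g hg hg'
      by_cases hgd : under g = d.1
      · obtain ⟨r, rfl⟩ := exists_pos g d hgd
        rw [pos_mem_cut_setLevel hd] at hg'
        exact hcon (hg' ▸ hg)
      · rw [mem_cut_setLevel_of_ne hgd] at hg'
        exact hpre.not_mem hg hg'
    have hle := (hT.step hT').2 ⟨hQ, hpQ⟩
    have h3 := hle hin.1
    clear hp hl hcon hnin
    fin_cases p
    · exact hp0 rfl
    · simp [inner, inr_mem_setLevel] at h3
    · exact absurd (inr_rev_mem_setLevel.1 h3) (by decide)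
  refine ⟨main, ?_⟩
  have hu := (h.clean_two hT.mem).under_mem main
  rw [under_pos] at hu
  refine (out_or_out_rev hu).resolve_right fun h1 => hd.2 (base_mono hpre.subset h1.1)

/-- The later position cannot be 0, since the source of d already lies in T and the edge would be
shared. `prev_level` then identifies the earlier position. -/
lemma next_level (hT : IsNth (sub s) (hatTwo s P d₁ d₂) n T)
    (hT' : IsNth (sub s) (hatTwo s P d₁ d₂) (n + 1) T') (hd : Out s (base T) d)
    (hd' : Out s (base T') d) (hp : pos d p ∈ cut (sub s) T) :
    p ≠ 2 ∧ pos d (p + 1) ∈ cut (sub s) T' := by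
  obtain ⟨q, hq, -⟩ := (h.clean_two hT'.mem).exists_level hd'
  have hpre := hT.precedes_succ hT'
  by_cases hq0 : q = 0
  · exfalso
    subst hq0
    have a := inner_mem_outer_notMem (h.clean_two hT'.mem) hd' hq
    refine hpre.not_mem (e := pos d 0) ?_ hq
    rw [pos_mem_cut_iff]
    have h1 : inner s d 0 ∈ T := hd.1
    have h2 := fun h2 => a.2 (hpre.subset h2)
    tauto
  · have := (h.clean_two hT.mem).eq_of_pos hp (h.prev_level hT hT' hd' hq hq0).1
    subst this
    rw [sub_add_cancel]
    exact ⟨sub_one_ne_two hq0, hq⟩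

/-- If both positions can be advanced, then this gives the next member of the chain. -/
lemma advance (hT : IsNth (sub s) (hatTwo s P d₁ d₂) n T) (hd : Out s (base T) d)
    (hd' : Out s (base T) d') (hne : d ≠ d') (hp : pos d p ∈ cut (sub s) T)
    (hq : pos d' q ∈ cut (sub s) T) (hp2 : p ≠ 2) (hq2 : q ≠ 2) :
    ∃ T', IsNth (sub s) (hatTwo s P d₁ d₂) (n + 1) T' ∧ base T' = base T := by
  have hc := h.clean_two hT.mem
  have hne1 : d.1 ≠ d'.1 := fun e => hne (hd.unique hd' e)
  have hle : ∀ p : Fin 3, p ≠ 2 → p ≤ p + 1 := by decide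
  have hne' : ∀ p : Fin 3, p ≠ p + 1 := by decide
  set Q₁ := setLevel T d (p + 1) with hQ₁
  have hc₁ : IsClean s Q₁ := isClean_setLevel hc hd
  have hd₁' : Out s (base Q₁) d' := by rwa [hQ₁, base_setLevel]
  have hq₁ : pos d' q ∈ cut (sub s) Q₁ := by
    rw [hQ₁, mem_cut_setLevel_of_ne (by simpa using hne1.symm)]
    exact hq
  set Q := setLevel Q₁ d' (q + 1) with hQ
  have hbase : base Q = base T := by rw [hQ, base_setLevel, hQ₁, base_setLevel]
  have hsub : T ⊆ Q := (subset_setLevel hc hd hp (hle p hp2)).trans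
    (subset_setLevel hc₁ hd₁' hq₁ (hle q hq2))
  have hQm : Q ∈ hatTwo s P d₁ d₂ :=
    ⟨setLevel_mem_tails hc₁ hd₁' (setLevel_mem_tails hc hd hT.mem.1), hT.mem.2.trans hsub⟩
  have hpQ : Precedes (sub s) T Q := by
    refine precedes_of_subset (h.fam.cut_nonempty T hT.mem) hsub (Set.disjoint_left.2 ?_)
    intro g hg hg'
    by_cases h1 : under g = d'.1
    · obtain ⟨r, rfl⟩ := exists_pos g d' h1
      rw [hQ, pos_mem_cut_setLevel hd₁'] at hg'
      exact hne' q (hc.eq_of_pos hq (hg' ▸ hg))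
    · rw [hQ, mem_cut_setLevel_of_ne h1] at hg'
      by_cases h2 : under g = d.1
      · obtain ⟨r, rfl⟩ := exists_pos g d h2
        rw [hQ₁, pos_mem_cut_setLevel hd] at hg'
        exact hne' p (hc.eq_of_pos hp (hg' ▸ hg))
      · obtain ⟨x, hx, hox⟩ := exists_out_of_mem_cut (hc.under_mem hg)
        rcases h.eq_or_eq hT.mem hd hd' hne hox with rfl | rfl
        · exact h2 hx.symm
        · exact h1 hx.symm
  obtain ⟨T', hT', hs'⟩ := h.fam.exists_succ hT hQm hpQ
  refine ⟨T', hT', ?_⟩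
  exact ((base_mono hs').trans hbase.subset).antisymm (base_mono (hT.precedes_succ hT').subset)

/-- If one position can be advanced but is not, then the next member starts afresh. -/
lemma reset (hT : IsNth (sub s) (hatTwo s P d₁ d₂) n T)
    (hT' : IsNth (sub s) (hatTwo s P d₁ d₂) (n + 1) T') (hd : Out s (base T) d)
    (hp : pos d p ∈ cut (sub s) T) (hp2 : p ≠ 2) (hn : pos d (p + 1) ∉ cut (sub s) T') :
    T' = lift s 0 (base T') := by
  refine eq_lift_of_level (h.clean_two hT'.mem) fun x hx => ?_
  obtain ⟨r, hr, -⟩ := (h.clean_two hT'.mem).exists_level hx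
  by_cases hr0 : r = 0
  · exact hr0 ▸ hr
  exfalso
  -- A nonzero position on x comes from a position of T which was not the last one. Then both
  -- positions of T can be advanced, and the next member keeps its base and does advance d.
  obtain ⟨h1, h2⟩ := h.prev_level hT hT' hx hr hr0
  have hxd : d ≠ x := by
    rintro rfl
    have := (h.clean_two hT.mem).eq_of_pos hp h1
    rw [this, sub_add_cancel] at hn
    exact hn hr
  obtain ⟨T'', hT'', hb⟩ := h.advance hT hd h2 hxd hp h1 hp2 (sub_one_ne_two hr0)
  obtain rfl := hT'.unique hT''
  exact hn (h.next_level hT hT' hd (hb ▸ hd) hp).2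

omit h in
variable (s P d₁ d₂) in
/-- `T` is a uniform lift, and the lower uniform lifts of the same set belong to the chain. -/
def Full (T : Set (V ⊕ (E × Bool))) : Prop :=
  ∃ p, T = lift s p (base T) ∧
    ∀ q ≤ p, ∃ m, IsNth (sub s) (hatTwo s P d₁ d₂) m (lift s q (base T))

omit h in
lemma full_of_eq_lift_zero (hT : IsNth (sub s) (hatTwo s P d₁ d₂) n T)
    (h0 : T = lift s 0 (base T)) : Full s P d₁ d₂ T := by
  refine ⟨0, h0, fun q hq => ⟨n, ?_⟩⟩
  obtain rfl : q = 0 := Fin.le_zero_iff.1 hq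
  rwa [← h0]

lemma lift_next {B : Set V} (hT : IsNth (sub s) (hatTwo s P d₁ d₂) n (lift s p B))
    (hp : p ≠ 2) : IsNth (sub s) (hatTwo s P d₁ d₂) (n + 1) (lift s (p + 1) B) := by
  obtain ⟨e, he⟩ := cut_nonempty_of_mem_tails (by decide) (h.base_two hT.mem)
  obtain ⟨d, rfl, hd⟩ := exists_out_of_mem_cut he
  obtain ⟨d', hne, hd'⟩ := h.exists_other hT.mem hd
  have lev : ∀ x, Out s B x → pos x p ∈ cut (sub s) (lift s p B) := fun x hx =>
    (pos_mem_cut_lift hx).2 rfl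
  obtain ⟨T', hT', hb⟩ := h.advance hT hd hd' hne.symm (lev d hd) (lev d' hd') hp hp
  rw [base_lift] at hb
  have : T' = lift s (p + 1) (base T') := by
    refine eq_lift_of_level (h.clean_two hT'.mem) fun x hx => ?_
    rw [hb] at hx
    exact (h.next_level hT hT' hx (by rwa [hb]) (lev x hx)).2
  rw [hb] at this
  rwa [← this]

/-- A uniform member advances uniformly up to position 2. After position 2 no cut can advance, so
the next member is cut at position 0 everywhere. -/
lemma full_succ (hT : IsNth (sub s) (hatTwo s P d₁ d₂) n T)
    (hT' : IsNth (sub s) (hatTwo s P d₁ d₂) (n + 1) T') (hf : Full s P d₁ d₂ T) :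
    Full s P d₁ d₂ T' := by
  obtain ⟨p, hp, hq⟩ := hf
  by_cases hp2 : p = 2
  · subst hp2
    refine full_of_eq_lift_zero hT' (eq_lift_of_level (h.clean_two hT'.mem) fun x hx => ?_)
    obtain ⟨r, hr, -⟩ := (h.clean_two hT'.mem).exists_level hx
    by_cases hr0 : r = 0
    · exact hr0 ▸ hr
    exfalso
    obtain ⟨h1, h2⟩ := h.prev_level hT hT' hx hr hr0
    rw [hp] at h1
    exact sub_one_ne_two hr0 ((pos_mem_cut_lift h2).1 h1)
  · have hT2 := h.lift_next (B := base T) (p := p) (n := n) (by rwa [← hp]) hp2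
    obtain rfl := hT'.unique hT2
    refine ⟨p + 1, rfl, fun q hqp => ?_⟩
    rw [base_lift]
    by_cases hqp' : q ≤ p
    · exact hq q hqp'
    · have : q = p + 1 := by
        clear hp hq hT2 hT'
        revert p q
        decide
      exact this ▸ ⟨_, hT2⟩

lemma full_of_le {m : ℕ} (hT : IsNth (sub s) (hatTwo s P d₁ d₂) n T)
    (hT' : IsNth (sub s) (hatTwo s P d₁ d₂) m T') (hf : Full s P d₁ d₂ T) (hnm : n ≤ m) :
    Full s P d₁ d₂ T' := by
  induction m generalizing T' with
  | zero =>
    obtain rfl : n = 0 := by omega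
    rwa [← hT.unique hT']
  | succ m ih =>
    rcases Nat.lt_or_ge n (m + 1) with h1 | h1
    · obtain ⟨A, hA⟩ := hT'.exists_of_le (m := m) (by omega)
      exact h.full_succ hA hT' (ih hA (by omega))
    · obtain rfl : n = m + 1 := by omega
      rwa [← hT.unique hT']

/-- The lower lifts belong to the chain by definition and the higher ones by `lift_next`, so every
edge of a path leaving the base is used. -/
lemma used_of_full (hT : IsNth (sub s) (hatTwo s P d₁ d₂) n T) (hf : Full s P d₁ d₂ T)
    (hd : Out s (base T) d) (q : Fin 3) : Used s P d₁ d₂ (pos d q) := by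
  obtain ⟨p, hp, hq⟩ := hf
  have key : ∃ m, IsNth (sub s) (hatTwo s P d₁ d₂) m (lift s q (base T)) := by
    obtain ⟨m0, h0⟩ := hq 0 (Fin.zero_le p)
    have h1 := h.lift_next h0 (by decide)
    have h2 := h.lift_next h1 (by decide)
    fin_cases q
    exacts [⟨_, h0⟩, ⟨_, h1⟩, ⟨_, h2⟩]
  obtain ⟨m, hm⟩ := key
  exact ⟨m, _, hm, (pos_mem_cut_lift hd).2 rfl⟩

/-- The union of a free `3`-tail and a member of the chain. -/
lemma union_mem (hZ : Z ∈ hatThree s P d₁ d₂) (hT : IsNth (sub s) (hatTwo s P d₁ d₂) n T)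
    (hn : ¬ T ⊆ Z) : T ∪ Z ∈ hatTwo s P d₁ d₂ := by
  have hi : ({Sum.inr d₁, Sum.inr d₂} : Set (V ⊕ (E × Bool))) ⊆ Z ∩ T :=
    Set.subset_inter hZ.2.2 hT.mem.2
  rcases (tails_three_two (isConn_sub h.conn) hZ.1 hT.mem.1
    ⟨_, hi (by simp : Sum.inr d₁ ∈ _)⟩).1 with h1 | h1
  · exact absurd (h.fam.subset_of_inter_mem hT hZ.2.1 ⟨h1.1, hi⟩) hn
  · rw [Set.union_comm]
    exact ⟨h1.2, hZ.2.2.trans Set.subset_union_left⟩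

-- A free 3-tail cuts no edge of the chain, so it contains both or neither of the ends of a used
-- edge. This allows passing from one edge of a path to the next.
omit h in
lemma outer_mem_iff_inner_mem (hZ : Z ∈ hatThree s P d₁ d₂) (hu : Used s P d₁ d₂ (pos d p)) :
    inner s d p ∈ Z ↔ outer s d p ∈ Z := by
  by_contra hcon
  exact not_used hZ (pos_mem_cut_iff.2 hcon) hu

/-- If the union of a chain member `T` and a free `3`-tail `Z` is cut at an outgoing edge of `T`,
then the other outgoing edge of the union is one of `Z`. -/
lemma exists_mem_cut_union (hZ : Z ∈ hatThree s P d₁ d₂)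
    (hT : IsNth (sub s) (hatTwo s P d₁ d₂) n T) (hn : ¬ T ⊆ Z) (hn' : ¬ Z ⊆ T)
    {g : (E × Bool) ⊕ E} (hg : g ∈ cut (sub s) T) (hg' : g ∈ cut (sub s) (T ∪ Z)) :
    ∃ g', cut (sub s) (T ∪ Z) = {g, g'} ∧ g' ∈ cut (sub s) Z ∧ g' ≠ g ∧ g' ∉ cut (sub s) T := by
  have hU := h.union_mem hZ hT hn
  obtain ⟨a, b, hab, hc⟩ := Set.ncard_eq_two.1 hU.1.2.1
  obtain ⟨g', hg'e, hne⟩ : ∃ g', cut (sub s) (T ∪ Z) = {g, g'} ∧ g' ≠ g := by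
    rw [hc] at hg'
    rcases hg' with rfl | rfl
    · exact ⟨b, hc, hab.symm⟩
    · exact ⟨a, by rw [hc, Set.pair_comm], hab⟩
  have hgT : g' ∉ cut (sub s) T := by
    intro hgT
    have hsub : cut (sub s) (T ∪ Z) ⊆ cut (sub s) T := by
      rw [hg'e]
      rintro x (rfl | rfl) <;> assumption
    have := Set.eq_of_subset_of_ncard_le hsub (by rw [hU.1.2.1, hT.mem.1.2.1])
    have := eq_of_cut_eq (isConn_sub h.conn) hU.1.1 hT.mem.1.1 this
    exact hn' (Set.union_eq_left.1 this)
  have hm : g' ∈ cut (sub s) (T ∪ Z) := by rw [hg'e]; simp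
  exact ⟨g', hg'e, (cut_union_subset _ _ hm).resolve_left hgT, hne, hgT⟩

/-- A free `3`-tail is not contained in the members of the chain which precede the full ones. -/
lemma full_or_not_subset (hZ : Z ∈ hatThree s P d₁ d₂)
    (hT : IsNth (sub s) (hatTwo s P d₁ d₂) n T) : Full s P d₁ d₂ T ∨ ¬ Z ⊆ T := by
  induction n generalizing T with
  | zero =>
    by_cases hall : ∀ d, Out s (base T) d → pos d 0 ∈ cut (sub s) T
    · exact Or.inl (full_of_eq_lift_zero hT (eq_lift_of_level (h.clean_two hT.mem) hall))
    right
    push Not at hall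
    obtain ⟨x, hx, hx0⟩ := hall
    obtain ⟨r, hr, -⟩ := (h.clean_two hT.mem).exists_level hx
    have hin := inner_mem_outer_notMem (h.clean_two hT.mem) hx hr
    have hfl := h.first_level hT hx hr
    intro hsub
    -- If Z were contained in T, it would miss both ends of this used edge. But at a nonzero
    -- position of the first member the inner end is one of the two new vertices prescribed in Z.
    have hnot : inner s x r ∉ Z := fun h1 =>
      hin.2 (hsub ((outer_mem_iff_inner_mem hZ ⟨0, T, hT, hr⟩).1 h1))
    fin_cases r
    · exact hx0 hr
    · rcases hfl.1 rfl with rfl | rfl <;> exact hnot (hZ.2.2 (by simp [inner]))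
    · rcases hfl.2 rfl with hd | hd <;> exact hnot (hZ.2.2 (by simp [inner, hd]))
  | succ n ih =>
    obtain ⟨T₀, hT₀⟩ := hT.exists_of_le (m := n) (by omega)
    rcases ih hT₀ with hf | hni
    · exact Or.inl (h.full_succ hT₀ hT hf)
    by_cases hall : ∀ d, Out s (base T) d → pos d 0 ∈ cut (sub s) T
    · exact Or.inl (full_of_eq_lift_zero hT (eq_lift_of_level (h.clean_two hT.mem) hall))
    right
    push Not at hall
    obtain ⟨x, hx, hx0⟩ := hall
    obtain ⟨r, hr, -⟩ := (h.clean_two hT.mem).exists_level hx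
    have hr0 : r ≠ 0 := fun h1 => hx0 (h1 ▸ hr)
    have hin := inner_mem_outer_notMem (h.clean_two hT.mem) hx hr
    obtain ⟨h1, h2⟩ := h.prev_level hT₀ hT hx hr hr0
    have hpre := hT₀.precedes_succ hT
    have hr1 : inner s x r = outer s x (r - 1) := by
      rw [← inner_succ (sub_one_ne_two hr0), sub_add_cancel]
    intro hsub
    have n1 : inner s x r ∉ Z := fun h3 =>
      hin.2 (hsub ((outer_mem_iff_inner_mem hZ ⟨_, T, hT, hr⟩).1 h3))
    have n2 : inner s x (r - 1) ∉ Z := fun h3 => n1 (by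
      rw [hr1]
      exact (outer_mem_iff_inner_mem hZ ⟨_, T₀, hT₀, h1⟩).1 h3)
    have hin₀ := inner_mem_outer_notMem (h.clean_two hT₀.mem) h2 h1
    have hn : ¬ T₀ ⊆ Z := fun h3 => n2 (h3 hin₀.1)
    have hU := h.union_mem hZ hT₀ hn
    have hUT : T₀ ∪ Z ⊆ T := Set.union_subset hpre.subset hsub
    have hcU : pos x (r - 1) ∈ cut (sub s) (T₀ ∪ Z) := by
      rw [pos_mem_cut_iff]
      have a : inner s x (r - 1) ∈ T₀ ∪ Z := Or.inl hin₀.1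
      have b : outer s x (r - 1) ∉ T₀ ∪ Z := by
        rintro (h3 | h3)
        · exact hin₀.2 h3
        · exact n1 (hr1 ▸ h3)
      tauto
    obtain ⟨g', hcut, hgZ, hgne, hgT⟩ := h.exists_mem_cut_union hZ hT₀ hn hni h1 hcU
    have hclU := h.clean_two hU
    have hoU : Out s (base (T₀ ∪ Z)) x := ⟨Or.inl h2.1, fun h3 => hx.2 (hUT h3)⟩
    -- The union with the predecessor is a 2-tail, cut on the path of x and at an edge of Z. Moving
    -- its cut on x to the position r gives a candidate for the next member contained in T, so T
    -- equals it and cuts an edge of Z.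
    set Q := setLevel (T₀ ∪ Z) x r with hQ
    have hle : r - 1 ≤ r := by clear hr hin hr1 n1 n2 h1 hin₀ hcU hcut hgne Q hQ; revert r; decide
    have hUQ : T₀ ∪ Z ⊆ Q := subset_setLevel hclU hoU hcU hle
    have hQm : Q ∈ hatTwo s P d₁ d₂ := ⟨setLevel_mem_tails hclU hoU hU.1, hU.2.trans hUQ⟩
    have hgx : under g' ≠ x.1 := by
      intro h3
      obtain ⟨t, rfl⟩ := exists_pos g' x h3
      exact hgne (by rw [hclU.eq_of_pos (hcut ▸ (by simp) : pos x t ∈ _) hcU])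
    have hpQ : Precedes (sub s) T₀ Q := by
      refine precedes_of_subset (h.fam.cut_nonempty T₀ hT₀.mem)
        (Set.subset_union_left.trans hUQ) (Set.disjoint_left.2 ?_)
      intro g hg hg'
      by_cases hgd : under g = x.1
      · obtain ⟨t, rfl⟩ := exists_pos g x hgd
        rw [hQ, pos_mem_cut_setLevel hoU] at hg'
        subst hg'
        exact hpre.not_mem hg hr
      · rw [hQ, mem_cut_setLevel_of_ne hgd, hcut] at hg'
        rcases hg' with rfl | rfl
        · exact hgd (under_pos _)
        · exact hgT hg
    have hTQ : T ⊆ Q := (hT₀.step hT).2 ⟨hQm, hpQ⟩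
    have hQT : Q ⊆ T := by
      rintro y (hy | ⟨rfl, hy⟩ | ⟨rfl, hy⟩)
      · exact hUT hy.1
      · exact ((h.clean_two hT.mem).level hx hr).1.2 hy
      · exact ((h.clean_two hT.mem).level hx hr).2.2 hy
    have hTQ' : T = Q := hTQ.antisymm hQT
    refine not_used hZ hgZ ⟨_, T, hT, ?_⟩
    rw [hTQ', hQ, mem_cut_setLevel_of_ne hgx, hcut]
    simp

/-- An outgoing edge of the chain lying outside of a free `3`-tail belongs to a path all of whose
edges are outgoing edges of the chain. -/
lemma used_of_notMem (hZ : Z ∈ hatThree s P d₁ d₂)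
    (hT : IsNth (sub s) (hatTwo s P d₁ d₂) n T) (hd : Out s (base T) d)
    (hp : pos d p ∈ cut (sub s) T) (hnot : inner s d p ∉ Z) :
    s d ∉ base Z ∧ s (rev d) ∉ base Z ∧ ∀ q, Used s P d₁ d₂ (pos d q) := by
  have hcZ := h.clean_three hZ
  have hout : outer s d p ∉ Z := fun h1 =>
    hnot ((outer_mem_iff_inner_mem hZ ⟨_, T, hT, hp⟩).2 h1)
  have hin := inner_mem_outer_notMem (h.clean_two hT.mem) hd hp
  have ends : d.1 ∉ cut s (base Z) → s d ∉ base Z ∧ s (rev d) ∉ base Z := by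
    intro h1
    rw [mem_cut_iff, not_not] at h1
    by_contra h2
    have h3 : s d ∈ base Z := by tauto
    have h4 : s (rev d) ∈ base Z := by tauto
    have a : (Sum.inr d : V ⊕ (E × Bool)) ∈ Z := hcZ.lift_zero_subset ⟨h3, h4⟩
    have b : (Sum.inr (rev d) : V ⊕ (E × Bool)) ∈ Z :=
      hcZ.lift_zero_subset ⟨h4, by rwa [rev_rev]⟩
    fin_cases p
    exacts [hnot h3, hnot a, hnot b]
  rcases h.full_or_not_subset hZ hT with hf | hni
  · have hall := h.used_of_full hT hf hd
    have h1 : d.1 ∉ cut s (base Z) := by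
      intro h1
      obtain ⟨g, hg, hgd⟩ := exists_mem_cut_of_mem_cut_base h1
      obtain ⟨q, rfl⟩ := exists_pos g d hgd
      exact not_used hZ hg (hall q)
    exact ⟨(ends h1).1, (ends h1).2, hall⟩
  have hn : ¬ T ⊆ Z := fun h1 => hnot (h1 hin.1)
  have hU := h.union_mem hZ hT hn
  have hcU : pos d p ∈ cut (sub s) (T ∪ Z) := by
    rw [pos_mem_cut_iff]
    have a : inner s d p ∈ T ∪ Z := Or.inl hin.1
    have b : outer s d p ∉ T ∪ Z := by
      rintro (h3 | h3)
      exacts [hin.2 h3, hout h3]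
    tauto
  obtain ⟨g', hcut, hgZ, hgne, hgT⟩ := h.exists_mem_cut_union hZ hT hn hni hp hcU
  have hclU := h.clean_two hU
  have hoU : Out s (base (T ∪ Z)) d := by
    have := hclU.under_mem hcU
    rw [under_pos] at this
    refine (out_or_out_rev this).resolve_right fun h1 => h1.2 ?_
    rw [rev_rev]
    exact Or.inl hd.1
  -- The modified union is a 2-tail, so it shares an edge with the chain. Its other edge belongs to
  -- Z and is not used, so the edge on the path of d is.
  have key : ∀ q, Z ⊆ setLevel (T ∪ Z) d q → Used s P d₁ d₂ (pos d q) := by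
    intro q hq
    obtain ⟨m, W, hW, g, hgW, hgQ⟩ := h.fam.exists_not_disjoint
      (⟨setLevel_mem_tails hclU hoU hU.1, hZ.2.2.trans hq⟩ :
        setLevel (T ∪ Z) d q ∈ hatTwo s P d₁ d₂)
    by_cases hgd : under g = d.1
    · obtain ⟨t, rfl⟩ := exists_pos g d hgd
      rw [pos_mem_cut_setLevel hoU] at hgQ
      exact ⟨m, W, hW, hgQ ▸ hgW⟩
    · rw [mem_cut_setLevel_of_ne hgd, hcut] at hgQ
      rcases hgQ with rfl | rfl
      · exact absurd (under_pos _) hgd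
      · exact absurd ⟨m, W, hW, hgW⟩ (not_used hZ hgZ)
  have sub_of : ∀ q, ((Sum.inr d : V ⊕ (E × Bool)) ∈ Z → q ≠ 0) →
      ((Sum.inr (rev d) : V ⊕ (E × Bool)) ∈ Z → q = 2) → Z ⊆ setLevel (T ∪ Z) d q := by
    rintro q h1 h2 (v | x) hx
    · exact Or.inl ⟨Or.inr hx, by simp, by simp⟩
    · by_cases hxd : x.1 = d.1
      · rcases eq_or_eq_rev_of_fst hxd with rfl | rfl
        · exact inr_mem_setLevel.2 (h1 hx)
        · exact inr_rev_mem_setLevel.2 (h2 hx)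
      · exact (inr_mem_setLevel_of_ne hxd).2 (Or.inr hx)
  have h1 : d.1 ∉ cut s (base Z) := by
    intro h1
    have hoZ : Out s (base Z) d := (out_or_out_rev h1).resolve_right fun h2 => by
      have := h.no_cross hZ.1 hZ.2.2 hT.mem h2
      rw [rev_rev] at this
      exact this hd
    obtain ⟨q, hq, hl1, hl2⟩ := hcZ.exists_level hoZ
    exact not_used hZ hq (key q (sub_of q hl1.1 hl2.1))
  have he := ends h1
  refine ⟨he.1, he.2, fun q => key q (sub_of q (fun h2 => ?_) fun h2 => ?_)⟩
  · have := hcZ.subset_lift_two h2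
    rw [inr_mem_lift_two] at this
    tauto
  · have := hcZ.subset_lift_two h2
    rw [inr_mem_lift_two, rev_rev] at this
    tauto

/-- Suppose the last edge of the path of d is used. If its inner end lies in Z, so does the target
of d, which is impossible as d leaves the base. Otherwise `used_of_notMem` puts the source of d
outside the base as well. -/
lemma lift_two_mem (hZ : Z ∈ hatThree s P d₁ d₂) :
    lift s 2 (base Z) ∈ hatThree s P d₁ d₂ := by
  have hcZ := h.clean_three hZ
  refine ⟨lift_mem_tails_iff.2 (h.base_three hZ), fun n W hW => Set.disjoint_left.2 ?_,
    hZ.2.2.trans hcZ.subset_lift_two⟩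
  intro g hg hgW
  obtain ⟨d, hd, rfl⟩ := mem_cut_lift_iff.1 hg
  have hu := (h.clean_two hW.mem).under_mem hgW
  rw [under_pos] at hu
  have hoW := h.out_of_mem_cut hZ.1 hZ.2.2 hW.mem hd hu
  by_cases hin : inner s d 2 ∈ Z
  · exact hd.2 ((outer_mem_iff_inner_mem hZ ⟨n, W, hW, hgW⟩).1 hin)
  · exact (h.used_of_notMem hZ hW hoW hgW hin).1 hd.1

/-- A used edge in the cut of the lift would have its inner end outside Z. Then the whole path would
be used, including the edge cut by lift 2 U. -/
lemma lift_mem_of_subset (hZ : Z ∈ hatThree s P d₁ d₂) (hZU : Z ⊆ lift s p U)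
    (hU : lift s 2 U ∈ hatThree s P d₁ d₂) : lift s p U ∈ hatThree s P d₁ d₂ := by
  refine ⟨lift_mem_tails_iff.2 (lift_mem_tails_iff.1 hU.1), fun n W hW => Set.disjoint_left.2 ?_,
    hZ.2.2.trans hZU⟩
  intro g hg hgW
  obtain ⟨d, hd, rfl⟩ := mem_cut_lift_iff.1 hg
  have hu := (h.clean_two hW.mem).under_mem hgW
  rw [under_pos] at hu
  have hoW := h.out_of_mem_cut hU.1 hU.2.2 hW.mem hd hu
  have hin := inner_mem_outer_notMem (isClean_lift p) hd hg
  have hnot : inner s d p ∉ Z := fun h1 =>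
    hin.2 (hZU ((outer_mem_iff_inner_mem hZ ⟨n, W, hW, hgW⟩).1 h1))
  exact not_used hU ((pos_mem_cut_lift hd).2 rfl) ((h.used_of_notMem hZ hW hoW hgW hnot).2.2 2)

end Setup

end HatChain

end DualGraph

namespace DualGraph

/-! ### The chains of 3-tails are interlaced -/

section ThreeTails

variable {V E : Type*} {s : E × Bool → V} {P : V} {S U : Set V} {T T' Z : Set (V ⊕ (E × Bool))}
  {d d' d₁ d₂ : E × Bool} {p q : Fin 3} {n m : ℕ} {X : Set V} {r a b c : Fin 3} {e : E}

variable (s P) in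
/-- The edge `e` is an outgoing edge of a nested `2`-tail of `X`. -/
def UsedIn (X : Set V) (e : E) : Prop :=
  ∃ n W, IsNth s (twoTails s P X) n W ∧ e ∈ cut s W

variable (s P d₁ d₂) in
/-- The nested chain of `2`-tails of `X` consists of every third set of vertices underlying the
nested chain of the subdivided graph. -/
def ChainAt (X : Set V) (r : Fin 3) : Prop :=
  ∀ n W, IsNth s (twoTails s P X) n W ↔
    ∃ T, IsNth (sub s) (hatTwo s P d₁ d₂) (3 * n + r.val) T ∧ base T = W

lemma ChainAt.usedIn (hX : ChainAt s P d₁ d₂ X r) (hT : IsNth (sub s) (hatTwo s P d₁ d₂) m T)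
    (he : e ∈ cut s (base T)) (hm : m % 3 = r.val) : UsedIn s P X e := by
  refine ⟨m / 3, base T, (hX _ _).2 ⟨T, ?_, rfl⟩, he⟩
  rwa [← hm, Nat.div_add_mod]

lemma UsedIn.exists_nth (h : UsedIn s P X e) (hX : ChainAt s P d₁ d₂ X r) :
    ∃ m T, IsNth (sub s) (hatTwo s P d₁ d₂) m T ∧ e ∈ cut s (base T) ∧ m % 3 = r.val := by
  obtain ⟨n, W, hW, he⟩ := h
  obtain ⟨T, hT, rfl⟩ := (hX n W).1 hW
  exact ⟨_, T, hT, he, by omega⟩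

lemma ChainAt.subset_base (hX : ChainAt s P d₁ d₂ X r)
    (hT : IsNth (sub s) (hatTwo s P d₁ d₂) r.val T) : X ⊆ base T :=
  IsNth.mem ((hX 0 (base T)).2 ⟨T, by simpa using hT, rfl⟩) |>.2

lemma mem_threeTails_iff (hU : U ∈ tails s P 3) :
    U ∈ threeTails s P X ↔ X ⊆ U ∧ ∀ d, Out s U d → ¬ UsedIn s P X d.1 := by
  constructor
  · rintro ⟨-, h1, h2⟩
    refine ⟨h2, fun d hd => ?_⟩
    rintro ⟨n, W, hW, hdW⟩
    exact Set.disjoint_left.1 (h1 n W hW) hd.mem_cut hdW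
  · rintro ⟨h1, h2⟩
    refine ⟨hU, fun n W hW => Set.disjoint_left.2 fun e he heW => ?_, h1⟩
    obtain ⟨d, rfl, hd⟩ := exists_out_of_mem_cut he
    exact h2 d hd ⟨n, W, hW, heW⟩

/-- The outgoing darts of a free `3`-tail which start in `X` are outgoing edges of nested
tails. -/
lemma isTerminal_of_mem_threeTails [Finite V] [Finite E] (hs : IsConn s)
    (hU : U ∈ threeTails s P X) (hd : Out s U d) (hdX : s d ∈ X) : IsTerminal s P X d.1 := by
  obtain ⟨W, hW, hWU⟩ := (isMeetFamily_threeTails hs ⟨_, hdX⟩).exists_zero hU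
  exact ⟨0, W, Or.inr hW, Out.mem_cut ⟨hW.mem.2.2 hdX, fun h => hd.2 (hWU h)⟩⟩

/-- The chains of `2`-tails of the three pairs of vertices are interlaced, and the chains of
the pairs `(d₁, d₂)` and `(rev d₁, rev d₂)` avoid one of the two edges. -/
structure SyncSetup [Finite V] [Finite E] (s : E × Bool → V) (P : V) (d₁ d₂ : E × Bool)
    (a b c : Fin 3) : Prop extends Setup s d₁ d₂ where
  ne_ab : a ≠ b
  ne_ac : a ≠ c
  ne_bc : b ≠ c
  chain_a : ChainAt s P d₁ d₂ {s d₁, s d₂} a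
  chain_b : ChainAt s P d₁ d₂ {s d₁, s (rev d₂)} b
  chain_c : ChainAt s P d₁ d₂ {s (rev d₁), s d₂} c
  quasi : ¬ (IsTerminal s P {s d₁, s d₂} d₁.1 ∧ IsTerminal s P {s d₁, s d₂} d₂.1)
  quasi_rev : ¬ (IsTerminal s P {s (rev d₁), s (rev d₂)} d₁.1 ∧
    IsTerminal s P {s (rev d₁), s (rev d₂)} d₂.1)

namespace Setup

variable [Finite V] [Finite E] (h : Setup s d₁ d₂)
include h

lemma not_used_two (hU : lift s 2 U ∈ hatThree s P d₁ d₂) (hd : Out s U d) :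
    ¬ Used s P d₁ d₂ (pos d 2) := not_used hU ((pos_mem_cut_lift hd).2 rfl)

lemma mem_tails_of_lift (hU : lift s p U ∈ hatThree s P d₁ d₂) : U ∈ tails s P 3 :=
  lift_mem_tails_iff.1 hU.1

lemma out_base (hU : lift s 2 U ∈ hatThree s P d₁ d₂) (hd : Out s U d)
    (hT : IsNth (sub s) (hatTwo s P d₁ d₂) n T) (hp : pos d p ∈ cut (sub s) T) :
    Out s (base T) d := by
  have := (h.clean_two hT.mem).under_mem hp
  rw [under_pos] at this
  exact h.out_of_mem_cut hU.1 hU.2.2 hT.mem hd this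

lemma lift_mem_iff (hU : lift s 2 U ∈ hatThree s P d₁ d₂) : lift s p U ∈ hatThree s P d₁ d₂ ↔
    (Sum.inr d₁ ∈ lift s p U ∧ Sum.inr d₂ ∈ lift s p U) ∧
      ∀ d, Out s U d → ¬ Used s P d₁ d₂ (pos d p) := by
  rw [← subset_lift_iff]
  constructor
  · intro h1
    exact ⟨h1.2.2, fun d hd => not_used h1 ((pos_mem_cut_lift hd).2 rfl)⟩
  · rintro ⟨h1, h2⟩
    refine ⟨lift_mem_tails_iff.2 (h.mem_tails_of_lift hU), fun n W hW =>
      Set.disjoint_left.2 fun g hg hgW => ?_, h1⟩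
    obtain ⟨d, hd, rfl⟩ := mem_cut_lift_iff.1 hg
    exact h2 d hd ⟨n, W, hW, hgW⟩

omit h in
variable (s P d₁ d₂) in
/-- The dart `d` leaves the member `T` of the chain at the position `p`, and no member of the
chain is cut at the following position. -/
structure LastAt (d : E × Bool) (p : Fin 3) (m : ℕ) (T : Set (V ⊕ (E × Bool))) : Prop where
  nth : IsNth (sub s) (hatTwo s P d₁ d₂) m T
  out : Out s (base T) d
  mem : pos d p ∈ cut (sub s) T
  ne_two : p ≠ 2
  not_used : ¬ Used s P d₁ d₂ (pos d (p + 1))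

/-- The last position is unused because lift 2 U is free, so some used position is followed by an
unused one. -/
lemma exists_lastAt (hU : lift s 2 U ∈ hatThree s P d₁ d₂) (hd : Out s U d)
    (hu : Used s P d₁ d₂ (pos d q)) : ∃ p m T, LastAt s P d₁ d₂ d p m T := by
  have h2 := h.not_used_two hU hd
  have key : ∃ p : Fin 3, p ≠ 2 ∧ Used s P d₁ d₂ (pos d p) ∧ ¬ Used s P d₁ d₂ (pos d (p + 1)) := by
    by_cases h1 : Used s P d₁ d₂ (pos d 1)
    · exact ⟨1, by decide, h1, h2⟩
    · fin_cases q
      · exact ⟨0, by decide, hu, h1⟩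
      · exact absurd hu h1
      · exact absurd hu h2
  obtain ⟨p, hp2, ⟨m, T, hT, hp⟩, hn⟩ := key
  exact ⟨p, m, T, hT, h.out_base hU hd hT hp, hp, hp2, hn⟩

/-- If the other position could be advanced too, then so would that of d, by `advance`. -/
lemma LastAt.other_level (hl : LastAt s P d₁ d₂ d p m T) (hd' : Out s (base T) d') (hne : d ≠ d')
    (hq : pos d' q ∈ cut (sub s) T) : q = 2 := by
  by_contra hq2
  obtain ⟨T', hT', hb⟩ := h.advance hl.nth hl.out hd' hne hl.mem hq hl.ne_two hq2
  exact hl.not_used ⟨_, T', hT',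
    (h.next_level hl.nth hT' hl.out (by rw [hb]; exact hl.out) hl.mem).2⟩

lemma LastAt.not_full (hl : LastAt s P d₁ d₂ d p m T) : ¬ Full s P d₁ d₂ T := fun hf =>
  hl.not_used (h.used_of_full hl.nth hf hl.out _)

/-- After such a member the chain restarts at position 0 and stays full, while these members are
never full. -/
lemma LastAt.not_lt (hl : LastAt s P d₁ d₂ d p m T) (hl' : LastAt s P d₁ d₂ d' q n T') :
    ¬ m < n := by
  intro hmn
  obtain ⟨A, hA⟩ := hl'.nth.exists_of_le (m := m + 1) hmn
  have h0 := h.reset hl.nth hA hl.out hl.mem hl.ne_two fun h1 => hl.not_used ⟨_, A, hA, h1⟩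
  exact LastAt.not_full h hl' (h.full_of_le hA hl'.nth (full_of_eq_lift_zero hA h0) hmn)

/-- At most one outgoing dart of a free `3`-tail belongs to the chain of `2`-tails. -/
lemma eq_of_used {d d' : E × Bool} (hU : lift s 2 U ∈ hatThree s P d₁ d₂) (hd : Out s U d)
    (hd' : Out s U d') (hu : Used s P d₁ d₂ (pos d p)) (hu' : Used s P d₁ d₂ (pos d' q)) :
    d = d' := by
  obtain ⟨p, m, T, hl⟩ := h.exists_lastAt hU hd hu
  obtain ⟨q, n, T', hl'⟩ := h.exists_lastAt hU hd' hu'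
  obtain rfl : m = n :=
    le_antisymm (not_lt.1 (LastAt.not_lt h hl' hl)) (not_lt.1 (LastAt.not_lt h hl hl'))
  obtain rfl := hl.nth.unique hl'.nth
  by_contra hne
  exact hl'.ne_two (LastAt.other_level h hl hl'.out hne hl'.mem)

lemma exists_level_of_usedIn (hU : lift s 2 U ∈ hatThree s P d₁ d₂) (hX : ChainAt s P d₁ d₂ X r)
    (hd : Out s U d) (hu : UsedIn s P X d.1) : ∃ m T q, IsNth (sub s) (hatTwo s P d₁ d₂) m T ∧
      pos d q ∈ cut (sub s) T ∧ q ≠ 2 ∧ m % 3 = r.val := by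
  obtain ⟨m, T, hT, hdT, hm⟩ := hu.exists_nth hX
  obtain ⟨q, hq, -⟩ := (h.clean_two hT.mem).exists_level
    (h.out_of_mem_cut hU.1 hU.2.2 hT.mem hd hdT)
  exact ⟨m, T, q, hT, hq, fun h2 => h.not_used_two hU hd ⟨m, T, hT, h2 ▸ hq⟩, hm⟩

/-- Only the member of index m cuts the path of d, so only the pair whose residue is m mod 3 sees
this edge. -/
lemma LastAt.usedIn_iff_zero (hl : LastAt s P d₁ d₂ d 0 m T)
    (hU : lift s 2 U ∈ hatThree s P d₁ d₂) (hd : Out s U d) (hX : ChainAt s P d₁ d₂ X r) :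
    UsedIn s P X d.1 ↔ m % 3 = r.val := by
  constructor
  · intro hu
    obtain ⟨m', T', q, hT', hq, hq2, hm⟩ := h.exists_level_of_usedIn hU hX hd hu
    fin_cases q
    · rwa [hl.nth.eq_of_mem_cut hT' hl.mem hq]
    · exact absurd ⟨m', T', hT', hq⟩ hl.not_used
    · exact absurd rfl hq2
  · exact fun hm => hX.usedIn hl.nth hl.out.mem_cut hm

/-- The path is cut at position 1 by the member of index m and at position 0 by its predecessor, if
there is one. -/
lemma LastAt.usedIn_iff_one (hl : LastAt s P d₁ d₂ d 1 m T)
    (hU : lift s 2 U ∈ hatThree s P d₁ d₂) (hd : Out s U d) (hX : ChainAt s P d₁ d₂ X r) :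
    UsedIn s P X d.1 ↔ m % 3 = r.val ∨ (m ≠ 0 ∧ (m - 1) % 3 = r.val) := by
  constructor
  · intro hu
    obtain ⟨m', T', q, hT', hq, hq2, hm⟩ := h.exists_level_of_usedIn hU hX hd hu
    fin_cases q
    · right
      rcases m with - | m
      · exfalso
        have h1 := inner_mem_outer_notMem (h.clean_two hl.nth.mem) hl.out hl.mem
        have h2 := inner_mem_outer_notMem (h.clean_two hT'.mem) (h.out_base hU hd hT' hq) hq
        exact h2.2 (hl.nth.subset hT' (Nat.zero_le _) h1.1)
      · obtain ⟨T₀, hT₀⟩ := hl.nth.exists_of_le (m := m) (by omega)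
        have := h.prev_level hT₀ hl.nth hl.out hl.mem (by decide)
        refine ⟨by omega, ?_⟩
        rw [Nat.add_sub_cancel, hT₀.eq_of_mem_cut hT' this.1 hq]
        exact hm
    · left
      rwa [hl.nth.eq_of_mem_cut hT' hl.mem hq]
    · exact absurd rfl hq2
  · rintro (hm | ⟨hm0, hm⟩)
    · exact hX.usedIn hl.nth hl.out.mem_cut hm
    · obtain ⟨m, rfl⟩ := Nat.exists_eq_succ_of_ne_zero hm0
      obtain ⟨T₀, hT₀⟩ := hl.nth.exists_of_le (m := m) (by omega)
      have := h.prev_level hT₀ hl.nth hl.out hl.mem (by decide)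
      exact hX.usedIn hT₀ this.2.mem_cut (by simpa using hm)

/-- On the chain, a member not contained in a free `3`-tail `Z` has, before the full members,
one outgoing edge inside of `Z` and one outside. -/
lemma exists_inside_outside (hZ : Z ∈ hatThree s P d₁ d₂)
    (hT : IsNth (sub s) (hatTwo s P d₁ d₂) n T) (hf : ¬ Full s P d₁ d₂ T) (hn : ¬ T ⊆ Z) :
    (∃ l p, Out s (base T) l ∧ pos l p ∈ cut (sub s) T ∧ outer s l p ∈ Z) ∧
    ∃ r q, Out s (base T) r ∧ pos r q ∈ cut (sub s) T ∧ outer s r q ∉ Z := by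
  have hcT := h.clean_two hT.mem
  have hni := (h.full_or_not_subset hZ hT).resolve_left hf
  have hU := h.union_mem hZ hT hn
  constructor
  · by_contra! hcon
    -- If no outgoing edge of T ended in Z, the cut of T would survive in the union. Only one of its
    -- two edges can do so.
    have hsub : cut (sub s) T ⊆ cut (sub s) (T ∪ Z) := by
      intro g hg
      obtain ⟨x, hx, hox⟩ := exists_out_of_mem_cut (hcT.under_mem hg)
      obtain ⟨p, rfl⟩ := exists_pos g x hx.symm
      have hin := inner_mem_outer_notMem hcT hox hg
      rw [pos_mem_cut_iff]
      have a : inner s x p ∈ T ∪ Z := Or.inl hin.1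
      have b : outer s x p ∉ T ∪ Z := by
        rintro (h3 | h3)
        exacts [hin.2 h3, hcon x p hox hg h3]
      tauto
    obtain ⟨g, hg⟩ := h.fam.cut_nonempty T hT.mem
    obtain ⟨g', hcut, -, -, hg'⟩ := h.exists_mem_cut_union hZ hT hn hni hg (hsub hg)
    have h1 : cut (sub s) T ⊆ {g} := by
      intro x hx
      have hxU := hsub hx
      rw [hcut] at hxU
      rcases hxU with rfl | rfl
      · rfl
      · exact absurd hx hg'
    have h2 := Set.ncard_le_ncard h1
    rw [hT.mem.1.2.1, Set.ncard_singleton] at h2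
    omega
  -- If all outgoing edges of T ended in Z, the union would only be cut at edges of Z. But the union
  -- is a 2-tail and must share an edge with the chain.
  · by_contra! hcon
    obtain ⟨k, W, hW, g, hgW, hgU⟩ := h.fam.exists_not_disjoint hU
    rcases cut_union_subset _ _ hgU with hg | hg
    · obtain ⟨x, hx, hox⟩ := exists_out_of_mem_cut (hcT.under_mem hg)
      obtain ⟨p, rfl⟩ := exists_pos g x hx.symm
      have hin := inner_mem_outer_notMem hcT hox hg
      rw [pos_mem_cut_iff] at hgU
      exact hgU ⟨fun _ => Or.inr (hcon x p hox hg), fun _ => Or.inl hin.1⟩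
    · exact not_used hZ hg ⟨k, W, hW, hgW⟩

/-- The two outgoing edges of the members of the chain, one inside of the free `3`-tail `Z` and
one outside, advance independently. -/
lemma sides (hZ : Z ∈ hatThree s P d₁ d₂) {T₀ : Set (V ⊕ (E × Bool))}
    (hT₀ : IsNth (sub s) (hatTwo s P d₁ d₂) 0 T₀) (hn : ¬ T₀ ⊆ Z) {l₀ r₀ : E × Bool}
    (hl₀ : Out s (base T₀) l₀) (hr₀ : Out s (base T₀) r₀) (hne : l₀ ≠ r₀)
    (hlp : pos l₀ c ∈ cut (sub s) T₀) (hrp : pos r₀ 0 ∈ cut (sub s) T₀)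
    (hlZ : outer s l₀ c ∈ Z) (n : ℕ) {T : Set (V ⊕ (E × Bool))}
    (hT : IsNth (sub s) (hatTwo s P d₁ d₂) n T) (hf : ¬ Full s P d₁ d₂ T) :
    ∃ l r p q, Out s (base T) l ∧ Out s (base T) r ∧ pos l p ∈ cut (sub s) T ∧
      pos r q ∈ cut (sub s) T ∧ outer s l p ∈ Z ∧ outer s r q ∉ Z ∧
      q.val = n % 3 ∧ p.val = (n + c.val) % 3 := by
  induction n generalizing T with
  | zero =>
    obtain rfl := hT.unique hT₀
    obtain ⟨-, r, q, hr, hq, hqZ⟩ := h.exists_inside_outside hZ hT hf hn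
    have hc := h.clean_two hT.mem
    rcases h.eq_or_eq hT.mem hl₀ hr₀ hne hr with rfl | rfl
    · obtain rfl := hc.eq_of_pos hq hlp
      exact absurd hlZ hqZ
    · obtain rfl := hc.eq_of_pos hq hrp
      exact ⟨l₀, r, c, 0, hl₀, hr, hlp, hrp, hlZ, hqZ, rfl, by
        rw [Nat.zero_add, Nat.mod_eq_of_lt c.isLt]⟩
  | succ n ih =>
    obtain ⟨T₁, hT₁⟩ := hT.exists_of_le (m := n) (by omega)
    obtain ⟨l, r, p, q, hl, hr, hp, hq, hpZ, hqZ, en, em⟩ := ih hT₁ fun h1 =>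
      hf (h.full_succ hT₁ hT h1)
    have hlr : l ≠ r := by
      rintro rfl
      obtain rfl := (h.clean_two hT₁.mem).eq_of_pos hp hq
      exact hqZ hpZ
    have hc := h.clean_two hT.mem
    have hpre := hT₁.precedes_succ hT
    have hnT : ¬ T ⊆ Z := fun h1 => hqZ ((outer_mem_iff_inner_mem hZ ⟨_, _, hT₁, hq⟩).1
      (h1 (hpre.subset (inner_mem_outer_notMem (h.clean_two hT₁.mem) hr hq).1)))
    obtain ⟨⟨l', p', hl', hp', hpZ'⟩, r', q', hr', hq', hqZ'⟩ :=
      h.exists_inside_outside hZ hT hf hnT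
    have hlr' : l' ≠ r' := by
      rintro rfl
      obtain rfl := hc.eq_of_pos hp' hq'
      exact hqZ' hpZ'
    have back : ∀ x t, Out s (base T) x → pos x t ∈ cut (sub s) T → t ≠ 0 →
        pos x (t - 1) ∈ cut (sub s) T₁ ∧ Out s (base T₁) x ∧
          (outer s x (t - 1) ∈ Z ↔ outer s x t ∈ Z) := by
      intro x t hx ht ht0
      have := h.prev_level hT₁ hT hx ht ht0
      refine ⟨this.1, this.2, ?_⟩
      rw [← outer_mem_iff_inner_mem hZ ⟨_, _, hT, ht⟩, ← inner_succ (sub_one_ne_two ht0),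
        sub_add_cancel]
    have fwd : ∀ x t, Out s (base T) x → Out s (base T₁) x → pos x t ∈ cut (sub s) T₁ →
        pos x (t + 1) ∈ cut (sub s) T ∧ (outer s x (t + 1) ∈ Z ↔ outer s x t ∈ Z) := by
      intro x t hx hx₁ ht
      have := h.next_level hT₁ hT hx₁ hx ht
      refine ⟨this.2, ?_⟩
      rw [← outer_mem_iff_inner_mem hZ ⟨_, _, hT, this.2⟩, ← inner_succ this.1]
    have bl : p' ≠ 0 → p' = p + 1 := by
      intro h0
      obtain ⟨h1, h2, h3⟩ := back l' p' hl' hp' h0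
      rcases h.eq_or_eq hT₁.mem hl hr hlr h2 with rfl | rfl
      · rw [← (h.clean_two hT₁.mem).eq_of_pos h1 hp, sub_add_cancel]
      · obtain rfl := (h.clean_two hT₁.mem).eq_of_pos h1 hq
        exact absurd (h3.2 hpZ') hqZ
    have br : q' ≠ 0 → q' = q + 1 := by
      intro h0
      obtain ⟨h1, h2, h3⟩ := back r' q' hr' hq' h0
      rcases h.eq_or_eq hT₁.mem hl hr hlr h2 with rfl | rfl
      · obtain rfl := (h.clean_two hT₁.mem).eq_of_pos h1 hp
        exact absurd (h3.1 hpZ) hqZ'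
      · rw [← (h.clean_two hT₁.mem).eq_of_pos h1 hq, sub_add_cancel]
    have some_ne : p' ≠ 0 ∨ q' ≠ 0 := by
      by_contra! h0
      obtain ⟨rfl, rfl⟩ := h0
      refine hf (full_of_eq_lift_zero hT (eq_lift_of_level hc fun x hx => ?_))
      rcases h.eq_or_eq hT.mem hl' hr' hlr' hx with rfl | rfl <;> assumption
    have both : p ≠ 2 → q ≠ 2 → p' = p + 1 ∧ q' = q + 1 := by
      intro hp2 hq2
      obtain ⟨T'', hT'', hb⟩ := h.advance hT₁ hl hr hlr hp hq hp2 hq2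
      obtain rfl := hT.unique hT''
      rw [← hb] at hl hr
      have f1 := fwd l p hl (by rwa [← hb]) hp
      have f2 := fwd r q hr (by rwa [← hb]) hq
      constructor
      · rcases h.eq_or_eq hT.mem hl' hr' hlr' hl with rfl | rfl
        · exact hc.eq_of_pos hp' f1.1
        · obtain rfl := hc.eq_of_pos hq' f1.1
          exact absurd (f1.2.2 hpZ) hqZ'
      · rcases h.eq_or_eq hT.mem hl' hr' hlr' hr with rfl | rfl
        · obtain rfl := hc.eq_of_pos hp' f2.1
          exact absurd (f2.2.1 hpZ') hqZ
        · exact hc.eq_of_pos hq' f2.1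
    have hval : ∀ x y : Fin 3, x = y + 1 → x.val = (y.val + 1) % 3 := by decide
    -- Addition in `Fin 3` wraps from 2 to 0: a position at the end of its path is followed by
    -- position 0 on a new path.
    have key : p' = p + 1 ∧ q' = q + 1 := by
      clear * - bl br some_ne both
      revert p q p' q'
      decide
    refine ⟨l', r', p', q', hl', hr', hp', hq', hpZ', hqZ', ?_, ?_⟩
    · rw [hval _ _ key.2]; omega
    · rw [hval _ _ key.1]; omega

end Setup

end ThreeTails

end DualGraph

/-! ### Counting the pairs and the positions for which a 3-tail is free. -/

namespace DualGraph

section ThreeTailsCount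

variable {V E : Type*} {s : E × Bool → V} {P : V} {S U : Set V} {T T' Z : Set (V ⊕ (E × Bool))}
  {d d' d₁ d₂ x : E × Bool} {p q : Fin 3} {n m : ℕ} {X : Set V} {r a b c : Fin 3} {e : E}

variable (s P d₁ d₂) in
/-- The number of pairs for which `U` is a free `3`-tail equals the number of positions at which
`U` lifts to a free `3`-tail. -/
def Counts (U : Set V) : Prop :=
  (U ∈ threeTails s P {s d₁, s d₂} ∨ U ∈ threeTails s P {s d₁, s (rev d₂)} ∨
    U ∈ threeTails s P {s (rev d₁), s d₂}) ∧
  (lift s 1 U ∈ hatThree s P d₁ d₂ ↔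
    (U ∈ threeTails s P {s d₁, s d₂} ∧ U ∈ threeTails s P {s d₁, s (rev d₂)}) ∨
    (U ∈ threeTails s P {s d₁, s d₂} ∧ U ∈ threeTails s P {s (rev d₁), s d₂}) ∨
    (U ∈ threeTails s P {s d₁, s (rev d₂)} ∧ U ∈ threeTails s P {s (rev d₁), s d₂})) ∧
  (lift s 0 U ∈ hatThree s P d₁ d₂ ↔
    U ∈ threeTails s P {s d₁, s d₂} ∧ U ∈ threeTails s P {s d₁, s (rev d₂)} ∧
    U ∈ threeTails s P {s (rev d₁), s d₂})

lemma hatTwo_comm : hatTwo s P d₁ d₂ = hatTwo s P d₂ d₁ := by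
  rw [hatTwo, hatTwo, Set.pair_comm]

lemma hatThree_comm : hatThree s P d₁ d₂ = hatThree s P d₂ d₁ := by
  rw [hatThree, hatThree, Set.pair_comm]

lemma Counts.symm (h : Counts s P d₁ d₂ U) : Counts s P d₂ d₁ U := by
  unfold Counts at h ⊢
  rw [Set.pair_comm (s d₂) (s d₁), Set.pair_comm (s d₂) (s (rev d₁)),
    Set.pair_comm (s (rev d₂)) (s d₁), hatThree_comm]
  tauto

lemma ChainAt.symm (h : ChainAt s P d₁ d₂ X r) : ChainAt s P d₂ d₁ X r := by
  unfold ChainAt at h ⊢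
  rwa [hatTwo_comm]

namespace SyncSetup

variable [Finite V] [Finite E] (h : SyncSetup s P d₁ d₂ a b c)
include h

/-- Exchanging d₁ and d₂ fixes the first pair and exchanges the other two, which halves the case
analysis below. -/
lemma symm : SyncSetup s P d₂ d₁ a c b where
  toSetup := h.toSetup.symm
  ne_ab := h.ne_ac
  ne_ac := h.ne_ab
  ne_bc := h.ne_bc.symm
  chain_a := by rw [Set.pair_comm]; exact h.chain_a.symm
  chain_b := by rw [Set.pair_comm]; exact h.chain_c.symm
  chain_c := by rw [Set.pair_comm]; exact h.chain_b.symm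
  quasi := by rw [Set.pair_comm, and_comm]; exact h.quasi
  quasi_rev := by rw [Set.pair_comm, and_comm]; exact h.quasi_rev

/-- The residues, as natural numbers. -/
lemma residues : a.val < 3 ∧ b.val < 3 ∧ c.val < 3 ∧ a.val ≠ b.val ∧ a.val ≠ c.val ∧
    b.val ≠ c.val :=
  ⟨a.isLt, b.isLt, c.isLt, fun e => h.ne_ab (Fin.ext e), fun e => h.ne_ac (Fin.ext e),
    fun e => h.ne_bc (Fin.ext e)⟩

lemma mem_base_a (hT : IsNth (sub s) (hatTwo s P d₁ d₂) a.val T) :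
    s d₁ ∈ base T ∧ s d₂ ∈ base T :=
  ⟨h.chain_a.subset_base hT (by simp), h.chain_a.subset_base hT (by simp)⟩

lemma mem_base_b (hT : IsNth (sub s) (hatTwo s P d₁ d₂) b.val T) :
    s d₁ ∈ base T ∧ s (rev d₂) ∈ base T :=
  ⟨h.chain_b.subset_base hT (by simp), h.chain_b.subset_base hT (by simp)⟩

lemma mem_base_c (hT : IsNth (sub s) (hatTwo s P d₁ d₂) c.val T) :
    s (rev d₁) ∈ base T ∧ s d₂ ∈ base T :=
  ⟨h.chain_c.subset_base hT (by simp), h.chain_c.subset_base hT (by simp)⟩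

/-- A free `3`-tail of one of the three pairs lifts to a free `3`-tail. -/
lemma lift_two_mem_of_mem (hX : ChainAt s P d₁ d₂ X r)
    (hXr : (X = {s d₁, s d₂} ∧ r = a) ∨ (X = {s d₁, s (rev d₂)} ∧ r = b) ∨
      (X = {s (rev d₁), s d₂} ∧ r = c)) (hU : U ∈ threeTails s P X) :
    lift s 2 U ∈ hatThree s P d₁ d₂ := by
  obtain ⟨hU2, hU3⟩ := (mem_threeTails_iff hU.1).1 hU
  have hsrc : ({Sum.inr d₁, Sum.inr d₂} : Set (V ⊕ (E × Bool))) ⊆ lift s 2 U := by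
    rw [subset_lift_iff]
    rcases hXr with ⟨rfl, -⟩ | ⟨rfl, -⟩ | ⟨rfl, -⟩ <;>
    · rw [Set.insert_subset_iff, Set.singleton_subset_iff] at hU2
      simp only [inr_mem_lift_two]
      tauto
  have htails : lift s 2 U ∈ tails (sub s) (Sum.inl P) 3 := lift_mem_tails_iff.2 hU.1
  refine ⟨htails, fun m T hT => Set.disjoint_left.2 fun g hg hgT => ?_, hsrc⟩
  obtain ⟨d, hd, rfl⟩ := mem_cut_lift_iff.1 hg
  have hu := (h.clean_two hT.mem).under_mem hgT
  rw [under_pos] at hu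
  have hdT := h.out_of_mem_cut htails hsrc hT.mem hd hu
  have hno := hU3 d hd
  obtain ⟨ha, hb, hc, hab, hac, hbc⟩ := h.residues
  -- The last edge of the path is cut at index m, and going back the earlier edges are cut at the
  -- preceding indices. None of these indices may have the residue r of the pair X.
  have hm : m % 3 ≠ r.val := fun hm => hno (hX.usedIn hT hdT.mem_cut hm)
  rcases m with - | m
  · rcases (h.first_level hT hdT hgT).2 rfl with h1 | h1
    · have hdr : s (rev d₁) = s d := by rw [← h1, rev_rev]
      have hn : s d₁ ∉ base T := by rw [← h1]; exact hdT.2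
      have hnU : s d₁ ∉ U := by rw [← h1]; exact hd.2
      rcases hXr with ⟨rfl, rfl⟩ | ⟨rfl, rfl⟩ | ⟨rfl, rfl⟩
      · exact hnU (hU2 (by simp))
      · exact hnU (hU2 (by simp))
      · have : a.val = 0 ∨ b.val = 0 := by omega
        rcases this with h0 | h0
        · exact hn (h.mem_base_a (h0 ▸ hT)).1
        · exact hn (h.mem_base_b (h0 ▸ hT)).1
    · have hn : s d₂ ∉ base T := by rw [← h1]; exact hdT.2
      have hnU : s d₂ ∉ U := by rw [← h1]; exact hd.2
      rcases hXr with ⟨rfl, rfl⟩ | ⟨rfl, rfl⟩ | ⟨rfl, rfl⟩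
      · exact hnU (hU2 (by simp))
      · have : a.val = 0 ∨ c.val = 0 := by omega
        rcases this with h0 | h0
        · exact hn (h.mem_base_a (h0 ▸ hT)).2
        · exact hn (h.mem_base_c (h0 ▸ hT)).2
      · exact hnU (hU2 (by simp))
  obtain ⟨T₁, hT₁⟩ := hT.exists_of_le (m := m) (by omega)
  obtain ⟨h1, h1'⟩ := h.prev_level hT₁ hT hdT hgT (by decide)
  have hm1 : m % 3 ≠ r.val := fun hm => hno (hX.usedIn hT₁ h1'.mem_cut hm)
  rcases m with - | m
  · rcases (h.first_level hT₁ h1' h1).1 rfl with rfl | rfl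
    -- The first two members do not contain the target of d₁, so the chain of the pair containing
    -- this target starts at neither. If it starts third, then r has to be its residue.
    · have : c.val = 0 ∨ c.val = 1 ∨ r = c := by
        by_cases hrc : r = c
        · exact Or.inr (Or.inr hrc)
        · have : r.val ≠ c.val := fun e => hrc (Fin.ext e)
          have := r.isLt
          omega
      rcases this with h0 | h0 | h0
      · exact h1'.2 (h.mem_base_c (h0 ▸ hT₁)).1
      · exact hdT.2 (h.mem_base_c (h0 ▸ hT)).1
      · have hX' : X = {s (rev d), s d₂} := by
          rcases hXr with h2 | h2 | h2
          · exact absurd (h2.2.symm.trans h0) h.ne_ac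
          · exact absurd (h2.2.symm.trans h0) h.ne_bc
          · exact h2.1
        exact hd.2 (hU2 (by simp [hX']))
    · have : b.val = 0 ∨ b.val = 1 ∨ r = b := by
        by_cases hrc : r = b
        · exact Or.inr (Or.inr hrc)
        · have : r.val ≠ b.val := fun e => hrc (Fin.ext e)
          have := r.isLt
          omega
      rcases this with h0 | h0 | h0
      · exact h1'.2 (h.mem_base_b (h0 ▸ hT₁)).2
      · exact hdT.2 (h.mem_base_b (h0 ▸ hT)).2
      · have hX' : X = {s d₁, s (rev d)} := by
          rcases hXr with h2 | h2 | h2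
          · exact absurd (h2.2.symm.trans h0) h.ne_ab
          · exact h2.1
          · exact absurd (h2.2.symm.trans h0) h.ne_bc.symm
        exact hd.2 (hU2 (by simp [hX']))
  obtain ⟨T₂, hT₂⟩ := hT₁.exists_of_le (m := m) (by omega)
  obtain ⟨h2, h2'⟩ := h.prev_level hT₂ hT₁ h1' h1 (by decide)
  -- Three consecutive indices cannot all avoid the residue r.
  have hm2 : m % 3 ≠ r.val := fun hm => hno (hX.usedIn hT₂ h2'.mem_cut hm)
  have := r.isLt
  omega

/-- If a dart d leaving U' is seen by the chain of X, its source is not in U, as U is free. The path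
of d then lies outside lift 2 U, so it is used throughout, against the freeness of lift 2 U'. -/
lemma mem_of_subset (hX : ChainAt s P d₁ d₂ X r)
    (hXr : (X = {s d₁, s d₂} ∧ r = a) ∨ (X = {s d₁, s (rev d₂)} ∧ r = b) ∨
      (X = {s (rev d₁), s d₂} ∧ r = c)) (hU : U ∈ threeTails s P X) {U' : Set V} (hUU' : U ⊆ U')
    (hU' : lift s 2 U' ∈ hatThree s P d₁ d₂) : U' ∈ threeTails s P X := by
  rw [mem_threeTails_iff (h.mem_tails_of_lift hU')]
  have hU2 := (mem_threeTails_iff hU.1).1 hU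
  refine ⟨hU2.1.trans hUU', fun d hd hu => ?_⟩
  obtain ⟨m, T, hT, hdT, -⟩ := hu.exists_nth hX
  have hoT := h.out_of_mem_cut hU'.1 hU'.2.2 hT.mem hd hdT
  obtain ⟨p, hp, -⟩ := (h.clean_two hT.mem).exists_level hoT
  have hn : s (rev d) ∉ U := fun h1 => hd.2 (hUU' h1)
  have hn' : s d ∉ U := fun h1 => hU2.2 d ⟨h1, hn⟩ hu
  have hin : inner s d p ∉ lift s 2 U := by
    fin_cases p <;> simp [inner, hn, hn']
  exact h.not_used_two hU' hd
    ((h.used_of_notMem (h.lift_two_mem_of_mem hX hXr hU) hT hoT hp hin).2.2 2)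

/-- The first member of the chain of the subdivided graph also gives the chain of any set of
vertices `X` such that the `2`-tails of `X` lift to the subdivided graph. -/
lemma isLeast_base (hT : IsNth (sub s) (hatTwo s P d₁ d₂) 0 T) (hX : X ⊆ base T)
    (hX' : ∀ Z : Set V, X ⊆ Z → Sum.inr d₁ ∈ lift s 2 Z ∧ Sum.inr d₂ ∈ lift s 2 Z) :
    IsLeast (twoTails s P X) (base T) := by
  refine ⟨⟨h.base_two hT.mem, hX⟩, fun Z hZ => ?_⟩
  have hm : lift s 2 Z ∈ hatTwo s P d₁ d₂ :=
    ⟨lift_mem_tails_iff.2 hZ.1, subset_lift_iff 2 |>.2 (hX' Z hZ.2)⟩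
  exact fun v hv => (show IsLeast _ T from hT).2 hm hv

omit h [Finite V] [Finite E] in
lemma sources_of_subset {y₁ y₂ : E × Bool} (h1 : y₁.1 = d₁.1) (h2 : y₂.1 = d₂.1) (Z : Set V)
    (hZ : {s y₁, s y₂} ⊆ Z) : Sum.inr d₁ ∈ lift s 2 Z ∧ Sum.inr d₂ ∈ lift s 2 Z := by
  rw [Set.insert_subset_iff, Set.singleton_subset_iff] at hZ
  simp only [inr_mem_lift_two]
  rcases eq_or_eq_rev_of_fst h1 with rfl | rfl <;>
    rcases eq_or_eq_rev_of_fst h2 with rfl | rfl <;> tauto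

omit h [Finite V] [Finite E] in
lemma usedIn_congr {X' : Set V} (hW : IsLeast (twoTails s P X) S)
    (hW' : IsLeast (twoTails s P X') S) : UsedIn s P X e ↔ UsedIn s P X' e := by
  unfold UsedIn
  simp only [isNth_twoTails_congr (X := X) (X' := X') fun W =>
    ⟨fun h1 => hW.unique h1 ▸ hW', fun h1 => hW'.unique h1 ▸ hW⟩]

/-- The case in which no outgoing edge of `U` belongs to the chain of `2`-tails. -/
lemma counts_of_not_used (hU : lift s 2 U ∈ hatThree s P d₁ d₂)
    (hno : ∀ d q, Out s U d → ¬ Used s P d₁ d₂ (pos d q)) : Counts s P d₁ d₂ U := by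
  have hUt := h.mem_tails_of_lift hU
  have notcut : ∀ d, Out s U d → ∀ m T, IsNth (sub s) (hatTwo s P d₁ d₂) m T →
      d.1 ∉ cut s (base T) := by
    intro d hd m T hT hc
    obtain ⟨g, hg, hgd⟩ := exists_mem_cut_of_mem_cut_base hc
    obtain ⟨q, rfl⟩ := exists_pos g d hgd
    exact hno d q hd ⟨m, T, hT, hg⟩
  have notIn : ∀ {X r}, ChainAt s P d₁ d₂ X r → ∀ d, Out s U d → ¬ UsedIn s P X d.1 := by
    intro X r hX d hd hu
    obtain ⟨m, T, hT, hc, -⟩ := hu.exists_nth hX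
    exact notcut d hd m T hT hc
  have mem : ∀ {y z r}, ChainAt s P d₁ d₂ {s y, s z} r →
      (U ∈ threeTails s P {s y, s z} ↔ s y ∈ U ∧ s z ∈ U) := by
    intro y z r hX
    rw [mem_threeTails_iff hUt, Set.insert_subset_iff, Set.singleton_subset_iff]
    exact and_iff_left (notIn hX)
  have lifts : ∀ p, lift s p U ∈ hatThree s P d₁ d₂ ↔
      Sum.inr d₁ ∈ lift s p U ∧ Sum.inr d₂ ∈ lift s p U := fun p =>
    (h.lift_mem_iff hU).trans (and_iff_left fun d hd => hno d p hd)
  -- Freeness is automatic here, so only the four ends matter, as for 2-tails, and quasistability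
  -- excludes the two bad configurations.
  have clash : ¬ (Out s U d₁ ∧ Out s U d₂) := by
    rintro ⟨h1, h2⟩
    have hm := (mem h.chain_a).2 ⟨h1.1, h2.1⟩
    exact h.quasi ⟨isTerminal_of_mem_threeTails h.conn hm h1 (by simp),
      isTerminal_of_mem_threeTails h.conn hm h2 (by simp)⟩
  -- The pair of targets has no chain among the three. But the first member of the chain cuts
  -- neither d₁ nor d₂ and so contains all four ends. It therefore starts both the chain of the
  -- targets and that of the sources, and the two chains coincide.
  have clash' : ¬ (Out s U (rev d₁) ∧ Out s U (rev d₂)) := by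
    rintro ⟨h1, h2⟩
    have hm : U ∈ threeTails s P {s (rev d₁), s (rev d₂)} := by
      rw [mem_threeTails_iff hUt]
      refine ⟨Set.insert_subset_iff.2 ⟨h1.1, by simpa using h2.1⟩, fun d hd hu => ?_⟩
      obtain ⟨n, W, hW, -⟩ := id hu
      have hm : lift s 2 W ∈ hatTwo s P d₁ d₂ := ⟨lift_mem_tails_iff.2 hW.mem.1,
        (subset_lift_iff 2).2 (sources_of_subset (y₁ := rev d₁) (y₂ := rev d₂) (d₁ := d₁)
          (d₂ := d₂) rfl rfl W hW.mem.2)⟩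
      obtain ⟨T, hT, -⟩ := h.fam.exists_zero hm
      have c1 := notcut _ h1 0 T hT
      have c2 := notcut _ h2 0 T hT
      have m1 : Sum.inr d₁ ∈ T := hT.mem.2 (by simp)
      have m2 : Sum.inr d₂ ∈ T := hT.mem.2 (by simp)
      have m1 := (h.clean_two hT.mem).subset_lift_two m1
      have m2 := (h.clean_two hT.mem).subset_lift_two m2
      rw [mem_cut_iff, rev_rev, not_not] at c1 c2
      rw [inr_mem_lift_two] at m1 m2
      have l1 := h.isLeast_base hT (X := {s (rev d₁), s (rev d₂)})
        (by rw [Set.insert_subset_iff, Set.singleton_subset_iff]; tauto)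
        (sources_of_subset (y₁ := rev d₁) (y₂ := rev d₂) rfl rfl)
      have l2 := h.isLeast_base hT (X := {s d₁, s d₂})
        (by rw [Set.insert_subset_iff, Set.singleton_subset_iff]; tauto)
        (sources_of_subset rfl rfl)
      exact notIn h.chain_a d hd ((usedIn_congr l1 l2).1 hu)
    exact h.quasi_rev ⟨isTerminal_of_mem_threeTails h.conn hm (d := rev d₁) h1 (by simp),
      isTerminal_of_mem_threeTails h.conn hm (d := rev d₂) h2 (by simp)⟩
  have h2 := (lifts 2).1 hU
  simp only [inr_mem_lift_two] at h2
  simp only [Out, rev_rev] at clash clash'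
  unfold Counts
  rw [mem h.chain_a, mem h.chain_b, mem h.chain_c, lifts, lifts, inr_mem_lift_one,
    inr_mem_lift_one, inr_mem_lift_zero, inr_mem_lift_zero]
  tauto

/-- By `eq_of_used` only the dart d has to be tested for freeness. -/
lemma mem_iff_of_used (hU : lift s 2 U ∈ hatThree s P d₁ d₂) (hd : Out s U d)
    (hu : Used s P d₁ d₂ (pos d q)) {y z : E × Bool} (hX : ChainAt s P d₁ d₂ {s y, s z} r) :
    U ∈ threeTails s P {s y, s z} ↔ (s y ∈ U ∧ s z ∈ U) ∧ ¬ UsedIn s P {s y, s z} d.1 := by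
  rw [mem_threeTails_iff (h.mem_tails_of_lift hU), Set.insert_subset_iff, Set.singleton_subset_iff]
  refine and_congr_right fun _ => ⟨fun h1 => h1 d hd, fun h1 d' hd' hu' => ?_⟩
  obtain ⟨m, T, q, hT, hq, -, -⟩ := h.exists_level_of_usedIn hU hX hd' hu'
  exact h1 (h.eq_of_used hU hd hd' hu ⟨m, T, hT, hq⟩ ▸ hu')

lemma lift_mem_iff_of_used (hU : lift s 2 U ∈ hatThree s P d₁ d₂) (hd : Out s U d)
    (hu : Used s P d₁ d₂ (pos d q)) : lift s p U ∈ hatThree s P d₁ d₂ ↔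
      (Sum.inr d₁ ∈ lift s p U ∧ Sum.inr d₂ ∈ lift s p U) ∧ ¬ Used s P d₁ d₂ (pos d p) := by
  rw [h.lift_mem_iff hU]
  refine and_congr_right fun _ => ⟨fun h1 => h1 d hd, fun h1 d' hd' hu' => ?_⟩
  exact h1 (h.eq_of_used hU hd hd' hu hu' ▸ hu')

/-- The case in which the first member of the chain is cut beyond the vertex `d₁`, and `d₁` leaves
the `3`-tail. -/
lemma counts_of_first (hU : lift s 2 U ∈ hatThree s P d₁ d₂)
    (hT : IsNth (sub s) (hatTwo s P d₁ d₂) 0 T) (hd : Out s U d₁)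
    (hp : pos d₁ 1 ∈ cut (sub s) T) : Counts s P d₁ d₂ U := by
  have hdT := h.out_base hU hd hT hp
  have hu : Used s P d₁ d₂ (pos d₁ 1) := ⟨0, T, hT, hp⟩
  have hl : Setup.LastAt s P d₁ d₂ d₁ 1 0 T := ⟨hT, hdT, hp, by decide, h.not_used_two hU hd⟩
  obtain ⟨y, hy, hyT⟩ := h.exists_other hT.mem hdT
  obtain ⟨q, hq, -⟩ := (h.clean_two hT.mem).exists_level hyT
  obtain rfl := Setup.LastAt.other_level h.toSetup hl hyT hy.symm hq
  have hy2 : rev y = d₂ := by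
    refine ((h.first_level hT hyT hq).2 rfl).resolve_left fun h1 => ?_
    exact hdT.2 (h1 ▸ by rw [rev_rev]; exact hyT.1)
  obtain rfl : y = rev d₂ := by rw [← hy2, rev_rev]
  have hn2 : s d₂ ∉ base T := by simpa using hyT.2
  have hne2 : ∀ y : E × Bool, y.1 = d₂.1 → d₁ ≠ y := fun y hy e => h.ne (e ▸ hy)
  have e2 : s d₂ ∈ U ∧ s (rev d₂) ∈ U := by
    have a1 : ¬ Out s U d₂ := fun h1 => h.no_cross hU.1 hU.2.2 hT.mem h1 hyT
    have a2 : ¬ Out s U (rev d₂) := fun h1 =>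
      hne2 (rev d₂) rfl (h.eq_of_used hU hd h1 hu ⟨0, T, hT, hq⟩)
    have a3 : Sum.inr d₂ ∈ lift s 2 U := hU.2.2 (by simp)
    rw [inr_mem_lift_two] at a3
    simp only [Out, rev_rev] at a1 a2
    tauto
  obtain ⟨ha, hb, hc, hab, hac, hbc⟩ := h.residues
  have a0 : a.val ≠ 0 := fun h0 => hn2 (h.mem_base_a (h0 ▸ hT)).2
  have c0 : c.val ≠ 0 := fun h0 => hn2 (h.mem_base_c (h0 ▸ hT)).2
  have ua := Setup.LastAt.usedIn_iff_one h.toSetup hl hU hd h.chain_a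
  have ub := Setup.LastAt.usedIn_iff_one h.toSetup hl hU hd h.chain_b
  have ma := h.mem_iff_of_used hU hd hu h.chain_a
  have mb := h.mem_iff_of_used hU hd hu h.chain_b
  have mc := h.mem_iff_of_used hU hd hu h.chain_c
  have l0 := h.lift_mem_iff_of_used hU hd hu (p := 0)
  have l1 := h.lift_mem_iff_of_used hU hd hu (p := 1)
  -- The first member misses the source of d₂, so it belongs to the chain of the second pair. Only
  -- the first pair remains for U, matching the single lift at position 2.
  have : b.val = 0 := by omega
  rw [inr_mem_lift_zero] at l0
  simp only [ne_eq, not_true_eq_false, false_and, or_false] at ua ub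
  have hA := ma.2 ⟨⟨hd.1, e2.1⟩, fun h1 => a0 (ua.1 h1).symm⟩
  have hB : ¬ _ := fun h1 => (mb.1 h1).2 (ub.2 this.symm)
  have hC : ¬ _ := fun h1 => hd.2 (mc.1 h1).1.1
  have h0 : ¬ _ := fun h1 => hd.2 (l0.1 h1).1.1.2
  have h1 : ¬ _ := fun h1 => (l1.1 h1).2 hu
  simp only [Counts, hA, hB, hC, h0, h1, and_false, or_false, and_self, or_self]

/-- The case in which all ends of the edges of `d₁` and `d₂` belong to the `3`-tail. -/
lemma counts_of_ends (hU : lift s 2 U ∈ hatThree s P d₁ d₂) (hd : Out s U d)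
    (hl : Setup.LastAt s P d₁ d₂ d p m T) (h1 : s d₁ ∈ U) (h1' : s (rev d₁) ∈ U)
    (h2 : s d₂ ∈ U) (h2' : s (rev d₂) ∈ U) : Counts s P d₁ d₂ U := by
  have hu : Used s P d₁ d₂ (pos d p) := ⟨m, T, hl.nth, hl.mem⟩
  have ma := h.mem_iff_of_used hU hd hu h.chain_a
  have mb := h.mem_iff_of_used hU hd hu h.chain_b
  have mc := h.mem_iff_of_used hU hd hu h.chain_c
  have l0 := h.lift_mem_iff_of_used hU hd hu (p := 0)
  have l1 := h.lift_mem_iff_of_used hU hd hu (p := 1)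
  rw [inr_mem_lift_zero, inr_mem_lift_zero] at l0
  rw [inr_mem_lift_one, inr_mem_lift_one] at l1
  obtain ⟨ha, hb, hc, hab, hac, hbc⟩ := h.residues
  fin_cases p
  · have n1 : ¬ Used s P d₁ d₂ (pos d 1) := hl.not_used
    have ua := Setup.LastAt.usedIn_iff_zero h.toSetup hl hU hd h.chain_a
    have ub := Setup.LastAt.usedIn_iff_zero h.toSetup hl hU hd h.chain_b
    have uc := Setup.LastAt.usedIn_iff_zero h.toSetup hl hU hd h.chain_c
    unfold Counts
    simp only [ma, mb, mc, l0, l1, ua, ub, uc, h1, h1', h2, h2', n1, true_and, and_true,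
      not_false_eq_true, true_iff]
    simp only [Fin.zero_eta] at hu
    simp only [hu, not_true_eq_false, false_iff]
    omega
  -- Position 1 at index 0 would make d one of d₁, d₂, whose ends all lie in U. So positions 0 and 1
  -- are used by consecutive members and two distinct pairs are spoiled.
  · have hm0 : m ≠ 0 := by
      rintro rfl
      rcases (h.first_level hl.nth hl.out hl.mem).1 rfl with rfl | rfl
      · exact hd.2 h1'
      · exact hd.2 h2'
    obtain ⟨k, rfl⟩ := Nat.exists_eq_succ_of_ne_zero hm0
    obtain ⟨T₀, hT₀⟩ := hl.nth.exists_of_le (m := k) (by omega)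
    have hu0 : Used s P d₁ d₂ (pos d 0) :=
      ⟨k, T₀, hT₀, (h.prev_level hT₀ hl.nth hl.out hl.mem (by decide)).1⟩
    have ua := Setup.LastAt.usedIn_iff_one h.toSetup hl hU hd h.chain_a
    have ub := Setup.LastAt.usedIn_iff_one h.toSetup hl hU hd h.chain_b
    have uc := Setup.LastAt.usedIn_iff_one h.toSetup hl hU hd h.chain_c
    have hu1 : Used s P d₁ d₂ (pos d 1) := hu
    unfold Counts
    simp only [ma, mb, mc, l0, l1, ua, ub, uc, h1, h1', h2, h2', hu0, hu1, true_and, and_true,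
      not_true_eq_false, and_false, false_iff, Nat.succ_ne_zero, ne_eq, not_false_eq_true,
      Nat.succ_eq_add_one, Nat.add_sub_cancel]
    omega
  · exact absurd rfl hl.ne_two

/-- The case in which the edge of `d₂` leaves the `3`-tail, but does not belong to the chain
of `2`-tails, and the first member of the chain is cut at the edge of `d₁`. -/
lemma counts_of_mem_cut (hU : lift s 2 U ∈ hatThree s P d₁ d₂) (hd : Out s U d)
    (hl : Setup.LastAt s P d₁ d₂ d p m T) {T₀ : Set (V ⊕ (E × Bool))}
    (hT₀ : IsNth (sub s) (hatTwo s P d₁ d₂) 0 T₀) (hx : Out s (base T₀) x)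
    (hr : pos x r ∈ cut (sub s) T₀) (hxr : (x = d₁ ∧ r = 1) ∨ (rev x = d₁ ∧ r = 2))
    (h1 : s d₁ ∈ U) (h1' : s (rev d₁) ∈ U) (h2 : d₂.1 ∈ cut s U)
    (hno : ¬ (Out s U d₂ ∧ pos d₂ 1 ∈ cut (sub s) T₀)) : Counts s P d₁ d₂ U := by
  have hxd : x.1 = d₁.1 := by
    rcases hxr with h3 | h3
    · rw [h3.1]
    · rw [← h3.1, rev_fst]
  have hu : Used s P d₁ d₂ (pos d p) := ⟨m, T, hl.nth, hl.mem⟩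
  -- If d₂ itself leaves U, its cut would have to be at position 1 of the first member, since all
  -- members contain the new vertex of d₂. In the opposite direction only the excluded position 2
  -- would be possible.
  have free : ∀ n W, IsNth (sub s) (hatTwo s P d₁ d₂) n W → d₂.1 ∉ cut s (base W) := by
    intro n W hW hc
    have key : ∀ y, y.1 = d₂.1 → Out s U y → False := by
      intro y hyd hy
      have hyW := h.out_of_mem_cut hU.1 hU.2.2 hW.mem hy (hyd ▸ hc)
      obtain ⟨q, hq, hl1, hl2⟩ := (h.clean_two hW.mem).exists_level hyW
      have hq2 : q ≠ 2 := fun e => h.not_used_two hU hy ⟨n, W, hW, e ▸ hq⟩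
      have hmem : Sum.inr d₂ ∈ W := hW.mem.2 (by simp)
      rcases eq_or_eq_rev_of_fst hyd with rfl | rfl
      · have hq0 := hl1.1 hmem
        have hq1 : q = 1 := by clear hl1 hl2 hq; revert q; decide
        subst hq1
        rcases n with - | n
        · exact hno ⟨hy, (hT₀.unique hW) ▸ hq⟩
        · obtain ⟨W', hW'⟩ := hW.exists_of_le (m := n) (by omega)
          obtain ⟨h3, h4⟩ := h.prev_level hW' hW hyW hq (by decide)
          exact (inner_mem_outer_notMem (h.clean_two hW'.mem) h4 h3).2 (hW'.mem.2 (by simp [outer]))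
      · rw [rev_rev] at hl2
        exact hq2 (hl2.1 hmem)
    rcases out_or_out_rev h2 with h3 | h3
    · exact key _ rfl h3
    · exact key (rev d₂) rfl h3
  have hcT := h.clean_two hT₀.mem
  have m2 : s d₂ ∈ base T₀ ∧ s (rev d₂) ∈ base T₀ := by
    have m2 := hcT.subset_lift_two (hT₀.mem.2 (by simp : Sum.inr d₂ ∈ _))
    have := free 0 T₀ hT₀
    rw [mem_cut_iff, not_not] at this
    rw [inr_mem_lift_two] at m2
    clear * - m2 this
    tauto
  have hnT : ¬ T₀ ⊆ lift s 2 U := by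
    intro h3
    have a1 : s d₂ ∈ U := h3 m2.1
    have a2 : s (rev d₂) ∈ U := h3 m2.2
    rw [mem_cut_iff] at h2
    exact h2 ⟨fun _ => a2, fun _ => a1⟩
  obtain ⟨x', hxx', hx'⟩ := h.exists_other hT₀.mem hx
  obtain ⟨t, ht, -⟩ := hcT.exists_level hx'
  have ht0 : t = 0 := by
    have hx1 : x'.1 ≠ d₁.1 := fun e => hxx' (hx'.unique hx (e.trans hxd.symm))
    have hx2 : x'.1 ≠ d₂.1 := fun e => free 0 T₀ hT₀ (e ▸ hx'.mem_cut)
    have := h.first_level hT₀ hx' ht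
    fin_cases t
    · rfl
    · rcases this.1 rfl with rfl | rfl
      · exact absurd rfl hx1
      · exact absurd rfl hx2
    · rcases this.2 rfl with rfl | rfl
      · exact absurd rfl hx1
      · exact absurd rfl hx2
  subst ht0
  have hxZ : outer s x r ∈ lift s 2 U := by
    rcases hxr with ⟨rfl, rfl⟩ | ⟨rfl, rfl⟩
    · simp [outer, h1]
    · exact h1
  have side := fun n (W : Set (V ⊕ (E × Bool))) (hW : IsNth (sub s) (hatTwo s P d₁ d₂) n W)
    (hWf : ¬ Setup.Full s P d₁ d₂ W) => h.sides hU hT₀ hnT hx hx' hxx'.symm hr ht hxZ n hW hWf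
  have hTf := Setup.LastAt.not_full h.toSetup hl
  obtain ⟨y, z, i, j, hy, hz, hi, hj, hiZ, hjZ, ej, ei⟩ := side m T hl.nth hTf
  have hcT' := h.clean_two hl.nth.mem
  have hyz : y ≠ z := by
    rintro rfl
    obtain rfl := hcT'.eq_of_pos hi hj
    exact hjZ hiZ
  obtain rfl : d = y := by
    refine (h.eq_or_eq hl.nth.mem hy hz hyz hl.out).resolve_right fun e => ?_
    subst e
    obtain rfl := hcT'.eq_of_pos hl.mem hj
    refine hjZ ?_
    have := hl.ne_two
    have hdU := hd.1
    fin_cases p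
    · simp [outer, hdU]
    · simp [outer, hdU]
    · exact absurd rfl this
  obtain rfl := hcT'.eq_of_pos hl.mem hi
  obtain rfl := Setup.LastAt.other_level h.toSetup hl hz hyz hj
  -- The outside cut starts at position 0 and the inside cut at r. When d is last, the outside cut
  -- is at position 2, which determines m mod 3 and then p.
  have em : m % 3 = 2 := ej.symm
  obtain ⟨ha, hb, hc, hab, hac, hbc⟩ := h.residues
  have ma := h.mem_iff_of_used hU hd hu h.chain_a
  have mb := h.mem_iff_of_used hU hd hu h.chain_b
  have mc := h.mem_iff_of_used hU hd hu h.chain_c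
  have l0 := h.lift_mem_iff_of_used hU hd hu (p := 0)
  have l1 := h.lift_mem_iff_of_used hU hd hu (p := 1)
  rw [inr_mem_lift_zero, inr_mem_lift_zero] at l0
  rw [inr_mem_lift_one, inr_mem_lift_one] at l1
  have h2c := h2
  rw [mem_cut_iff] at h2c
  rcases hxr with ⟨rfl, rfl⟩ | ⟨rfl, rfl⟩
  · obtain rfl : p = 0 := Fin.ext (by rw [ei]; simp; omega)
    obtain ⟨T₁, hT₁⟩ := hl.nth.exists_of_le (m := 1) (by omega)
    obtain ⟨y₁, z₁, i₁, j₁, hy₁, -, hi₁, -, -, -, -, ei₁⟩ :=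
      side 1 T₁ hT₁ fun hf => hTf (h.full_of_le hT₁ hl.nth hf (by omega))
    obtain rfl : i₁ = 2 := Fin.ext ei₁
    obtain ⟨b1, b2⟩ := h.prev_level hT₀ hT₁ hy₁ hi₁ (by decide)
    obtain rfl : y₁ = x := by
      refine (h.eq_or_eq hT₀.mem hx hx' hxx'.symm b2).resolve_right fun e => ?_
      subst e
      exact absurd (hcT.eq_of_pos b1 ht) (by decide)
    have c0 : c.val ≠ 0 := fun h0 => hx.2 (h.mem_base_c (h0 ▸ hT₀)).1
    have c1 : c.val ≠ 1 := fun h0 => hy₁.2 (h.mem_base_c (h0 ▸ hT₁)).1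
    have ua : ¬ UsedIn s P {s y₁, s d₂} d.1 := by
      rw [Setup.LastAt.usedIn_iff_zero h.toSetup hl hU hd h.chain_a]; omega
    have ub : ¬ UsedIn s P {s y₁, s (rev d₂)} d.1 := by
      rw [Setup.LastAt.usedIn_iff_zero h.toSetup hl hU hd h.chain_b]; omega
    by_cases h3 : s d₂ ∈ U
    -- Here the spoiled pair is the third. If U contained the source of d₂, it would be free for the
    -- first pair, whose chains would then have both d₁ and d₂ terminal.
    · exfalso
      have hm := ma.2 ⟨⟨h1, h3⟩, ua⟩
      refine h.quasi ⟨?_, isTerminal_of_mem_threeTails h.conn hm ⟨h3, by clear * - h2c h3; tauto⟩ (by simp)⟩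
      have : a.val = 0 ∨ a.val = 1 := by omega
      rcases this with h0 | h0
      · exact ⟨0, base T₀, Or.inl ((h.chain_a 0 _).2 ⟨T₀, by simpa [h0] using hT₀, rfl⟩),
          hx.mem_cut⟩
      · exact ⟨0, base T₁, Or.inl ((h.chain_a 0 _).2 ⟨T₁, by simpa [h0] using hT₁, rfl⟩),
          hy₁.mem_cut⟩
    · have h3' : s (rev d₂) ∈ U := by clear * - h2c h3; tauto
      have hA : ¬ _ := fun h4 => h3 (ma.1 h4).1.2
      have hB := mb.2 ⟨⟨h1, h3'⟩, ub⟩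
      have hC : ¬ _ := fun h4 => h3 (mc.1 h4).1.2
      have h0 : ¬ _ := fun h4 => h3 (l0.1 h4).1.2.1
      have h1 : ¬ _ := fun h4 => h3 (l1.1 h4).1.2
      simp only [Counts, hA, hB, hC, h0, h1, and_true, and_false, or_false, or_true, and_self, or_self]
  · obtain rfl : p = 1 := Fin.ext (by rw [ei]; simp; omega)
    have hx2 : s (rev x) ∉ base T₀ := hx.2
    have a0 : a.val ≠ 0 := fun h0 => hx2 (h.mem_base_a (h0 ▸ hT₀)).1
    have b0 : b.val ≠ 0 := fun h0 => hx2 (h.mem_base_b (h0 ▸ hT₀)).1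
    have ua : UsedIn s P {s (rev x), s d₂} d.1 := by
      rw [Setup.LastAt.usedIn_iff_one h.toSetup hl hU hd h.chain_a]; omega
    have ub : UsedIn s P {s (rev x), s (rev d₂)} d.1 := by
      rw [Setup.LastAt.usedIn_iff_one h.toSetup hl hU hd h.chain_b]; omega
    have uc : ¬ UsedIn s P {s (rev (rev x)), s d₂} d.1 := by
      rw [Setup.LastAt.usedIn_iff_one h.toSetup hl hU hd h.chain_c]; omega
    by_cases h3 : s d₂ ∈ U
    · have hA : ¬ _ := fun h4 => (ma.1 h4).2 ua
      have hB : ¬ _ := fun h4 => (mb.1 h4).2 ub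
      have hC := mc.2 ⟨⟨h1', h3⟩, uc⟩
      have h0 : lift s 0 U ∉ hatThree s P (rev x) d₂ := fun h4 => h2c
        (by clear * - h4 l0; tauto)
      have h1 : ¬ _ := fun h4 => (l1.1 h4).2 hu
      simp only [Counts, hA, hB, hC, h0, h1, and_true, or_true, and_self, or_self]
    -- The chain of the two targets starts at the first member and coincides with that of the third
    -- pair, for which U is unspoiled. So U is free for the targets, and both edges are terminal for
    -- them.
    · exfalso
      have h3' : s (rev d₂) ∈ U := by clear * - h2c h3; tauto
      have q1 := h.isLeast_base hT₀ (X := {s (rev (rev x)), s (rev d₂)})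
        (by rw [Set.insert_subset_iff, Set.singleton_subset_iff, rev_rev]; exact ⟨hx.1, m2.2⟩)
        (sources_of_subset rfl rfl)
      have q2 := h.isLeast_base hT₀ (X := {s (rev (rev x)), s d₂})
        (by rw [Set.insert_subset_iff, Set.singleton_subset_iff, rev_rev]; exact ⟨hx.1, m2.1⟩)
        (sources_of_subset rfl rfl)
      have hm : U ∈ threeTails s P {s (rev (rev x)), s (rev d₂)} := by
        rw [mem_threeTails_iff (h.mem_tails_of_lift hU), Set.insert_subset_iff,
          Set.singleton_subset_iff]
        refine ⟨⟨h1', h3'⟩, fun d' hd' hu' => ?_⟩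
        rw [usedIn_congr q1 q2] at hu'
        obtain ⟨m', T', q', hT', hq', -, -⟩ := h.exists_level_of_usedIn hU h.chain_c hd' hu'
        exact uc (h.eq_of_used hU hd hd' hu ⟨m', T', hT', hq'⟩ ▸ hu')
      exact h.quasi_rev ⟨⟨0, base T₀, Or.inl q1, hx.mem_cut⟩,
        isTerminal_of_mem_threeTails h.conn hm (d := rev d₂) ⟨h3', by rwa [rev_rev]⟩ (by simp)⟩

lemma counts_of_level (hU : lift s 2 U ∈ hatThree s P d₁ d₂) (hd : Out s U d)
    (hl : Setup.LastAt s P d₁ d₂ d p m T) {T₀ : Set (V ⊕ (E × Bool))}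
    (hT₀ : IsNth (sub s) (hatTwo s P d₁ d₂) 0 T₀) (hx : Out s (base T₀) x)
    (hr : pos x r ∈ cut (sub s) T₀) (hxr : (x = d₁ ∧ r = 1) ∨ (rev x = d₁ ∧ r = 2)) :
    Counts s P d₁ d₂ U := by
  by_cases f1 : Out s U d₁ ∧ pos d₁ 1 ∈ cut (sub s) T₀
  · exact h.counts_of_first hU hT₀ f1.1 f1.2
  by_cases f2 : Out s U d₂ ∧ pos d₂ 1 ∈ cut (sub s) T₀
  · refine Counts.symm (h.symm.counts_of_first ?_ ?_ f2.1 f2.2 (T := T₀))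
    · rwa [hatThree_comm]
    · rwa [hatTwo_comm]
  have n1 : Sum.inr d₁ ∈ lift s 2 U := hU.2.2 (by simp)
  have n2 : Sum.inr d₂ ∈ lift s 2 U := hU.2.2 (by simp)
  rw [inr_mem_lift_two] at n1 n2
  have ends : s d₁ ∈ U ∧ s (rev d₁) ∈ U := by
    rcases hxr with ⟨rfl, rfl⟩ | ⟨rfl, rfl⟩
    · have a1 : ¬ Out s U x := fun h3 => f1 ⟨h3, hr⟩
      have a2 : ¬ Out s U (rev x) := fun h3 =>
        h.no_cross hU.1 hU.2.2 hT₀.mem h3 (by rwa [rev_rev])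
      simp only [Out, rev_rev] at a1 a2
      tauto
    · have a1 : s (rev x) ∈ U := by
        have := (Setup.outer_mem_iff_inner_mem hU ⟨0, T₀, hT₀, hr⟩).1 (hU.2.2 (by simp [inner]))
        exact this
      have a2 : ¬ Out s U (rev x) := fun h3 =>
        h.no_cross hU.1 hU.2.2 hT₀.mem h3 (by rwa [rev_rev])
      simp only [Out, rev_rev] at a2 ⊢
      tauto
  by_cases h2 : d₂.1 ∈ cut s U
  · exact h.counts_of_mem_cut hU hd hl hT₀ hx hr hxr ends.1 ends.2 h2 f2
  · rw [mem_cut_iff, not_not] at h2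
    exact h.counts_of_ends hU hd hl ends.1 ends.2 (by tauto) (by tauto)

lemma counts (hU : lift s 2 U ∈ hatThree s P d₁ d₂) : Counts s P d₁ d₂ U := by
  by_cases hno : ∀ d q, Out s U d → ¬ Used s P d₁ d₂ (pos d q)
  · exact h.counts_of_not_used hU hno
  push Not at hno
  obtain ⟨d, q, hd, hu⟩ := hno
  obtain ⟨p, m, T, hl⟩ := h.exists_lastAt hU hd hu
  obtain ⟨T₀, hT₀⟩ := hl.nth.exists_of_le (Nat.zero_le m)
  have hf : ¬ Setup.Full s P d₁ d₂ T₀ := fun hf =>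
    Setup.LastAt.not_full h.toSetup hl (h.full_of_le hT₀ hl.nth hf (Nat.zero_le m))
  have hc := h.clean_two hT₀.mem
  -- The first member is not full, hence is cut somewhere beyond position 0. By `first_level` this
  -- happens on the path of d₁ or of d₂.
  obtain ⟨x, hx, hx0⟩ : ∃ x, Out s (base T₀) x ∧ pos x 0 ∉ cut (sub s) T₀ := by
    by_contra! hcon
    exact hf (Setup.full_of_eq_lift_zero hT₀ (eq_lift_of_level hc hcon))
  obtain ⟨r, hr, -⟩ := hc.exists_level hx
  have key : ((x = d₁ ∧ r = 1) ∨ (rev x = d₁ ∧ r = 2)) ∨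
      ((x = d₂ ∧ r = 1) ∨ (rev x = d₂ ∧ r = 2)) := by
    have := h.first_level hT₀ hx hr
    fin_cases r
    · exact absurd hr hx0
    · rcases this.1 rfl with h1 | h1 <;> simp [h1]
    · rcases this.2 rfl with h1 | h1 <;> simp [h1]
  rcases key with hxr | hxr
  · exact h.counts_of_level hU hd hl hT₀ hx hr hxr
  · refine Counts.symm (h.symm.counts_of_level (d := d) (p := p) (m := m) (T := T) (T₀ := T₀)
      ?_ hd ?_ ?_ hx hr hxr)
    · rwa [hatThree_comm]
    · obtain ⟨k1, k2, k3, k4, k5⟩ := hl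
      refine ⟨?_, k2, k3, k4, ?_⟩
      · rwa [hatTwo_comm]
      · unfold Used at k5 ⊢
        rwa [hatTwo_comm]
    · rwa [hatTwo_comm]

end SyncSetup

theorem isInterlaced_threeTails [Finite V] [Finite E] (hs : IsConn s) (h12 : d₁.1 ≠ d₂.1)
    (hA : ¬ (IsTerminal s P {s d₁, s d₂} d₁.1 ∧ IsTerminal s P {s d₁, s d₂} d₂.1))
    (hC : ¬ (IsTerminal s P {s (rev d₁), s (rev d₂)} d₁.1 ∧
      IsTerminal s P {s (rev d₁), s (rev d₂)} d₂.1)) :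
    IsInterlaced s (hatThree s P d₁ d₂) (fun i => threeTails s P (pairs s d₁ d₂ i)) := by
  obtain ⟨σ, hσ⟩ := (isInterlaced_twoTails (P := P) hs h12 hA hC).exists_perm
  have h : SyncSetup s P d₁ d₂ (σ 0) (σ 1) (σ 2) :=
    { conn := hs, ne := h12
      ne_ab := fun e => absurd (σ.injective e) (by decide)
      ne_ac := fun e => absurd (σ.injective e) (by decide)
      ne_bc := fun e => absurd (σ.injective e) (by decide)
      chain_a := hσ 0, chain_b := hσ 1, chain_c := hσ 2, quasi := hA, quasi_rev := hC }
  have hXr : ∀ i, (pairs s d₁ d₂ i = {s d₁, s d₂} ∧ σ i = σ 0) ∨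
      (pairs s d₁ d₂ i = {s d₁, s (rev d₂)} ∧ σ i = σ 1) ∨
      (pairs s d₁ d₂ i = {s (rev d₁), s d₂} ∧ σ i = σ 2) := by
    intro i
    fin_cases i <;> simp [pairs]
  refine
    { hat := isMeetFamily_threeTails (isConn_sub hs) (Set.insert_nonempty _ _)
      fam := fun i => isMeetFamily_threeTails hs (pairs_nonempty _ _ _)
      subset_lift := fun Z hZ => (h.clean_three hZ).subset_lift_two
      lift_two := fun Z hZ => h.lift_two_mem hZ
      lift_mem := fun Z hZ U p hZU hU => h.lift_mem_of_subset hZ hZU hU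
      lift_of_mem := fun i U hU => h.lift_two_mem_of_mem (hσ i) (hXr i) hU
      upper := fun i U hU U' hUU' hU' => h.mem_of_subset (hσ i) (hXr i) hU hUU' hU'
      one := fun U hU => ?_, two := fun U hU => ?_, three := fun U hU => ?_ }
  · rcases (h.counts hU).1 with h1 | h1 | h1
    exacts [⟨0, h1⟩, ⟨1, h1⟩, ⟨2, h1⟩]
  · rw [(h.counts hU).2.1]
    constructor
    · rintro (⟨h1, h2⟩ | ⟨h1, h2⟩ | ⟨h1, h2⟩)
      exacts [⟨0, 1, by decide, h1, h2⟩, ⟨0, 2, by decide, h1, h2⟩, ⟨1, 2, by decide, h1, h2⟩]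
    · rintro ⟨i, j, hij, hi, hj⟩
      fin_cases i <;> fin_cases j <;> simp [pairs] at hij hi hj <;> tauto
  · rw [(h.counts hU).2.2]
    constructor
    · rintro ⟨h1, h2, h3⟩ i
      fin_cases i
      exacts [h1, h2, h3]
    · exact fun h1 => ⟨h1 0, h1 1, h1 2⟩

end ThreeTailsCount

end DualGraph

namespace DualGraph

/-! ### Connected sets of vertices -/

section Connected

variable {V E : Type*} {s : E × Bool → V} {P : V} {S T : Set V}

variable (s) in
/-- The subgraph induced on `S` is nonempty and connected. -/
def IsConnSet (S : Set V) : Prop :=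
  S.Nonempty ∧ ∀ T ⊆ S, T.Nonempty → (S \ T).Nonempty → ∃ d, s d ∈ T ∧ s (rev d) ∈ S \ T

/-- A disconnection of S splits its cut into two nonempty cuts. With at most three edges one part
has a single edge, which is a bridge; with one edge there is no such splitting. -/
lemma isConnSet_of_ncard_cut [Finite E] (hs : IsConn s) (hc : (cut s S).Nonempty)
    (hk : (cut s S).ncard = 1 ∨ (cut s S).ncard ≤ 3 ∧ ∀ e ∈ cut s S, ¬ IsBridge s e) :
    IsConnSet s S := by
  obtain ⟨e, he⟩ := hc
  obtain ⟨d, rfl, hd⟩ := exists_out_of_mem_cut he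
  refine ⟨⟨_, hd.1⟩, fun T hTS hT hST => ?_⟩
  by_contra! hcon
  have hdisj : Disjoint (cut s T) (cut s (S \ T)) := by
    refine Set.disjoint_left.2 fun e h1 h2 => ?_
    obtain ⟨x, rfl, hx⟩ := exists_out_of_mem_cut h1
    rw [mem_cut_iff] at h2
    have a := hcon x hx.1
    have b := hx.1
    simp only [Set.mem_sdiff] at a h2
    tauto
  have hunion : cut s S = cut s T ∪ cut s (S \ T) := by
    ext e
    rw [Set.mem_union, mem_cut_iff (e, false), mem_cut_iff (e, false), mem_cut_iff (e, false)]
    have a := hcon (e, false)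
    have b := hcon (rev (e, false))
    have c := @hTS (s (e, false))
    have c' := @hTS (s (rev (e, false)))
    simp only [Set.mem_sdiff, rev_rev] at a b ⊢
    tauto
  have n1 : (cut s T).Nonempty := by
    rw [Set.nonempty_iff_ne_empty]
    intro h0
    rcases hs T h0 with h1 | h1
    · rw [h1] at hT
      exact Set.not_nonempty_empty hT
    · exact hd.2 (hTS (h1 ▸ Set.mem_univ _))
  have n2 : (cut s (S \ T)).Nonempty := by
    rw [Set.nonempty_iff_ne_empty]
    intro h0
    rcases hs _ h0 with h1 | h1
    · rw [h1] at hST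
      exact Set.not_nonempty_empty hST
    · have : s (rev d) ∈ S \ T := h1 ▸ Set.mem_univ _
      exact hd.2 this.1
  have hcard : (cut s S).ncard = (cut s T).ncard + (cut s (S \ T)).ncard := by
    rw [hunion, Set.ncard_union_eq hdisj]
  have p1 := n1.ncard_pos
  have p2 := n2.ncard_pos
  rcases hk with h1 | ⟨h3, hb⟩
  · omega
  · rcases (by omega : (cut s T).ncard = 1 ∨ (cut s (S \ T)).ncard = 1) with h1 | h1
    · obtain ⟨e, he⟩ := Set.ncard_eq_one.1 h1
      exact hb e (by rw [hunion, he]; simp) ⟨T, he⟩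
    · obtain ⟨e, he⟩ := Set.ncard_eq_one.1 h1
      exact hb e (by rw [hunion, he]; simp) ⟨_, he⟩

lemma not_isBridge_of_isConnSet (hS : IsConnSet s S) (hS' : IsConnSet s Sᶜ)
    (hk : 2 ≤ (cut s S).ncard) {e : E} (he : e ∈ cut s S) : ¬ IsBridge s e := by
  rintro ⟨T, hT⟩
  -- The bridge runs between S and its complement, so it disconnects neither. Each of them lies on
  -- one side of T, which makes the cut of S consist of the bridge alone.
  have side : ∀ A, (A = S ∨ A = Sᶜ) → IsConnSet s A → A ⊆ T ∨ A ∩ T = ∅ := by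
    intro A hA hAc
    by_contra! hcon
    obtain ⟨h1, h2⟩ := hcon
    obtain ⟨d, h3, h4⟩ := hAc.2 (A ∩ T) Set.inter_subset_left h2
      (by rw [Set.sdiff_self_inter]; exact Set.sdiff_nonempty.2 h1)
    have hd : d.1 ∈ cut s T := by
      rw [mem_cut_iff]
      exact fun h => h4.2 ⟨h4.1, h.1 h3.2⟩
    rw [hT] at hd
    rw [← Set.mem_singleton_iff.1 hd, mem_cut_iff] at he
    have a := h3.1
    have b := h4.1
    rcases hA with rfl | rfl
    · exact he ⟨fun _ => b, fun _ => a⟩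
    · exact he ⟨fun h => absurd h a, fun h => absurd h b⟩
  have hcut : cut s S = cut s T := by
    have h1 := side S (Or.inl rfl) hS
    have h2 := side Sᶜ (Or.inr rfl) hS'
    have hne : (cut s T).Nonempty := hT ▸ Set.singleton_nonempty e
    have key : T = S ∨ T = Sᶜ := by
      rcases h1 with h1 | h1 <;> rcases h2 with h2 | h2
      · have : T = Set.univ := Set.eq_univ_of_univ_subset
          (by rw [← Set.union_compl_self S]; exact Set.union_subset h1 h2)
        rw [this] at hne
        obtain ⟨e, he⟩ := hne
        simp [cut] at he
      · left
        refine Set.Subset.antisymm (fun v hv => ?_) h1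
        by_contra hvS
        exact Set.notMem_empty v (h2 ▸ ⟨hvS, hv⟩)
      · right
        refine Set.Subset.antisymm (fun v hv hvS => ?_) h2
        exact Set.notMem_empty v (h1 ▸ ⟨hvS, hv⟩)
      · have : T = ∅ := by
          rw [Set.eq_empty_iff_forall_notMem]
          intro v hv
          by_cases hvS : v ∈ S
          · exact Set.notMem_empty v (h1 ▸ ⟨hvS, hv⟩)
          · exact Set.notMem_empty v (h2 ▸ ⟨hvS, hv⟩)
        rw [this] at hne
        obtain ⟨e, he⟩ := hne
        simp [cut] at he
    rcases key with rfl | rfl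
    · rfl
    · rw [cut_compl]
  rw [hcut, hT, Set.ncard_singleton] at hk
  omega

lemma isConnSet_and_compl_iff [Finite E] (hs : IsConn s) {k : ℕ} (hk : k = 2 ∨ k = 3)
    (hc : (cut s S).ncard = k) :
    (IsConnSet s S ∧ IsConnSet s Sᶜ) ↔ ∀ e ∈ cut s S, ¬ IsBridge s e := by
  constructor
  · rintro ⟨h1, h2⟩ e he
    exact not_isBridge_of_isConnSet h1 h2 (by omega) he
  · intro hb
    have hne : (cut s S).Nonempty := (Set.ncard_pos).1 (by omega)
    refine ⟨isConnSet_of_ncard_cut hs hne (Or.inr ⟨by omega, hb⟩), ?_⟩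
    refine isConnSet_of_ncard_cut hs (by rwa [cut_compl]) (Or.inr ?_)
    rw [cut_compl]
    exact ⟨by omega, hb⟩

end Connected

open AbelJacobi

/-! ### Curves with a dual graph -/

section DualGraphOf

variable {V E : Type*} {X : Type u} [TopologicalSpace X]

/-- The graph `s` is the dual graph of `X`: its vertices are the irreducible components, and its
edges which are not loops are the points where two of them meet. -/
structure IsDualGraph (s : E × Bool → V) (comp : V → Set X) (node : E → X) : Prop where
  injective : Function.Injective comp
  range_eq : Set.range comp = irreducibleComponents X
  node_mem : ∀ d, node d.1 ∈ comp (s d)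
  exists_node : ∀ v w x, v ≠ w → x ∈ comp v → x ∈ comp w → ∃ d, node d.1 = x ∧ s d = v ∧ s (rev d) = w
  node_injective : Function.Injective node

/-- The union of the components indexed by `S`. -/
def curve (comp : V → Set X) (S : Set V) : Set X := ⋃ v ∈ S, comp v

variable {s : E × Bool → V} {comp : V → Set X} {node : E → X} {S S' : Set V} {P : X} {vP : V}

omit [TopologicalSpace X] in
lemma mem_curve {x : X} : x ∈ curve comp S ↔ ∃ v ∈ S, x ∈ comp v := by simp [curve]

omit [TopologicalSpace X] in
lemma curve_mono (h : S ⊆ S') : curve comp S ⊆ curve comp S' :=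
  Set.biUnion_subset_biUnion_left h

namespace IsDualGraph

section Basic

variable (h : IsDualGraph s comp node)
include h

lemma mem_irreducibleComponents (v : V) : comp v ∈ irreducibleComponents X :=
  h.range_eq ▸ ⟨v, rfl⟩

lemma isIrreducible (v : V) : IsIrreducible (comp v) := (h.mem_irreducibleComponents v).1

lemma isClosed (v : V) : IsClosed (comp v) :=
  isClosed_of_mem_irreducibleComponents _ (h.mem_irreducibleComponents v)

lemma eq_of_subset {v w : V} (hvw : comp v ⊆ comp w) : v = w :=
  h.injective (hvw.antisymm ((h.mem_irreducibleComponents v).2 (h.isIrreducible w) hvw))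

lemma isSubcurve_iff {Z : Set X} : IsSubcurve Z ↔ ∃ S, Z = curve comp S := by
  constructor
  · rintro ⟨𝒮, h𝒮, rfl⟩
    refine ⟨comp ⁻¹' 𝒮, ?_⟩
    ext x
    rw [mem_curve]
    constructor
    · rintro ⟨D, hD, hx⟩
      obtain ⟨v, rfl⟩ := h.range_eq ▸ h𝒮 hD
      exact ⟨v, hD, hx⟩
    · rintro ⟨v, hv, hx⟩
      exact ⟨_, hv, hx⟩
  · rintro ⟨S, rfl⟩
    refine ⟨comp '' S, ?_, by rw [Set.sUnion_image]; rfl⟩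
    rintro _ ⟨v, -, rfl⟩
    exact h.mem_irreducibleComponents v

lemma curve_univ : curve comp Set.univ = Set.univ := by
  rw [Set.eq_univ_iff_forall]
  intro x
  obtain ⟨v, hv⟩ := h.range_eq ▸ irreducibleComponent_mem_irreducibleComponents x
  exact mem_curve.2 ⟨v, trivial, hv ▸ mem_irreducibleComponent⟩

end Basic

variable [Finite V] (h : IsDualGraph s comp node)
include h

lemma isClosed_curve (S : Set V) : IsClosed (curve comp S) :=
  (Set.toFinite S).isClosed_biUnion fun v _ => h.isClosed v

lemma comp_subset_curve_iff {v : V} : comp v ⊆ curve comp S ↔ v ∈ S := by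
  constructor
  · intro hv
    obtain ⟨Z, hZ, hvZ⟩ := isIrreducible_iff_sUnion_isClosed.1 (h.isIrreducible v)
      ((Set.toFinite S).toFinset.image comp) (by
        intro Z hZ
        simp only [Finset.mem_image, Set.Finite.mem_toFinset] at hZ
        obtain ⟨w, -, rfl⟩ := hZ
        exact h.isClosed w) (by
        refine hv.trans fun x hx => ?_
        obtain ⟨w, hw, hx⟩ := mem_curve.1 hx
        exact ⟨comp w, by simpa using ⟨w, hw, rfl⟩, hx⟩)
    simp only [Finset.mem_image, Set.Finite.mem_toFinset] at hZ
    obtain ⟨w, hw, rfl⟩ := hZ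
    exact h.eq_of_subset hvZ ▸ hw
  · exact fun hv x hx => mem_curve.2 ⟨v, hv, hx⟩

lemma curve_subset_iff : curve comp S ⊆ curve comp S' ↔ S ⊆ S' := by
  refine ⟨fun hS v hv => h.comp_subset_curve_iff.1 ?_, curve_mono⟩
  exact (h.comp_subset_curve_iff.2 hv).trans hS

lemma curve_injective : Function.Injective (curve comp) := fun S S' hS =>
  (h.curve_subset_iff.1 hS.subset).antisymm (h.curve_subset_iff.1 hS.superset)

/-- A component not indexed by S is irreducible and not contained in the curve of S, so its part
outside that curve is dense in it. -/
lemma complCurve_curve : complCurve (curve comp S) = curve comp Sᶜ := by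
  apply Set.Subset.antisymm
  · refine closure_minimal (fun x hx => ?_) (h.isClosed_curve _)
    obtain ⟨v, -, hv⟩ := mem_curve.1 (h.curve_univ ▸ Set.mem_univ x : x ∈ curve comp Set.univ)
    exact mem_curve.2 ⟨v, fun hvS => hx (mem_curve.2 ⟨v, hvS, hv⟩), hv⟩
  · intro x hx
    obtain ⟨v, hv, hx⟩ := mem_curve.1 hx
    have hne : (comp v ∩ (curve comp S)ᶜ).Nonempty := by
      rw [Set.inter_compl_nonempty_iff]
      exact fun h1 => hv (h.comp_subset_curve_iff.1 h1)
    refine mem_closure_iff.2 fun U hU hxU => ?_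
    obtain ⟨y, -, hyU, hyS⟩ := (h.isIrreducible v).2 U _ hU (h.isClosed_curve S).isOpen_compl
      ⟨x, hx, hxU⟩ hne
    exact ⟨y, hyU, hyS⟩

lemma term_curve : Term (curve comp S) = node '' cut s S := by
  rw [Term, h.complCurve_curve]
  ext x
  constructor
  · rintro ⟨h1, h2⟩
    obtain ⟨v, hv, hxv⟩ := mem_curve.1 h1
    obtain ⟨w, hw, hxw⟩ := mem_curve.1 h2
    obtain ⟨d, rfl, rfl, rfl⟩ := h.exists_node v w x (fun e => hw (e ▸ hv)) hxv hxw
    exact ⟨d.1, Out.mem_cut ⟨hv, hw⟩, rfl⟩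
  · rintro ⟨e, he, rfl⟩
    obtain ⟨d, rfl, hd⟩ := exists_out_of_mem_cut he
    exact ⟨mem_curve.2 ⟨_, hd.1, h.node_mem d⟩, mem_curve.2 ⟨_, hd.2, h.node_mem (rev d)⟩⟩

lemma isFree_iff : IsFree (curve comp S) (curve comp S') ↔ Disjoint (cut s S) (cut s S') := by
  rw [IsFree, h.term_curve, h.term_curve, Set.disjoint_image_iff h.node_injective]

lemma prec_iff : Prec (curve comp S) (curve comp S') ↔ Precedes s S S' := by
  rw [Prec, h.isFree_iff, Precedes, Set.ssubset_def, h.curve_subset_iff, h.curve_subset_iff,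
    Set.ssubset_def]

lemma encard_term [Finite E] {k : ℕ} : (Term (curve comp S)).encard = k ↔ (cut s S).ncard = k := by
  rw [h.term_curve, h.node_injective.encard_image, Set.ncard,
    ← Set.encard_ne_top_iff.2 (Set.toFinite (cut s S)) |> ENat.natCast_toNat]
  simp

/-- An irreducible component is never split by two closed sets. A separation of the curve is thus a
partition of its components with no node in common. -/
lemma isConnected_curve_iff : IsConnected (curve comp S) ↔ IsConnSet s S := by
  constructor
  · rintro ⟨⟨x, hx⟩, hpre⟩
    obtain ⟨v, hv, -⟩ := mem_curve.1 hx
    refine ⟨⟨v, hv⟩, fun T hTS hT hST => ?_⟩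
    have sub_ne : ∀ A ⊆ S, A.Nonempty → (curve comp S ∩ curve comp A).Nonempty := by
      rintro A hA ⟨w, hw⟩
      obtain ⟨y, hy⟩ := (h.isIrreducible w).1
      exact ⟨y, mem_curve.2 ⟨w, hA hw, hy⟩, mem_curve.2 ⟨w, hw, hy⟩⟩
    obtain ⟨y, -, h1, h2⟩ := isPreconnected_closed_iff.1 hpre _ _ (h.isClosed_curve T)
      (h.isClosed_curve (S \ T)) (by
        intro y hy
        obtain ⟨w, hw, hy⟩ := mem_curve.1 hy
        by_cases hwT : w ∈ T
        · exact Or.inl (mem_curve.2 ⟨w, hwT, hy⟩)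
        · exact Or.inr (mem_curve.2 ⟨w, ⟨hw, hwT⟩, hy⟩))
      (sub_ne T hTS hT) (sub_ne _ Set.sdiff_subset hST)
    obtain ⟨v, hv, hyv⟩ := mem_curve.1 h1
    obtain ⟨w, hw, hyw⟩ := mem_curve.1 h2
    obtain ⟨d, -, rfl, rfl⟩ := h.exists_node v w y (fun e => hw.2 (e ▸ hv)) hyv hyw
    exact ⟨d, hv, hw⟩
  · rintro ⟨⟨v, hv⟩, hS⟩
    obtain ⟨x, hx⟩ := (h.isIrreducible v).1
    refine ⟨⟨x, mem_curve.2 ⟨v, hv, hx⟩⟩, isPreconnected_closed_iff.2 ?_⟩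
    rintro t t' ht ht' htt' ⟨y, hyS, hyt⟩ ⟨y', hyS', hyt'⟩
    have alt : ∀ w ∈ S, comp w ⊆ t ∨ comp w ⊆ t' := fun w hw =>
      isPreirreducible_iff_isClosed_union_isClosed.1 (h.isIrreducible w).2 t t' ht ht'
        ((h.comp_subset_curve_iff.2 hw).trans htt')
    set T := {w | w ∈ S ∧ comp w ⊆ t} with hT
    by_cases h1 : T.Nonempty
    · by_cases h2 : (S \ T).Nonempty
      · obtain ⟨d, hd, hd'⟩ := hS T (fun w hw => hw.1) h1 h2
        refine ⟨node d.1, mem_curve.2 ⟨_, hd.1, h.node_mem d⟩, hd.2 (h.node_mem d), ?_⟩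
        exact (alt _ hd'.1).resolve_left (fun h3 => hd'.2 ⟨hd'.1, h3⟩) (h.node_mem (rev d))
      · rw [Set.not_nonempty_iff_eq_empty, Set.sdiff_eq_empty] at h2
        obtain ⟨w, hw, hyw⟩ := mem_curve.1 hyS'
        exact ⟨y', hyS', (h2 hw).2 hyw, hyt'⟩
    · obtain ⟨w, hw, hyw⟩ := mem_curve.1 hyS
      refine ⟨y, hyS, hyt, (alt w hw).resolve_left (fun h3 => h1 ⟨w, hw, h3⟩) hyw⟩

lemma isConn [PreconnectedSpace X] : IsConn s := by
  intro S hS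
  by_contra! hcon
  have hc : curve comp S ∩ curve comp Sᶜ = ∅ := by
    rw [← h.complCurve_curve]
    change Term (curve comp S) = ∅
    rw [h.term_curve, hS, Set.image_empty]
  have hne : ∀ A : Set V, A.Nonempty → (Set.univ ∩ curve comp A).Nonempty := by
    rintro A ⟨w, hw⟩
    obtain ⟨y, hy⟩ := (h.isIrreducible w).1
    exact ⟨y, trivial, mem_curve.2 ⟨w, hw, hy⟩⟩
  obtain ⟨y, -, hy⟩ := isPreconnected_closed_iff.1 (isPreconnected_univ (α := X)) _ _
    (h.isClosed_curve S) (h.isClosed_curve Sᶜ) (by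
      rw [← h.curve_univ]
      intro y hy
      obtain ⟨w, -, hy⟩ := mem_curve.1 hy
      by_cases hw : w ∈ S
      · exact Or.inl (mem_curve.2 ⟨w, hw, hy⟩)
      · exact Or.inr (mem_curve.2 ⟨w, hw, hy⟩)) (hne S hcon.1)
      (hne Sᶜ (Set.nonempty_compl.2 hcon.2))
  rw [hc] at hy
  exact hy

variable (hP : ∀ v, P ∈ comp v ↔ v = vP)
include hP

lemma mem_complCurve_iff : P ∈ complCurve (curve comp S) ↔ vP ∉ S := by
  rw [h.complCurve_curve, mem_curve]
  simp [hP]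

variable [Finite E] [PreconnectedSpace X]

lemma isKTail_curve_iff {k : ℕ} (hk : k = 2 ∨ k = 3) :
    (IsKTail k (curve comp S) ∧ P ∈ complCurve (curve comp S)) ↔ S ∈ tails s vP k := by
  rw [h.mem_complCurve_iff hP, IsKTail, h.encard_term, IsTail, h.complCurve_curve,
    h.isConnected_curve_iff, h.isConnected_curve_iff]
  have hsub : IsSubcurve (curve comp S) := h.isSubcurve_iff.2 ⟨S, rfl⟩
  constructor
  · rintro ⟨⟨⟨-, h1⟩, h2⟩, h3⟩
    exact ⟨h3, h2, (isConnSet_and_compl_iff h.isConn hk h2).1 h1⟩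
  · rintro ⟨h3, h2, h1⟩
    exact ⟨⟨⟨hsub, (isConnSet_and_compl_iff h.isConn hk h2).2 h1⟩, h2⟩, h3⟩

lemma isOneTail_curve_iff : (IsKTail 1 (curve comp S) ∧ P ∈ complCurve (curve comp S)) ↔
    vP ∉ S ∧ (cut s S).ncard = 1 := by
  rw [h.mem_complCurve_iff hP, IsKTail, h.encard_term, IsTail, h.complCurve_curve,
    h.isConnected_curve_iff, h.isConnected_curve_iff]
  have hsub : IsSubcurve (curve comp S) := h.isSubcurve_iff.2 ⟨S, rfl⟩
  constructor
  · rintro ⟨⟨-, h2⟩, h3⟩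
    exact ⟨h3, h2⟩
  · rintro ⟨h3, h2⟩
    have hne : (cut s S).Nonempty := (Set.ncard_pos).1 (by omega)
    refine ⟨⟨⟨hsub, isConnSet_of_ncard_cut h.isConn hne (Or.inl h2), ?_⟩, h2⟩, h3⟩
    refine isConnSet_of_ncard_cut h.isConn (by rwa [cut_compl]) (Or.inl ?_)
    rwa [cut_compl]

-- Closure under intersection as sets of vertices is what is needed; intersections of curves also
-- contain isolated points and are not used.
omit hP [Finite E] [PreconnectedSpace X] in
lemma inNestedChain_iff {𝓛 : Set (Set V)} (h𝓛 : IsMeetFamily s 𝓛) {Z : Set X} :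
    InNestedChain (curve comp '' 𝓛) Z ↔ ∃ n W, IsNth s 𝓛 n W ∧ curve comp W = Z := by
  have minimal : ∀ (𝒬 : Set (Set V)) (Q : Set X → Prop), (∀ Z ∈ 𝒬, ∀ Z' ∈ 𝒬, Z ∩ Z' ∈ 𝒬) →
      (∀ Z, Q Z ↔ Z ∈ curve comp '' 𝒬) → ∀ Z, Minimal Q Z ↔ ∃ W, IsLeast 𝒬 W ∧ curve comp W = Z := by
    intro 𝒬 Q hin hQ Z
    constructor
    · rintro ⟨h1, h2⟩
      obtain ⟨W, hW, rfl⟩ := (hQ Z).1 h1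
      refine ⟨W, (minimal_iff_isLeast hin).1 ⟨hW, fun S hS hSW => ?_⟩, rfl⟩
      exact h.curve_subset_iff.1 (h2 ((hQ _).2 ⟨S, hS, rfl⟩) (curve_mono hSW))
    · rintro ⟨W, hW, rfl⟩
      refine ⟨(hQ _).2 ⟨W, hW.1, rfl⟩, fun Z hZ _ => ?_⟩
      obtain ⟨S, hS, rfl⟩ := (hQ Z).1 hZ
      exact curve_mono (hW.2 hS)
  have first := minimal 𝓛 (fun Z => Z ∈ curve comp '' 𝓛) h𝓛.inter_mem fun Z => Iff.rfl
  have next : ∀ W ∈ 𝓛, ∀ Z, Minimal (fun Z => Z ∈ curve comp '' 𝓛 ∧ Prec (curve comp W) Z) Z ↔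
      ∃ W', IsLeast {Z | Z ∈ 𝓛 ∧ Precedes s W Z} W' ∧ curve comp W' = Z := by
    intro W hW
    refine minimal {Z | Z ∈ 𝓛 ∧ Precedes s W Z} _ (h𝓛.precedes_inter hW) fun Z => ?_
    constructor
    · rintro ⟨⟨S, hS, rfl⟩, hp⟩
      exact ⟨S, ⟨hS, h.prec_iff.1 hp⟩, rfl⟩
    · rintro ⟨S, ⟨hS, hp⟩, rfl⟩
      exact ⟨⟨S, hS, rfl⟩, h.prec_iff.2 hp⟩
  constructor
  · intro hZ
    induction hZ with
    | first h1 =>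
      obtain ⟨W, hW, rfl⟩ := (first _).1 h1
      exact ⟨0, W, hW, rfl⟩
    | next _ h1 ih =>
      obtain ⟨n, W, hW, rfl⟩ := ih
      obtain ⟨W', hW', rfl⟩ := (next W hW.mem _).1 h1
      exact ⟨n + 1, W', ⟨W, hW, hW'⟩, rfl⟩
  · rintro ⟨n, W, hW, rfl⟩
    induction n generalizing W with
    | zero => exact InNestedChain.first ((first _).2 ⟨W, hW, rfl⟩)
    | succ n ih =>
      obtain ⟨W', hW', hW⟩ := hW
      exact InNestedChain.next (ih W' hW') ((next W' hW'.mem _).2 ⟨W, hW, rfl⟩)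

omit hP [Finite E] [PreconnectedSpace X] in
lemma union_subset_curve_iff {v w : V} : comp v ∪ comp w ⊆ curve comp S ↔ {v, w} ⊆ S := by
  rw [Set.union_subset_iff, h.comp_subset_curve_iff, h.comp_subset_curve_iff,
    Set.insert_subset_iff, Set.singleton_subset_iff]

lemma mem_nestedTwo_iff {v w : V} {Z : Set X} : Z ∈ nestedTwo P (comp v) (comp w) ↔
    ∃ n W, IsNth s (twoTails s vP {v, w}) n W ∧ curve comp W = Z := by
  have : {Z | IsKTail 2 Z ∧ comp v ∪ comp w ⊆ Z ∧ P ∈ complCurve Z} =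
      curve comp '' twoTails s vP {v, w} := by
    ext Z
    constructor
    · rintro ⟨h1, h2, h3⟩
      obtain ⟨S, rfl⟩ := h.isSubcurve_iff.1 h1.1.1
      exact ⟨S, ⟨(h.isKTail_curve_iff hP (Or.inl rfl)).1 ⟨h1, h3⟩,
        h.union_subset_curve_iff.1 h2⟩, rfl⟩
    · rintro ⟨S, ⟨h1, h2⟩, rfl⟩
      have := (h.isKTail_curve_iff hP (Or.inl rfl)).2 h1
      exact ⟨this.1, h.union_subset_curve_iff.2 h2, this.2⟩
  rw [nestedTwo, this]
  exact h.inNestedChain_iff (isMeetFamily_twoTails h.isConn (Set.insert_nonempty _ _))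

lemma mem_nestedThree_iff {v w : V} {Z : Set X} : Z ∈ nestedThree P (comp v) (comp w) ↔
    ∃ n W, IsNth s (threeTails s vP {v, w}) n W ∧ curve comp W = Z := by
  have : {Z | IsKTail 3 Z ∧ (∀ W ∈ nestedTwo P (comp v) (comp w), IsFree Z W) ∧
      comp v ∪ comp w ⊆ Z ∧ P ∈ complCurve Z} = curve comp '' threeTails s vP {v, w} := by
    have free : ∀ S, (∀ W ∈ nestedTwo P (comp v) (comp w), IsFree (curve comp S) W) ↔
        ∀ n W, IsNth s (twoTails s vP {v, w}) n W → Disjoint (cut s S) (cut s W) := by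
      intro S
      constructor
      · intro h1 n W hW
        exact h.isFree_iff.1 (h1 _ ((h.mem_nestedTwo_iff hP).2 ⟨n, W, hW, rfl⟩))
      · intro h1 Z hZ
        obtain ⟨n, W, hW, rfl⟩ := (h.mem_nestedTwo_iff hP).1 hZ
        exact h.isFree_iff.2 (h1 n W hW)
    ext Z
    constructor
    · rintro ⟨h1, h2, h3, h4⟩
      obtain ⟨S, rfl⟩ := h.isSubcurve_iff.1 h1.1.1
      exact ⟨S, ⟨(h.isKTail_curve_iff hP (Or.inr rfl)).1 ⟨h1, h4⟩, (free S).1 h2,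
        h.union_subset_curve_iff.1 h3⟩, rfl⟩
    · rintro ⟨S, ⟨h1, h2, h3⟩, rfl⟩
      have := (h.isKTail_curve_iff hP (Or.inr rfl)).2 h1
      exact ⟨this.1, (free S).2 h2, h.union_subset_curve_iff.2 h3, this.2⟩
  rw [nestedThree, this]
  exact h.inNestedChain_iff (isMeetFamily_threeTails h.isConn (Set.insert_nonempty _ _))

lemma mem_nestedOne_iff {v : V} {Z : Set X} : Z ∈ nestedOne P (comp v) ↔
    ∃ S, vP ∉ S ∧ (cut s S).ncard = 1 ∧ v ∈ S ∧ curve comp S = Z := by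
  constructor
  · rintro ⟨h1, h2, h3⟩
    obtain ⟨S, rfl⟩ := h.isSubcurve_iff.1 h1.1.1
    obtain ⟨h4, h5⟩ := (h.isOneTail_curve_iff hP).1 ⟨h1, h3⟩
    exact ⟨S, h4, h5, h.comp_subset_curve_iff.1 h2, rfl⟩
  · rintro ⟨S, h1, h2, h3, rfl⟩
    obtain ⟨h4, h5⟩ := (h.isOneTail_curve_iff hP).2 ⟨h1, h2⟩
    exact ⟨h4, h.comp_subset_curve_iff.2 h3, h5⟩

lemma not_isTerminal_and {v w : V} {e f : E} (hef : e ≠ f)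
    (hq : (({node e, node f} : Set X) ∩ ⋃ W ∈ nestedTwo P (comp v) (comp w) ∪
      nestedThree P (comp v) (comp w), Term W).encard ≤ 1) :
    ¬ (IsTerminal s vP {v, w} e ∧ IsTerminal s vP {v, w} f) := by
  have mem : ∀ e, IsTerminal s vP {v, w} e → node e ∈ ⋃ W ∈ nestedTwo P (comp v) (comp w) ∪
      nestedThree P (comp v) (comp w), Term W := by
    rintro e ⟨n, W, hW, he⟩
    refine Set.mem_biUnion (x := curve comp W) ?_ ?_
    · rcases hW with hW | hW
      · exact Or.inl ((h.mem_nestedTwo_iff hP).2 ⟨n, W, hW, rfl⟩)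
      · exact Or.inr ((h.mem_nestedThree_iff hP).2 ⟨n, W, hW, rfl⟩)
    · rw [h.term_curve]
      exact ⟨e, he, rfl⟩
  rintro ⟨h1, h2⟩
  rw [Set.inter_eq_left.2 (by rintro x (rfl | rfl); exacts [mem e h1, mem f h2]),
    Set.encard_pair (h.node_injective.ne hef)] at hq
  exact absurd hq (by decide)

end IsDualGraph

end DualGraphOf

end DualGraph

/-! ### From interlaced chains to the synchronizing bijection. -/

namespace DualGraph

open AbelJacobi

section Synchronization

/-- A bijection from a family onto a disjoint union of three families of subsets, from three
injections with disjoint images. -/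
lemma exists_equiv_sum {X Y : Type u} {K : Fin 3 → Set (Set X)} {H : Set (Set Y)}
    (w : H → Set X) (g : ∀ i, K i → H) (hw : ∀ i a, w (g i a) = a.1)
    (hinj : ∀ i j a b, g i a = g j b → i = j) (hsurj : ∀ z, ∃ i a, g i a = z) :
    ∃ f : H ≃ K 0 ⊕ (K 1 ⊕ K 2), ∀ z, Sum.elim (fun a => a.1)
      (Sum.elim (fun a => a.1) fun a => a.1) (f z) = w z := by
  have inj : ∀ i, Function.Injective (g i) := fun i a b hab =>
    Subtype.ext (by rw [← hw i a, ← hw i b, hab])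
  have ne : ∀ i j, i ≠ j → ∀ a b, g i a ≠ g j b := fun i j hij a b hab => hij (hinj i j a b hab)
  let G : K 0 ⊕ (K 1 ⊕ K 2) → H := Sum.elim (g 0) (Sum.elim (g 1) (g 2))
  have hG : Function.Bijective G := by
    constructor
    · exact (inj 0).sumElim ((inj 1).sumElim (inj 2) (ne 1 2 (by decide)))
        (by rintro a (b | b); exacts [ne 0 1 (by decide) a b, ne 0 2 (by decide) a b])
    · intro z
      obtain ⟨i, a, rfl⟩ := hsurj z
      fin_cases i
      exacts [⟨Sum.inl a, rfl⟩, ⟨Sum.inr (Sum.inl a), rfl⟩, ⟨Sum.inr (Sum.inr a), rfl⟩]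
  refine ⟨(Equiv.ofBijective G hG).symm, fun z => ?_⟩
  obtain ⟨a, rfl⟩ := hG.2 z
  rw [show (Equiv.ofBijective G hG).symm (G a) = a from Equiv.ofBijective_symm_apply_apply _ _ _]
  rcases a with a | a | a <;> exact (hw _ a).symm

variable {V E : Type*} {X Y : Type u} [TopologicalSpace X] [TopologicalSpace Y]
  {s : E × Bool → V} {comp : V → Set X} {node : E → X}
  {comp' : V ⊕ (E × Bool) → Set Y} {node' : (E × Bool) ⊕ E → Y} {μ : Y → X}
  {P : X} {P' : Y} {vP : V} {d d₁ d₂ : E × Bool} {T : Set (V ⊕ (E × Bool))}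

variable (hX : IsDualGraph s comp node) (hY : IsDualGraph (sub s) comp' node')
  (hμl : ∀ v, μ '' comp' (Sum.inl v) = comp v) (hμr : ∀ d, μ '' comp' (Sum.inr d) = {node d.1})
  (hP : ∀ v, P ∈ comp v ↔ v = vP) (hP' : ∀ w, P' ∈ comp' w ↔ w = Sum.inl vP)

-- An exceptional component in T is contracted to a node of a component already in the base, by the
-- hypothesis on T, so it adds nothing to the image.
omit [TopologicalSpace Y] in
include hX hμl hμr in
lemma image_curve (hT : T ⊆ lift s 2 (base T)) : μ '' curve comp' T = curve comp (base T) := by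
  apply Set.Subset.antisymm
  · rintro _ ⟨y, hy, rfl⟩
    obtain ⟨v | d, hv, hy⟩ := mem_curve.1 hy
    · exact mem_curve.2 ⟨v, hv, hμl v ▸ Set.mem_image_of_mem μ hy⟩
    · have h1 : μ y = node d.1 := by
        have := Set.mem_image_of_mem μ hy
        rwa [hμr d] at this
      rw [h1]
      rcases inr_mem_lift_two.1 (hT hv) with h2 | h2
      · exact mem_curve.2 ⟨_, h2, hX.node_mem d⟩
      · exact mem_curve.2 ⟨_, h2, hX.node_mem (rev d)⟩
  · intro x hx
    obtain ⟨v, hv, hx⟩ := mem_curve.1 hx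
    rw [← hμl v] at hx
    obtain ⟨y, hy, rfl⟩ := hx
    exact ⟨y, mem_curve.2 ⟨_, hv, hy⟩, rfl⟩

variable [Finite V] [Finite E]

include hX hY hμl hμr in
/-- Interlaced chains give a bijection onto a disjoint union of chains. -/
lemma exists_equiv_of_isInterlaced {𝓜 : Set (Set (V ⊕ (E × Bool)))} {F : Fin 3 → Set (Set V)}
    (hi : IsInterlaced s 𝓜 F) {K : Fin 3 → Set (Set X)} {H : Set (Set Y)}
    (hK : ∀ i Z, Z ∈ K i ↔ ∃ n W, IsNth s (F i) n W ∧ curve comp W = Z)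
    (hH : ∀ Z, Z ∈ H ↔ ∃ n T, IsNth (sub s) 𝓜 n T ∧ curve comp' T = Z) :
    ∃ f : H ≃ K 0 ⊕ (K 1 ⊕ K 2), ∀ z, Sum.elim (fun a => a.1)
      (Sum.elim (fun a => a.1) fun a => a.1) (f z) = μ '' z.1 := by
  obtain ⟨σ, hσ⟩ := hi.exists_perm
  have img : ∀ {n T}, IsNth (sub s) 𝓜 n T → μ '' curve comp' T = curve comp (base T) :=
    fun hT => image_curve hX hμl hμr (hi.subset_lift _ hT.mem)
  have key : ∀ i (Z : K i), ∃ Q : H, ∃ n T, IsNth (sub s) 𝓜 (3 * n + (σ i).val) T ∧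
      curve comp (base T) = Z.1 ∧ curve comp' T = Q.1 := by
    rintro i ⟨Z, hZ⟩
    obtain ⟨n, W, hW, rfl⟩ := (hK i Z).1 hZ
    obtain ⟨T, hT, rfl⟩ := (hσ i n W).1 hW
    exact ⟨⟨_, (hH _).2 ⟨_, T, hT, rfl⟩⟩, n, T, hT, rfl, rfl⟩
  choose g hg using key
  refine exists_equiv_sum (fun z => μ '' z.1) g (fun i a => ?_) (fun i j a b hab => ?_) fun z => ?_
  · obtain ⟨n, T, hT, h1, h2⟩ := hg i a
    rw [← h2, ← h1, img hT]
  · obtain ⟨n, T, hT, -, h2⟩ := hg i a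
    obtain ⟨m, T', hT', -, h2'⟩ := hg j b
    obtain rfl : T = T' := hY.curve_injective (by rw [h2, h2', hab])
    have := hT.index_unique hT'
    exact σ.injective (Fin.ext (by have := (σ i).isLt; have := (σ j).isLt; omega))
  · obtain ⟨m, T, hT, hz⟩ := (hH _).1 z.2
    have hlt : m % 3 < 3 := Nat.mod_lt _ (by decide)
    have hm : 3 * (m / 3) + (σ (σ.symm ⟨m % 3, hlt⟩)).val = m := by
      rw [Equiv.apply_symm_apply]
      exact Nat.div_add_mod m 3
    have hW := (hσ (σ.symm ⟨m % 3, hlt⟩) (m / 3) (base T)).2 ⟨T, by rwa [hm], rfl⟩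
    refine ⟨_, ⟨_, (hK _ _).2 ⟨_, _, hW, rfl⟩⟩, Subtype.ext ?_⟩
    obtain ⟨n, T', hT', h1, h2⟩ := hg _ ⟨_, (hK _ _).2 ⟨_, _, hW, rfl⟩⟩
    have hW' := (hσ _ n _).2 ⟨T', hT', rfl⟩
    rw [hX.curve_injective h1] at hW'
    obtain rfl := hW.index_unique hW'
    rw [hm] at hT'
    rw [← h2, ← hz, hT.unique hT']

/-! ### The case of 1-tails. -/

section OneTails

omit [Finite V] [Finite E]

lemma isClean_of_ncard_cut (hT : (cut (sub s) T).ncard = 1) : IsClean s T := by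
  obtain ⟨g, hg⟩ := Set.ncard_eq_one.1 hT
  intro a ha b hb _
  rw [hg] at ha hb
  rw [Set.mem_singleton_iff.1 ha, Set.mem_singleton_iff.1 hb]

/-- The subsets with one outgoing edge in the subdivided graph are uniform lifts. -/
lemma exists_eq_lift (hT : (cut (sub s) T).ncard = 1) :
    ∃ p, T = lift s p (base T) ∧ (cut s (base T)).ncard = 1 := by
  have hc := isClean_of_ncard_cut hT
  have hb := hc.ncard_cut.symm.trans hT
  obtain ⟨e, he⟩ := Set.ncard_eq_one.1 hb
  obtain ⟨d, -, hd⟩ := exists_out_of_mem_cut (s := s) (S := base T) (e := e) (by rw [he]; rfl)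
  obtain ⟨p, hp, -⟩ := hc.exists_level hd
  refine ⟨p, eq_lift_of_level hc fun x hx => ?_, hb⟩
  have h1 := hx.mem_cut
  have h2 := hd.mem_cut
  rw [he] at h1 h2
  rwa [hx.unique hd (h1.trans h2.symm)]

lemma lift_inj {p q : Fin 3} {S S' : Set V} (hS : (cut s S).Nonempty)
    (h : lift s p S = lift s q S') : p = q ∧ S = S' := by
  have hb : S = S' := by
    have := congrArg base h
    rwa [base_lift, base_lift] at this
  subst hb
  refine ⟨?_, rfl⟩
  obtain ⟨e, he⟩ := hS
  obtain ⟨d, rfl, hd⟩ := exists_out_of_mem_cut he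
  have h1 := (pos_mem_cut_lift (q := p) hd).2 rfl
  rw [h] at h1
  exact (pos_mem_cut_lift hd).1 h1

end OneTails

variable [PreconnectedSpace X] [PreconnectedSpace Y]

include hX hY hμl hμr hP hP' in
lemma exists_equiv_nestedOne (d : E × Bool) :
    ∃ f : nestedOne P' (comp' (Sum.inr d)) ≃ nestedOne P (comp (s d)) ⊕
      (nestedOne P (comp (s d)) ⊕ nestedOne P (comp (s (rev d)))), ∀ z, Sum.elim (fun a => a.1)
      (Sum.elim (fun a => a.1) fun a => a.1) (f z) = μ '' z.1 := by
  classical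
  have memY : ∀ p S, curve comp' (lift s p S) ∈ nestedOne P' (comp' (Sum.inr d)) ↔
      vP ∉ S ∧ (cut s S).ncard = 1 ∧ Sum.inr d ∈ lift s p S := by
    intro p S
    rw [hY.mem_nestedOne_iff hP']
    constructor
    · rintro ⟨T, h1, h2, h3, h4⟩
      obtain rfl := hY.curve_injective h4
      rw [ncard_cut_lift] at h2
      exact ⟨h1, h2, h3⟩
    · rintro ⟨h1, h2, h3⟩
      exact ⟨_, h1, by rwa [ncard_cut_lift], h3, rfl⟩
  -- If S contains only the source of d, the new vertex lies in the lifts at positions 1 and 2,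
  -- matching the two copies for the source. If S contains only the target, it lies in the lift at
  -- 2. With both ends, position 0 is left for the target.
  let level : Fin 3 → Set V → Fin 3 := fun i S =>
    if i = 0 then 2 else if i = 1 then 1 else if s d ∈ S then 0 else 2
  let src : Fin 3 → V := fun i => if i = 2 then s (rev d) else s d
  have key : ∀ i (Z : nestedOne P (comp (src i))), ∃ Q : nestedOne P' (comp' (Sum.inr d)),
      ∃ S, src i ∈ S ∧ (cut s S).ncard = 1 ∧ curve comp S = Z.1 ∧
        curve comp' (lift s (level i S) S) = Q.1 := by
    rintro i ⟨Z, hZ⟩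
    obtain ⟨S, h1, h2, h3, rfl⟩ := (hX.mem_nestedOne_iff hP).1 hZ
    refine ⟨⟨_, (memY (level i S) S).2 ⟨h1, h2, ?_⟩⟩, S, h3, h2, rfl, rfl⟩
    fin_cases i
    · exact Or.inl h3
    · exact h3
    · have h3' : s (rev d) ∈ S := h3
      by_cases h4 : s d ∈ S <;> simp [level, h3', h4]
  choose g hg using key
  refine exists_equiv_sum (K := fun i => nestedOne P (comp (src i))) (fun z => μ '' z.1) g
    (fun i a => ?_) (fun i j a b hab => ?_) fun z => ?_
  · obtain ⟨S, -, -, h1, h2⟩ := hg i a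
    rw [← h2, ← h1, image_curve hX hμl hμr (by rw [base_lift]; exact lift_mono (Fin.le_last _)),
      base_lift]
  · obtain ⟨S, h0, h1, -, h2⟩ := hg i a
    obtain ⟨S', h0', -, -, h2'⟩ := hg j b
    have := hY.curve_injective (h2.trans ((congrArg Subtype.val hab).trans h2'.symm))
    obtain ⟨hl, rfl⟩ := lift_inj ((Set.ncard_pos).1 (by omega)) this
    fin_cases i <;> fin_cases j <;> simp [level, src] at hl h0 h0' ⊢ <;> simp_all
  · obtain ⟨T, h1, h2, h3, h4⟩ := (hY.mem_nestedOne_iff hP').1 z.2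
    obtain ⟨p, hp, hb⟩ := exists_eq_lift h2
    generalize base T = S at hp hb
    subst hp
    obtain ⟨i, hi, hl⟩ : ∃ i, src i ∈ S ∧ level i S = p := by
      fin_cases p
      · have h5 : s d ∈ S ∧ s (rev d) ∈ S := h3
        exact ⟨2, h5.2, if_pos h5.1⟩
      · exact ⟨1, h3, rfl⟩
      · by_cases h5 : s d ∈ S
        · exact ⟨0, h5, rfl⟩
        · exact ⟨2, (inr_mem_lift_two.1 h3).resolve_left h5, if_neg h5⟩
    refine ⟨i, ⟨curve comp S, (hX.mem_nestedOne_iff hP).2 ⟨S, h1, hb, hi, rfl⟩⟩, Subtype.ext ?_⟩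
    obtain ⟨S', -, -, h5, h6⟩ := hg i
      ⟨curve comp S, (hX.mem_nestedOne_iff hP).2 ⟨S, h1, hb, hi, rfl⟩⟩
    obtain rfl := hX.curve_injective h5
    rw [← h6, ← h4, hl]

include hX hY hμl hμr hP hP' in
/-- Synchronization, for spaces with a dual graph. -/
theorem isSynchronizedAt (h12 : d₁.1 ≠ d₂.1)
    (hq : IsQuasistable P (node d₁.1) (node d₂.1) (comp (s d₁)) (comp (s (rev d₁)))
      (comp (s d₂)) (comp (s (rev d₂)))) :
    ∀ k ∈ ({1, 2, 3} : Set ℕ), IsSynchronizedAt μ P' (comp' (Sum.inr d₁)) (comp' (Sum.inr d₂)) P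
      (comp (s d₁)) (comp (s (rev d₁))) (comp (s d₂)) (comp (s (rev d₂))) k := by
  have hA := hX.not_isTerminal_and hP h12 hq.1
  have hC := hX.not_isTerminal_and hP h12 hq.2
  rintro k (rfl | rfl | rfl)
  · obtain ⟨f₁, h₁⟩ := exists_equiv_nestedOne hX hY hμl hμr hP hP' d₁
    obtain ⟨f₂, h₂⟩ := exists_equiv_nestedOne hX hY hμl hμr hP hP' d₂
    -- Each source component occurs in two of the three pairs and each target component in one, so
    -- the six summands only need regrouping.
    let r : ∀ (a a' b b' : Type u), (a ⊕ (a ⊕ a')) ⊕ (b ⊕ (b ⊕ b')) ≃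
        (a ⊕ b) ⊕ ((a ⊕ b') ⊕ (a' ⊕ b)) := fun a a' b b' =>
      { toFun := fun
          | Sum.inl (Sum.inl x) => Sum.inl (Sum.inl x)
          | Sum.inl (Sum.inr (Sum.inl x)) => Sum.inr (Sum.inl (Sum.inl x))
          | Sum.inl (Sum.inr (Sum.inr x)) => Sum.inr (Sum.inr (Sum.inl x))
          | Sum.inr (Sum.inl x) => Sum.inl (Sum.inr x)
          | Sum.inr (Sum.inr (Sum.inl x)) => Sum.inr (Sum.inr (Sum.inr x))
          | Sum.inr (Sum.inr (Sum.inr x)) => Sum.inr (Sum.inl (Sum.inr x))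
        invFun := fun
          | Sum.inl (Sum.inl x) => Sum.inl (Sum.inl x)
          | Sum.inr (Sum.inl (Sum.inl x)) => Sum.inl (Sum.inr (Sum.inl x))
          | Sum.inr (Sum.inr (Sum.inl x)) => Sum.inl (Sum.inr (Sum.inr x))
          | Sum.inl (Sum.inr x) => Sum.inr (Sum.inl x)
          | Sum.inr (Sum.inr (Sum.inr x)) => Sum.inr (Sum.inr (Sum.inl x))
          | Sum.inr (Sum.inl (Sum.inr x)) => Sum.inr (Sum.inr (Sum.inr x))
        left_inv := by rintro ((x | x | x) | (x | x | x)) <;> rfl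
        right_inv := by rintro ((x | x) | ((x | x) | (x | x))) <;> rfl }
    refine ⟨(Equiv.sumCongr f₁ f₂).trans (r _ _ _ _), ?_⟩
    rintro (z | z)
    · refine Eq.trans ?_ (h₁ z)
      change NestedTailA.tail (P := P) (D₁ := comp (s d₁)) (D₁' := comp (s (rev d₁)))
        (D₂ := comp (s d₂)) (D₂' := comp (s (rev d₂))) (s := 1) (r _ _ _ _ (Sum.inl (f₁ z))) = _
      rcases f₁ z with a | a | a <;> rfl
    · refine Eq.trans ?_ (h₂ z)
      change NestedTailA.tail (P := P) (D₁ := comp (s d₁)) (D₁' := comp (s (rev d₁)))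
        (D₂ := comp (s d₂)) (D₂' := comp (s (rev d₂))) (s := 1) (r _ _ _ _ (Sum.inr (f₂ z))) = _
      rcases f₂ z with a | a | a <;> rfl
  · obtain ⟨f, hf⟩ := exists_equiv_of_isInterlaced hX hY hμl hμr
      (isInterlaced_twoTails hX.isConn h12 hA hC)
      (K := fun i => match i with
        | 0 => nestedTwo P (comp (s d₁)) (comp (s d₂))
        | 1 => nestedTwo P (comp (s d₁)) (comp (s (rev d₂)))
        | 2 => nestedTwo P (comp (s (rev d₁))) (comp (s d₂)))
      (H := nestedTwo P' (comp' (Sum.inr d₁)) (comp' (Sum.inr d₂)))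
      (fun i Z => by fin_cases i <;> exact hX.mem_nestedTwo_iff hP)
      (fun Z => hY.mem_nestedTwo_iff hP')
    refine ⟨f, fun z => ?_⟩
    refine Eq.trans ?_ (hf z)
    rcases f z with a | a | a <;> rfl
  · obtain ⟨f, hf⟩ := exists_equiv_of_isInterlaced hX hY hμl hμr
      (isInterlaced_threeTails hX.isConn h12 hA hC)
      (K := fun i => match i with
        | 0 => nestedThree P (comp (s d₁)) (comp (s d₂))
        | 1 => nestedThree P (comp (s d₁)) (comp (s (rev d₂)))
        | 2 => nestedThree P (comp (s (rev d₁))) (comp (s d₂)))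
      (H := nestedThree P' (comp' (Sum.inr d₁)) (comp' (Sum.inr d₂)))
      (fun i Z => by fin_cases i <;> exact hX.mem_nestedThree_iff hP)
      (fun Z => hY.mem_nestedThree_iff hP')
    refine ⟨f, fun z => ?_⟩
    refine Eq.trans ?_ (hf z)
    rcases f z with a | a | a <;> rfl

end Synchronization

end DualGraph

/-! ### Minimal primes of the local rings of a nodal curve -/

section LocalAlgebra

lemma MvPowerSeries.prime_X {σ K : Type*} [Field K] (i : σ) :
    Prime (MvPowerSeries.X i : MvPowerSeries σ K) := by
  classical
  refine ⟨?_, ?_, ?_⟩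
  · intro h
    have := congrArg (MvPowerSeries.coeff (Finsupp.single i 1)) h
    rw [MvPowerSeries.coeff_index_single_self_X, map_zero] at this
    exact one_ne_zero this
  · intro h
    have := h.map (MvPowerSeries.constantCoeff (σ := σ) (R := K))
    rw [MvPowerSeries.constantCoeff_X] at this
    exact not_isUnit_zero this
  · intro f g hfg
    -- Dropping the multiples of the variable reduces the claim to the domain property: the product
    -- of two truncations involves no such multiple, so it vanishes as soon as the variable divides
    -- it.
    let trunc : MvPowerSeries σ K → MvPowerSeries σ K := fun f m => if m i = 0 then f m else 0
    have coeff_trunc : ∀ f m, MvPowerSeries.coeff m (trunc f) =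
        if m i = 0 then MvPowerSeries.coeff m f else 0 := fun f m => rfl
    have dvd : ∀ f, MvPowerSeries.X i ∣ f - trunc f := by
      intro f
      rw [MvPowerSeries.X_dvd_iff]
      intro m hm
      rw [map_sub, coeff_trunc, if_pos hm, sub_self]
    have h0 : trunc f * trunc g = 0 := by
      ext m
      rw [map_zero]
      by_cases hm : m i = 0
      · have h1 : MvPowerSeries.X i ∣ trunc f * trunc g := by
          have e : trunc f * trunc g = f * g - (f - trunc f) * g - trunc f * (g - trunc g) := by ring
          rw [e]
          exact dvd_sub (dvd_sub hfg ((dvd f).mul_right g)) ((dvd g).mul_left _)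
        exact MvPowerSeries.X_dvd_iff.1 h1 m hm
      · rw [MvPowerSeries.coeff_mul]
        refine Finset.sum_eq_zero fun x hx => ?_
        rw [Finset.HasAntidiagonal.mem_antidiagonal] at hx
        rw [coeff_trunc, coeff_trunc]
        have : x.1 i + x.2 i = m i := by rw [← hx]; rfl
        by_cases h1 : x.1 i = 0
        · rw [if_neg (show x.2 i ≠ 0 by omega), mul_zero]
        · rw [if_neg h1, zero_mul]
    rcases mul_eq_zero.1 h0 with h1 | h1
    · left
      have := dvd f
      rwa [h1, sub_zero] at this
    · right
      have := dvd g
      rwa [h1, sub_zero] at this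

variable (K : Type*) [Field K]

/-- The completed local ring of a node. -/
abbrev NodeRing : Type _ := MvPowerSeries (Fin 2) K ⧸
  Ideal.span {(MvPowerSeries.X 0 * MvPowerSeries.X 1 : MvPowerSeries (Fin 2) K)}

/-- The two branches x = 0 and y = 0: every prime contains xy, hence x or y. -/
lemma NodeRing.exists_primes : ∃ q : Fin 2 → Ideal (NodeRing K), (∀ i, (q i).IsPrime) ∧
    ∀ p : Ideal (NodeRing K), p.IsPrime → ∃ i, q i ≤ p := by
  let mk := Ideal.Quotient.mk
    (Ideal.span {(MvPowerSeries.X 0 * MvPowerSeries.X 1 : MvPowerSeries (Fin 2) K)})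
  have hprime : ∀ i : Fin 2, (Ideal.span {(MvPowerSeries.X i : MvPowerSeries (Fin 2) K)}).IsPrime :=
    fun i => (Ideal.span_singleton_prime (MvPowerSeries.prime_X i).ne_zero).2
      (MvPowerSeries.prime_X i)
  refine ⟨fun i => (Ideal.span {(MvPowerSeries.X i : MvPowerSeries (Fin 2) K)}).map mk,
    fun i => ?_, fun p hp => ?_⟩
  · have := hprime i
    refine Ideal.map_isPrime_of_surjective Ideal.Quotient.mk_surjective ?_
    rw [Ideal.mk_ker, Ideal.span_singleton_le_span_singleton]
    fin_cases i
    · exact Dvd.intro _ rfl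
    · exact Dvd.intro_left _ rfl
  · have h0 : mk (MvPowerSeries.X 0) * mk (MvPowerSeries.X 1) ∈ p := by
      rw [← map_mul, Ideal.Quotient.eq_zero_iff_mem.2 (Ideal.mem_span_singleton_self _)]
      exact p.zero_mem
    rcases hp.mem_or_mem h0 with h1 | h1
    · refine ⟨0, ?_⟩
      beta_reduce
      rwa [Ideal.map_span, Set.image_singleton, Ideal.span_singleton_le_iff_mem]
    · refine ⟨1, ?_⟩
      beta_reduce
      rwa [Ideal.map_span, Set.image_singleton, Ideal.span_singleton_le_iff_mem]

lemma NodeRing.not_isDomain : ¬ IsDomain (NodeRing K) := by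
  intro h
  have hne : ∀ i j : Fin 2, ∀ _ : MvPowerSeries.X i * MvPowerSeries.X j =
      (MvPowerSeries.X 0 * MvPowerSeries.X 1 : MvPowerSeries (Fin 2) K),
      (Ideal.Quotient.mk (Ideal.span {(MvPowerSeries.X 0 * MvPowerSeries.X 1 :
        MvPowerSeries (Fin 2) K)}) (MvPowerSeries.X i)) ≠ 0 := by
    intro i j hij h0
    rw [Ideal.Quotient.eq_zero_iff_mem, Ideal.mem_span_singleton, ← hij] at h0
    obtain ⟨c, hc⟩ := h0
    have h1 : (MvPowerSeries.X j : MvPowerSeries (Fin 2) K) * c = 1 := by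
      refine mul_left_cancel₀ (MvPowerSeries.prime_X i).ne_zero ?_
      rw [mul_one, ← mul_assoc, ← hc]
    exact (MvPowerSeries.prime_X j).not_isUnit (IsUnit.of_mul_eq_one _ h1)
  have h0 := Ideal.Quotient.eq_zero_iff_mem.2 (Ideal.mem_span_singleton_self
    (MvPowerSeries.X 0 * MvPowerSeries.X 1 : MvPowerSeries (Fin 2) K))
  rw [map_mul] at h0
  rcases mul_eq_zero.1 h0 with h1 | h1
  · exact hne 0 1 rfl h1
  · exact hne 1 0 (mul_comm _ _) h1

end LocalAlgebra

/-! ### Components through smooth points and nodes. -/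

namespace AbelJacobi

section Components

variable {K : Type u} [Field K] {X : Scheme.{u}} {x : X}

/-- The irreducible components through a point correspond to minimal primes of the local
ring. -/
lemma exists_minimalPrime {Z : Set X} (hZ : Z ∈ irreducibleComponents X) (hx : x ∈ Z) :
    ∃ p : PrimeSpectrum (X.presheaf.stalk x), p.asIdeal ∈ minimalPrimes (X.presheaf.stalk x) ∧
      closure {X.fromSpecStalk x p} = Z := by
  have hgen := hZ.1.isGenericPoint_genericPoint (isClosed_of_mem_irreducibleComponents Z hZ)
  set η := hZ.1.genericPoint
  have hη : η ⤳ x := by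
    rw [specializes_iff_mem_closure, hgen.def]
    exact hx
  obtain ⟨p, hp⟩ : η ∈ Set.range (X.fromSpecStalk x) := by
    rw [Scheme.range_fromSpecStalk]
    exact hη
  refine ⟨p, ⟨⟨p.2, bot_le⟩, ?_⟩, by rw [hp]; exact hgen.def⟩
  rintro q ⟨hq, -⟩ hqp
  have h1 : (⟨q, hq⟩ : PrimeSpectrum (X.presheaf.stalk x)) ⤳ p :=
    (PrimeSpectrum.le_iff_specializes _ _).1 hqp
  have h2 := h1.map (X.fromSpecStalk x).continuous
  rw [hp, specializes_iff_closure_subset, hgen.def] at h2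
  have h3 : closure {X.fromSpecStalk x ⟨q, hq⟩} = closure {η} := by
    rw [hgen.def]
    exact Set.Subset.antisymm (hZ.2 (isIrreducible_singleton.closure) h2) h2
  have h4 : X.fromSpecStalk x ⟨q, hq⟩ = X.fromSpecStalk x p := by
    rw [hp]
    exact (inseparable_iff_closure_eq.2 h3).eq
  have h5 := (X.fromSpecStalk x).isEmbedding.injective h4
  rw [← h5]

lemma IsSmoothPoint.not_isNode (hx : IsSmoothPoint K x) : ¬ IsNode K x := by
  rintro ⟨-, ⟨e'⟩⟩
  obtain ⟨-, ⟨e⟩⟩ := hx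
  exact NodeRing.not_isDomain K ((e'.symm.trans e).toMulEquiv.isDomain _)

variable [IsLocallyNoetherian X]

lemma injective_completion : Function.Injective
    (algebraMap (X.presheaf.stalk x) (completedStalk x)) :=
  AdicCompletion.of_injective _ _

/-- A minimal prime is the contraction of a prime along an injection. Replacing that prime by some
`q i` below it changes nothing, by minimality. -/
lemma _root_.Ideal.comap_mem_or_of_forall_le {R S : Type*} [CommRing R] [CommRing S] {f : R →+* S}
    (hf : Function.Injective f) {q : Fin 2 → Ideal S} (hq : ∀ i, (q i).IsPrime)
    (hle : ∀ p : Ideal S, p.IsPrime → ∃ i, q i ≤ p) {p : Ideal R} (hp : p ∈ minimalPrimes R) :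
    ∃ i, (q i).comap f = p := by
  obtain ⟨p', hp', rfl⟩ := Ideal.exists_comap_eq_of_mem_minimalPrimes_of_injective hf p hp
  obtain ⟨i, hi⟩ := hle p' hp'
  have := hq i
  exact ⟨i, (Ideal.comap_mono hi).antisymm (hp.2 ⟨inferInstance, bot_le⟩ (Ideal.comap_mono hi))⟩

/-- At most two components pass through a node. -/
lemma IsNode.eq_or_eq (hx : IsNode K x) {Z : Fin 3 → Set X}
    (hZ : ∀ i, Z i ∈ irreducibleComponents X) (hxZ : ∀ i, x ∈ Z i) : ∃ i j, i ≠ j ∧ Z i = Z j := by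
  obtain ⟨e⟩ := hx.2
  obtain ⟨q, hq, hle⟩ := NodeRing.exists_primes K
  have hf : Function.Injective ((e : completedStalk x →+* NodeRing K).comp
      (algebraMap (X.presheaf.stalk x) (completedStalk x))) := by
    rw [RingHom.coe_comp]
    exact e.injective.comp injective_completion
  choose p hp hpZ using fun i => exists_minimalPrime (hZ i) (hxZ i)
  choose k hk using fun i => Ideal.comap_mem_or_of_forall_le hf hq hle (hp i)
  -- Three components and two branches: two components have the same minimal prime.
  obtain ⟨i, j, hij, h⟩ := Fintype.exists_ne_map_eq_of_card_lt k (by simp)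
  refine ⟨i, j, hij, ?_⟩
  rw [← hpZ i, ← hpZ j, PrimeSpectrum.ext ((hk i).symm.trans ((h ▸ rfl : _ = _).trans (hk j)))]

/-- A smooth point lies on one component only. -/
lemma IsSmoothPoint.eq (hx : IsSmoothPoint K x) {Z Z' : Set X}
    (hZ : Z ∈ irreducibleComponents X) (hZ' : Z' ∈ irreducibleComponents X) (hxZ : x ∈ Z)
    (hxZ' : x ∈ Z') : Z = Z' := by
  obtain ⟨e⟩ := hx.2
  have hf : Function.Injective ((e : completedStalk x →+* K⟦X⟧).comp
      (algebraMap (X.presheaf.stalk x) (completedStalk x))) := by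
    rw [RingHom.coe_comp]
    exact e.injective.comp injective_completion
  obtain ⟨p, hp, rfl⟩ := exists_minimalPrime hZ hxZ
  obtain ⟨p', hp', rfl⟩ := exists_minimalPrime hZ' hxZ'
  obtain ⟨_, hi⟩ := Ideal.comap_mem_or_of_forall_le hf (q := fun _ => ⊥)
    (fun _ => Ideal.isPrime_bot) (fun _ _ => ⟨0, bot_le⟩) hp
  obtain ⟨_, hi'⟩ := Ideal.comap_mem_or_of_forall_le hf (q := fun _ => ⊥)
    (fun _ => Ideal.isPrime_bot) (fun _ _ => ⟨0, bot_le⟩) hp'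
  rw [PrimeSpectrum.ext (hi.symm.trans hi')]

end Components

section Curve

variable {K : Type u} [Field K] {C : Scheme.{u}} {p : C ⟶ Spec (.of K)}

lemma IsNodalCurve.isNoetherian (h : IsNodalCurve K p) : IsNoetherian C := by
  have := h.proper
  have : IsLocallyNoetherian C := LocallyOfFiniteType.isLocallyNoetherian p
  have : CompactSpace C := QuasiCompact.compactSpace_of_compactSpace p
  exact {}

lemma IsNodalCurve.finite_irreducibleComponents (h : IsNodalCurve K p) :
    (irreducibleComponents C).Finite :=
  have := h.isNoetherian
  finite_irreducibleComponents_of_isNoetherian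

/-- A point on two components is closed. -/
lemma IsNodalCurve.isClosed_of_mem (h : IsNodalCurve K p) {Z Z' : Set C} {x : C}
    (hZ : Z ∈ irreducibleComponents C) (hZ' : Z' ∈ irreducibleComponents C) (hne : Z ≠ Z')
    (hx : x ∈ Z) (hx' : x ∈ Z') : IsClosed ({x} : Set C) := by
  by_contra hcl
  obtain ⟨y, hy, hyx⟩ : ∃ y ∈ closure {x}, y ≠ x := by
    by_contra! hcon
    refine hcl (isClosed_of_closure_subset fun y hy => hcon y hy)
  have hcZ := isClosed_of_mem_irreducibleComponents Z hZ
  let a : IrreducibleCloseds C := ⟨closure {y}, isIrreducible_singleton.closure, isClosed_closure⟩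
  let b : IrreducibleCloseds C := ⟨closure {x}, isIrreducible_singleton.closure, isClosed_closure⟩
  let c : IrreducibleCloseds C := ⟨Z, hZ.1, hcZ⟩
  have hab : a < b := by
    refine lt_of_le_of_ne (closure_minimal (Set.singleton_subset_iff.2 hy) isClosed_closure) ?_
    intro e
    have e' : closure {y} = closure {x} := congrArg IrreducibleCloseds.carrier e
    exact hyx (inseparable_iff_closure_eq.2 e').eq
  have hbc : b < c := by
    refine lt_of_le_of_ne (closure_minimal (Set.singleton_subset_iff.2 hx) hcZ) ?_
    intro e
    have e' : closure {x} = Z := congrArg IrreducibleCloseds.carrier e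
    have hsub : Z ⊆ Z' := e' ▸ closure_minimal (Set.singleton_subset_iff.2 hx')
      (isClosed_of_mem_irreducibleComponents Z' hZ')
    exact hne (hsub.antisymm (hZ.2 hZ'.1 hsub))
  -- A non-closed point on two components gives a chain of three irreducible closed sets, too long
  -- for dimension one.
  let l : LTSeries (IrreducibleCloseds C) :=
    { length := 2, toFun := ![a, b, c], step := fun i => by fin_cases i; exacts [hab, hbc] }
  have h1 := Order.LTSeries.length_le_krullDim l
  have h2 : Order.krullDim (IrreducibleCloseds C) = 1 := h.dim_eq_one
  rw [h2] at h1
  exact absurd h1 (by simp [l])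

lemma IsNodalCurve.isNode_of_mem (h : IsNodalCurve K p) {Z Z' : Set C} {x : C}
    (hZ : Z ∈ irreducibleComponents C) (hZ' : Z' ∈ irreducibleComponents C) (hne : Z ≠ Z')
    (hx : x ∈ Z) (hx' : x ∈ Z') : IsNode K x := by
  have := h.isNoetherian
  refine (h.smooth_or_node x (h.isClosed_of_mem hZ hZ' hne hx hx')).resolve_left fun hs => ?_
  exact hne (hs.eq hZ hZ' hx hx')

/-- At most two components pass through a point. -/
lemma IsNodalCurve.eq_or_eq (h : IsNodalCurve K p) {Z₀ Z₁ Z₂ : Set C} {x : C}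
    (h₀ : Z₀ ∈ irreducibleComponents C) (h₁ : Z₁ ∈ irreducibleComponents C)
    (h₂ : Z₂ ∈ irreducibleComponents C) (hx₀ : x ∈ Z₀) (hx₁ : x ∈ Z₁) (hx₂ : x ∈ Z₂)
    (h01 : Z₀ ≠ Z₁) : Z₂ = Z₀ ∨ Z₂ = Z₁ := by
  have := h.isNoetherian
  obtain ⟨i, j, hij, he⟩ := (h.isNode_of_mem h₀ h₁ h01 hx₀ hx₁).eq_or_eq (Z := ![Z₀, Z₁, Z₂])
    (by intro i; fin_cases i <;> assumption) (by intro i; fin_cases i <;> assumption)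
  fin_cases i <;> fin_cases j <;> simp at hij he <;> grind

end Curve

end AbelJacobi

/-! ### Irreducible components and generic points -/

section Topology

variable {X : Type*} [TopologicalSpace X]

lemma IsClosed.finite_of_forall_isClosed_singleton [NoetherianSpace X] [QuasiSober X] {S : Set X}
    (hS : IsClosed S) (h : ∀ x ∈ S, IsClosed ({x} : Set X)) : S.Finite := by
  obtain ⟨F, hF, hcl, hirr, rfl⟩ := NoetherianSpace.exists_finite_set_isClosed_irreducible hS
  refine hF.sUnion fun Z hZ => ?_
  have hgen := (hirr Z hZ).isGenericPoint_genericPoint (hcl Z hZ)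
  have hmem := h _ (Set.mem_sUnion_of_mem hgen.mem hZ)
  rw [← hgen.def, hmem.closure_eq]
  exact Set.finite_singleton _

lemma exists_irreducibleComponent_of_mem_closure_compl (hfin : (irreducibleComponents X).Finite)
    {A : Set X} {x : X} (hx : x ∈ closure Aᶜ) :
    ∃ W ∈ irreducibleComponents X, x ∈ W ∧ ¬ W ⊆ A := by
  have hcl : IsClosed (⋃₀ {W | W ∈ irreducibleComponents X ∧ ¬ W ⊆ A}) :=
    Set.sUnion_eq_biUnion ▸ (hfin.subset fun W (hW : _ ∧ _) => hW.1).isClosed_biUnion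
      fun W hW => isClosed_of_mem_irreducibleComponents W hW.1
  have hsub : Aᶜ ⊆ ⋃₀ {W | W ∈ irreducibleComponents X ∧ ¬ W ⊆ A} := fun y hy =>
    ⟨irreducibleComponent y, ⟨irreducibleComponent_mem_irreducibleComponents y,
      fun h => hy (h mem_irreducibleComponent)⟩, mem_irreducibleComponent⟩
  obtain ⟨W, ⟨hW, hWA⟩, hxW⟩ := closure_minimal hsub hcl hx
  exact ⟨W, hW, hxW, hWA⟩

lemma eq_of_subset_of_mem_irreducibleComponents {Z W : Set X} (hZ : Z ∈ irreducibleComponents X)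
    (hW : W ∈ irreducibleComponents X) (h : Z ⊆ W) : Z = W :=
  h.antisymm (hZ.2 hW.1 h)

end Topology

namespace AbelJacobi

/-! ### The components of `C(2)` -/

section Contraction

variable {K : Type u} [Field K] {C X : Scheme.{u}} {p : C ⟶ Spec (.of K)}
  {q : X ⟶ Spec (.of K)} {μ : X ⟶ C}

lemma IsContraction.finite_nodes (h : IsContraction K p q μ) (hC : IsNodalCurve K p) :
    {x : C | IsNode K x}.Finite := by
  have := hC.isNoetherian
  obtain ⟨U, hU, -⟩ := h.iso_smooth
  refine IsClosed.finite_of_forall_isClosed_singleton ⟨?_⟩ fun x hx => hx.1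
  rw [← hU]
  exact U.isOpen

lemma IsContraction.isClosedMap (h : IsContraction K p q μ) (hC : IsNodalCurve K p) :
    IsClosedMap μ := by
  have := hC.proper
  have : IsProper (μ ≫ p) := h.comp_eq ▸ h.curve.proper
  have := IsProper.of_comp μ p
  exact μ.isClosedMap

lemma bijective_restrictPreimage {U : C.Opens} (hU : IsIso (μ ∣_ U)) :
    Topology.IsInducing (U.1.restrictPreimage μ) ∧
      Function.Bijective (U.1.restrictPreimage μ) := by
  rw [← morphismRestrict_base]
  exact ⟨(Scheme.homeoOfIso (asIso (μ ∣_ U))).isInducing,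
    (Scheme.homeoOfIso (asIso (μ ∣_ U))).bijective⟩

/-- Away from the nodes μ is a homeomorphism onto the smooth locus, so specializations lift. -/
lemma IsContraction.specializes (h : IsContraction K p q μ) {y y' : X}
    (hy : ¬ IsNode K (μ y)) (hy' : ¬ IsNode K (μ y')) (hs : μ y ⤳ μ y') : y ⤳ y' := by
  obtain ⟨U, hU, hiso⟩ := h.iso_smooth
  have hmem : ∀ x : C, x ∈ U.1 ↔ ¬ IsNode K x := fun x => by
    change x ∈ (U : Set C) ↔ _
    rw [hU]
    rfl
  have h1 := (bijective_restrictPreimage hiso).1.specializes_iff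
    (x := ⟨y, (hmem _).2 hy⟩) (y := ⟨y', (hmem _).2 hy'⟩)
  exact (h1.1 ((subtype_specializes_iff _ _).2 hs)).map continuous_subtype_val

lemma IsContraction.eq_of_eq (h : IsContraction K p q μ) {y y' : X}
    (hy : ¬ IsNode K (μ y)) (hs : μ y = μ y') : y = y' :=
  ((h.specializes hy (hs ▸ hy) (specializes_of_eq hs)).antisymm
    (h.specializes (hs ▸ hy) hy (specializes_of_eq hs.symm))).eq

lemma IsContraction.surjective (h : IsContraction K p q μ) : Function.Surjective μ := by
  intro x
  by_cases hx : IsNode K x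
  · obtain ⟨E, E', hE, -, -, -, hEE', -⟩ := h.chain x hx
    obtain ⟨y, hy⟩ := hE.1.1
    exact ⟨y, hEE'.ge (Or.inl hy)⟩
  · obtain ⟨U, hU, hiso⟩ := h.iso_smooth
    obtain ⟨y, hy⟩ := (bijective_restrictPreimage hiso).2.2 ⟨x, hU.ge hx⟩
    exact ⟨y, congrArg Subtype.val hy⟩

variable (K) in
/-- A choice, over every node `S` of `C`, of the two exceptional components `E (S, b)`, of the point
`z₀ S` where they meet, of the point `z₁ (S, b)` where `E (S, b)` meets the rest of the curve, and
of the component `s (S, b)` of `C` whose strict transform passes through this point. -/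
structure IsChainSystem (μ : X ⟶ C) (E : {x : C // IsNode K x} × Bool → Set X)
    (z₀ : {x : C // IsNode K x} → X) (z₁ : {x : C // IsNode K x} × Bool → X)
    (s : {x : C // IsNode K x} × Bool → irreducibleComponents C) : Prop where
  mem : ∀ d, E d ∈ irreducibleComponents X
  preimage : ∀ S, μ ⁻¹' {S.1} = E (S, false) ∪ E (S, true)
  ne : ∀ S, E (S, false) ≠ E (S, true)
  inter : ∀ S, E (S, false) ∩ E (S, true) = {z₀ S}
  inter_closure : ∀ d, E d ∩ closure (μ ⁻¹' {d.1.1})ᶜ = {z₁ d}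
  mem_strict : ∀ d, z₁ d ∈ strictTransform μ (s d : Set C)

/-- An exceptional component is not a point. -/
lemma IsContraction.not_subsingleton (h : IsContraction K p q μ) {S : C} {E : Set X} {z : X}
    (hE : E ∈ irreducibleComponents X) (hES : E ⊆ μ ⁻¹' {S})
    (hz : E ∩ closure (μ ⁻¹' {S})ᶜ = {z}) : ¬ E.Subsingleton := by
  intro hs
  have hz' : z ∈ E ∩ closure (μ ⁻¹' {S})ᶜ := hz ▸ rfl
  obtain ⟨W, hW, hzW, hWS⟩ := exists_irreducibleComponent_of_mem_closure_compl
    h.curve.finite_irreducibleComponents hz'.2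
  have hEW : E = W := eq_of_subset_of_mem_irreducibleComponents hE hW fun y hy =>
    hs hz'.1 hy ▸ hzW
  exact hWS (hEW ▸ hES)

/-- Over a node the fibre contains a component with more than one point, so μ is not injective over
any neighbourhood of the node. -/
lemma IsContraction.coe_isoLocus (h : IsContraction K p q μ) :
    (isoLocus μ : Set C) = {x | IsNode K x}ᶜ := by
  obtain ⟨U, hU, hiso⟩ := h.iso_smooth
  refine Set.Subset.antisymm (fun x hx hn => ?_) ?_
  · obtain ⟨V, hV, hxV⟩ := Opens.mem_sSup.1 hx
    obtain ⟨E, E', hE, -, -, -, hEE', -, ⟨z, hz⟩, -⟩ := h.chain x hn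
    have hES : E ⊆ μ ⁻¹' {x} := hEE' ▸ Set.subset_union_left
    refine h.not_subsingleton hE hES hz fun y hy y' hy' => ?_
    have e : μ y = x := hES hy
    have e' : μ y' = x := hES hy'
    have h1 := (bijective_restrictPreimage hV).2.1
      (a₁ := ⟨y, show μ y ∈ V.1 from e ▸ hxV⟩) (a₂ := ⟨y', show μ y' ∈ V.1 from e' ▸ hxV⟩)
      (Subtype.ext (e.trans e'.symm))
    exact congrArg Subtype.val h1
  · rw [← hU]
    exact SetLike.coe_subset_coe.2 (le_sSup (show U ∈ {U : C.Opens | IsIso (μ ∣_ U)} from hiso))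

/-- The generic point of a component of `C` is not a node. -/
lemma IsContraction.exists_generic (h : IsContraction K p q μ) (hC : IsNodalCurve K p) {D : Set C}
    (hD : D ∈ irreducibleComponents C) : ∃ η : X, ¬ IsNode K (μ η) ∧ closure {μ η} = D := by
  have hgen := hD.1.isGenericPoint_genericPoint (isClosed_of_mem_irreducibleComponents D hD)
  obtain ⟨η, hη⟩ := h.surjective hD.1.genericPoint
  refine ⟨η, fun hn => ?_, by rw [hη, hgen.def]⟩
  obtain ⟨E, E', hE, -, -, -, hEE', -, ⟨z, hz⟩, -⟩ := h.chain _ hn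
  have hz' : z ∈ E ∩ closure (μ ⁻¹' {μ η})ᶜ := hz ▸ rfl
  have hzη : μ z = μ η := hEE'.ge (Or.inl hz'.1)
  have hcl : μ η ∈ closure ({μ η} : Set C)ᶜ := by
    have h1 := image_closure_subset_closure_image μ.continuous (Set.mem_image_of_mem μ hz'.2)
    rw [hzη] at h1
    refine closure_mono ?_ h1
    rintro _ ⟨y, hy, rfl⟩
    exact hy
  obtain ⟨W, hW, hxW, hWη⟩ := exists_irreducibleComponent_of_mem_closure_compl
    hC.finite_irreducibleComponents hcl
  have hDη : D = {μ η} := by rw [← hgen.def, ← hη, hn.1.closure_eq]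
  have hDW : D = W := eq_of_subset_of_mem_irreducibleComponents hD hW
    (hDη ▸ Set.singleton_subset_iff.2 hxW)
  exact hWη (hDW ▸ hDη.le)

lemma IsContraction.strictTransform_eq (h : IsContraction K p q μ) {η : X}
    (hη : ¬ IsNode K (μ η)) : strictTransform μ (closure {μ η}) = closure {η} := by
  rw [strictTransform, h.coe_isoLocus]
  refine Set.Subset.antisymm (closure_minimal ?_ isClosed_closure) (closure_mono ?_)
  · rintro y ⟨hy, hyn⟩
    exact (h.specializes hη hyn (specializes_iff_mem_closure.2 hy)).mem_closure
  · exact Set.singleton_subset_iff.2 ⟨subset_closure rfl, hη⟩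

lemma IsContraction.image_strictTransform (h : IsContraction K p q μ) (hC : IsNodalCurve K p)
    {D : Set C} (hD : D ∈ irreducibleComponents C) : μ '' strictTransform μ D = D := by
  obtain ⟨η, hη, rfl⟩ := h.exists_generic hC hD
  rw [h.strictTransform_eq hη, ← (h.isClosedMap hC).closure_image_eq_of_continuous μ.continuous,
    Set.image_singleton]

lemma IsContraction.strictTransform_mem (h : IsContraction K p q μ) (hC : IsNodalCurve K p)
    {D : Set C} (hD : D ∈ irreducibleComponents C) :
    strictTransform μ D ∈ irreducibleComponents X := by
  obtain ⟨η, hη, rfl⟩ := h.exists_generic hC hD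
  rw [h.strictTransform_eq hη]
  refine ⟨isIrreducible_singleton.closure, fun W hW hle => ?_⟩
  have hgen := hW.isGenericPoint_genericPoint_closure
  set ζ := hW.genericPoint
  have hζ : ζ ⤳ η := by
    rw [specializes_iff_mem_closure, hgen.def]
    exact subset_closure (hle (subset_closure rfl))
  have h1 : closure {μ ζ} = closure {μ η} := by
    have h2 := specializes_iff_closure_subset.1 (hζ.map μ.continuous)
    exact Set.Subset.antisymm (hD.2 isIrreducible_singleton.closure h2) h2
  have h2 : ζ = η := (h.eq_of_eq hη (inseparable_iff_closure_eq.2 h1.symm).eq).symm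
  rw [← h2, hgen.def]
  exact subset_closure

/-- The two cases are distinguished by whether the generic point maps to a node. -/
lemma IsContraction.exists_strictTransform_eq (h : IsContraction K p q μ) (hC : IsNodalCurve K p)
    {Z : Set X} (hZ : Z ∈ irreducibleComponents X) :
    (∃ D ∈ irreducibleComponents C, Z = strictTransform μ D) ∨
      ∃ S, IsNode K S ∧ Z ⊆ μ ⁻¹' {S} := by
  have hgen := hZ.1.isGenericPoint_genericPoint (isClosed_of_mem_irreducibleComponents Z hZ)
  set ζ := hZ.1.genericPoint
  by_cases hζ : IsNode K (μ ζ)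
  · refine Or.inr ⟨_, hζ, ?_⟩
    rw [← hgen.def]
    exact closure_minimal (Set.singleton_subset_iff.2 rfl) (hζ.1.preimage μ.continuous)
  · refine Or.inl ⟨_, irreducibleComponent_mem_irreducibleComponents (μ ζ), ?_⟩
    refine eq_of_subset_of_mem_irreducibleComponents hZ
      (h.strictTransform_mem hC (irreducibleComponent_mem_irreducibleComponents (μ ζ))) ?_
    rw [← hgen.def]
    refine closure_mono (Set.singleton_subset_iff.2 ⟨mem_irreducibleComponent, ?_⟩)
    rw [h.coe_isoLocus]
    exact hζ

lemma IsContraction.strictTransform_subset (h : IsContraction K p q μ) (D : Set C) {S : C} (hS : IsNode K S) :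
    strictTransform μ D ⊆ closure (μ ⁻¹' {S})ᶜ := by
  rw [strictTransform, h.coe_isoLocus]
  refine closure_mono fun y hy hyS => hy.2 ?_
  rw [show μ y = S from hyS]
  exact hS

lemma IsContraction.not_strictTransform_subset (h : IsContraction K p q μ)
    (hC : IsNodalCurve K p) {D : Set C} (hD : D ∈ irreducibleComponents C) {S : C}
    (hS : IsNode K S) : ¬ strictTransform μ D ⊆ μ ⁻¹' {S} := by
  obtain ⟨η, hη, rfl⟩ := h.exists_generic hC hD
  rw [h.strictTransform_eq hη]
  intro hsub
  have h1 : μ η = S := hsub (subset_closure rfl)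
  exact hη (h1 ▸ hS)

/-- The point where an exceptional component meets the rest of the curve lies on a component not
contracted to that node, necessarily a strict transform. This defines the source of the dart. -/
lemma IsContraction.exists_isChainSystem (h : IsContraction K p q μ) (hC : IsNodalCurve K p) :
    ∃ E z₀ z₁ s, IsChainSystem K μ E z₀ z₁ s := by
  choose E E' hE hE' _ _ hEE' hz₀ hz₁ hz₁' using fun S : {x : C // IsNode K x} => h.chain S.1 S.2
  choose z₀ hz₀ using hz₀
  choose z₁ hz₁ using hz₁
  choose z₁' hz₁' using hz₁'
  let F : {x : C // IsNode K x} × Bool → Set X := fun d => bif d.2 then E' d.1 else E d.1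
  let z : {x : C // IsNode K x} × Bool → X := fun d => bif d.2 then z₁' d.1 else z₁ d.1
  have hF : ∀ d, F d ∈ irreducibleComponents X := by rintro ⟨S, _ | _⟩ <;> simp [F, hE, hE']
  have hFz : ∀ d, F d ∩ closure (μ ⁻¹' {d.1.1})ᶜ = {z d} := by
    rintro ⟨S, _ | _⟩
    · exact hz₁ S
    · exact hz₁' S
  have hs : ∀ d, ∃ D : irreducibleComponents C, z d ∈ strictTransform μ (D : Set C) := by
    intro d
    have hzd : z d ∈ F d ∩ closure (μ ⁻¹' {d.1.1})ᶜ := hFz d ▸ rfl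
    obtain ⟨W, hW, hzW, hWS⟩ := exists_irreducibleComponent_of_mem_closure_compl
      h.curve.finite_irreducibleComponents hzd.2
    have hμz : μ (z d) = d.1.1 := by
      have h1 : F d ⊆ μ ⁻¹' {d.1.1} := by
        rw [hEE']
        rcases d with ⟨S, _ | _⟩
        · exact Set.subset_union_left
        · exact Set.subset_union_right
      exact h1 hzd.1
    obtain ⟨D, hD, rfl⟩ | ⟨S, hS, hWS'⟩ := h.exists_strictTransform_eq hC hW
    · exact ⟨⟨D, hD⟩, hzW⟩
    · have h1 : μ (z d) = S := hWS' hzW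
      rw [← hμz, h1] at hWS
      exact absurd hWS' hWS
  choose s hs using hs
  refine ⟨F, z₀, z, s, hF, hEE', fun S hEq => ?_, hz₀, hFz, hs⟩
  have h1 : E S = E' S := hEq
  refine h.not_subsingleton (hE S) (hEE' S ▸ Set.subset_union_left) (hz₁ S) ?_
  have h2 := hz₀ S
  rw [← h1, Set.inter_self] at h2
  rw [h2]
  exact Set.subsingleton_singleton

/-! ### The dual graphs of C and of C(2). -/

namespace IsChainSystem

variable {E : {x : C // IsNode K x} × Bool → Set X} {z₀ : {x : C // IsNode K x} → X}
  {z₁ : {x : C // IsNode K x} × Bool → X}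
  {s : {x : C // IsNode K x} × Bool → irreducibleComponents C}

lemma subset (H : IsChainSystem K μ E z₀ z₁ s) (d) : E d ⊆ μ ⁻¹' {d.1.1} := by
  rw [H.preimage]
  rcases d with ⟨S, _ | _⟩
  · exact Set.subset_union_left
  · exact Set.subset_union_right

lemma image_eq (H : IsChainSystem K μ E z₀ z₁ s) (d) : μ '' E d = {d.1.1} :=
  ((H.mem d).1.1.image μ).subset_singleton_iff.1 (Set.image_subset_iff.2 (H.subset d))

lemma injective (H : IsChainSystem K μ E z₀ z₁ s) : Function.Injective E := by
  rintro ⟨S, b⟩ ⟨S', b'⟩ he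
  obtain rfl : S = S' := by
    have h1 := H.image_eq (S, b)
    rw [he, H.image_eq] at h1
    exact Subtype.ext (Set.singleton_injective h1).symm
  have := H.ne S
  cases b <;> cases b' <;> first | rfl | exact absurd he this | exact absurd he.symm this

lemma exists_mem (H : IsChainSystem K μ E z₀ z₁ s) {S} {x : X} (hx : μ x = S.1) :
    ∃ b, x ∈ E (S, b) := by
  have : x ∈ E (S, false) ∪ E (S, true) := H.preimage S ▸ hx
  rcases this with h | h
  exacts [⟨_, h⟩, ⟨_, h⟩]

lemma exists_eq (H : IsChainSystem K μ E z₀ z₁ s) {Z : Set X} (hZ : Z ∈ irreducibleComponents X)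
    {S} (hS : Z ⊆ μ ⁻¹' {S.1}) : ∃ b, Z = E (S, b) := by
  have hgen := hZ.1.isGenericPoint_genericPoint (isClosed_of_mem_irreducibleComponents Z hZ)
  obtain ⟨b, hb⟩ := H.exists_mem (hS hgen.mem)
  refine ⟨b, eq_of_subset_of_mem_irreducibleComponents hZ (H.mem _) ?_⟩
  rw [← hgen.def]
  exact closure_minimal (Set.singleton_subset_iff.2 hb)
    (isClosed_of_mem_irreducibleComponents _ (H.mem _))

lemma z₁_mem (H : IsChainSystem K μ E z₀ z₁ s) (d) : z₁ d ∈ E d :=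
  ((H.inter_closure d).ge rfl).1

lemma map_z₁ (H : IsChainSystem K μ E z₀ z₁ s) (d) : μ (z₁ d) = d.1.1 :=
  H.subset d (H.z₁_mem d)

lemma z₀_mem (H : IsChainSystem K μ E z₀ z₁ s) (S b) : z₀ S ∈ E (S, b) := by
  have := (H.inter S).ge rfl
  cases b
  exacts [this.1, this.2]

lemma map_z₀ (H : IsChainSystem K μ E z₀ z₁ s) (S) : μ (z₀ S) = S.1 :=
  H.subset _ (H.z₀_mem S false)

lemma eq_z₀ (H : IsChainSystem K μ E z₀ z₁ s) {S b b'} {x : X} (hb : b ≠ b') (hx : x ∈ E (S, b))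
    (hx' : x ∈ E (S, b')) : x = z₀ S := by
  have h1 : x ∈ E (S, false) ∩ E (S, true) := by
    cases b <;> cases b' <;> first | exact absurd rfl hb | exact ⟨hx, hx'⟩ | exact ⟨hx', hx⟩
  exact (H.inter S).le h1

lemma eq_z₁ (H : IsChainSystem K μ E z₀ z₁ s) (h : IsContraction K p q μ) {D : Set C} {d} {x : X}
    (hx : x ∈ E d) (hxD : x ∈ strictTransform μ D) : x = z₁ d :=
  (H.inter_closure d).le ⟨hx, h.strictTransform_subset D d.1.2 hxD⟩

variable (H : IsChainSystem K μ E z₀ z₁ s) (h : IsContraction K p q μ) (hC : IsNodalCurve K p)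

include H h hC

lemma strictTransform_ne {D : Set C} (hD : D ∈ irreducibleComponents C) (d) :
    strictTransform μ D ≠ E d := fun he =>
  h.not_strictTransform_subset hC hD d.1.2 (he ▸ H.subset d)

/-- The exceptional component and one strict transform already pass through the point, and there is
no room for a third component. -/
lemma eq_of_mem {D : irreducibleComponents C} {d} {x : X} (hx : x ∈ E d)
    (hxD : x ∈ strictTransform μ (D : Set C)) : D = s d := by
  obtain rfl := H.eq_z₁ h hx hxD
  have h1 := h.curve.eq_or_eq (H.mem d) (h.strictTransform_mem hC (s d).2)
    (h.strictTransform_mem hC D.2) hx (H.mem_strict d) hxD (H.strictTransform_ne h hC (s d).2 d).symm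
  have h2 := h1.resolve_left (H.strictTransform_ne h hC D.2 d)
  refine Subtype.ext ?_
  rw [← h.image_strictTransform hC D.2, h2, h.image_strictTransform hC (s d).2]

lemma exists_z₁_mem {D : Set C} (hD : D ∈ irreducibleComponents C) {S} (hS : S.1 ∈ D) :
    ∃ b, z₁ (S, b) ∈ strictTransform μ D ∧ s (S, b) = D := by
  rw [← h.image_strictTransform hC hD] at hS
  obtain ⟨y, hy, hyS⟩ := hS
  obtain ⟨b, hb⟩ := H.exists_mem hyS
  have h1 := H.eq_of_mem h hC (D := ⟨D, hD⟩) hb hy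
  exact ⟨b, H.eq_z₁ h hb hy ▸ hy, by rw [← h1]⟩

lemma z₀_ne_z₁ (d) : z₀ d.1 ≠ z₁ d := by
  intro he
  have hne : E (d.1, false) ≠ E (d.1, true) := H.ne d.1
  rcases h.curve.eq_or_eq (H.mem _) (H.mem _) (h.strictTransform_mem hC (s d).2)
    (H.z₀_mem d.1 false) (H.z₀_mem d.1 true) (he ▸ H.mem_strict d) hne with h1 | h1
  exacts [H.strictTransform_ne h hC (s d).2 _ h1, H.strictTransform_ne h hC (s d).2 _ h1]

lemma z₁_injective : Function.Injective z₁ := by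
  rintro ⟨S, b⟩ ⟨S', b'⟩ he
  obtain rfl : S = S' := Subtype.ext
    ((H.map_z₁ (S, b)).symm.trans ((congrArg μ he).trans (H.map_z₁ (S', b'))))
  by_contra hne
  have hb : b ≠ b' := fun hb => hne (hb ▸ rfl)
  exact H.z₀_ne_z₁ h hC (S, b) (H.eq_z₀ hb (H.z₁_mem _) (he ▸ H.z₁_mem (S, b'))).symm

/-- The dual graph of `C`. -/
lemma isDualGraph : DualGraph.IsDualGraph s
    (fun D : irreducibleComponents C => (D : Set C)) (fun S : {x : C // IsNode K x} => S.1) where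
  injective := Subtype.val_injective
  range_eq := Subtype.range_coe
  node_mem d := by
    have h1 := Set.mem_image_of_mem μ (H.mem_strict d)
    rwa [h.image_strictTransform hC (s d).2, H.map_z₁] at h1
  node_injective := Subtype.val_injective
  exists_node := by
    intro v w x hvw hxv hxw
    let S : {x : C // IsNode K x} :=
      ⟨x, hC.isNode_of_mem v.2 w.2 (fun he => hvw (Subtype.ext he)) hxv hxw⟩
    obtain ⟨b, -, hb⟩ := H.exists_z₁_mem h hC v.2 (S := S) hxv
    obtain ⟨b', -, hb'⟩ := H.exists_z₁_mem h hC w.2 (S := S) hxw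
    have hbb : b' = !b := by
      refine Bool.eq_not.2 fun he => hvw (Subtype.ext ?_)
      rw [← hb, ← hb', he]
    refine ⟨(S, b), rfl, Subtype.ext hb, Subtype.ext ?_⟩
    rw [hbb] at hb'
    exact hb'

/-- The dual graph of `C(2)` is obtained from the one of `C` by inserting two vertices in every
edge. -/
lemma isDualGraph_sub : DualGraph.IsDualGraph (DualGraph.sub s)
    (Sum.elim (fun D : irreducibleComponents C => strictTransform μ (D : Set C)) E)
    (Sum.elim z₁ z₀) where
  injective := by
    rintro (v | d) (w | d') he
    · refine congrArg Sum.inl (Subtype.ext ?_)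
      have he : strictTransform μ (v : Set C) = strictTransform μ (w : Set C) := he
      rw [← h.image_strictTransform hC v.2, he, h.image_strictTransform hC w.2]
    · exact absurd he (H.strictTransform_ne h hC v.2 d')
    · exact absurd he.symm (H.strictTransform_ne h hC w.2 d)
    · exact congrArg Sum.inr (H.injective he)
  range_eq := by
    refine Set.Subset.antisymm ?_ fun Z hZ => ?_
    · rintro _ ⟨v | d, rfl⟩
      exacts [h.strictTransform_mem hC v.2, H.mem d]
    · obtain ⟨D, hD, rfl⟩ | ⟨S, hS, hZS⟩ := h.exists_strictTransform_eq hC hZ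
      · exact ⟨Sum.inl ⟨D, hD⟩, rfl⟩
      · obtain ⟨b, rfl⟩ := H.exists_eq hZ (S := ⟨S, hS⟩) hZS
        exact ⟨Sum.inr _, rfl⟩
  node_mem := by
    rintro ⟨d | S, _ | _⟩
    exacts [H.mem_strict d, H.z₁_mem d, H.z₀_mem S _, H.z₀_mem S _]
  node_injective := by
    rintro (d | S) (d' | S') he
    · exact congrArg Sum.inl (H.z₁_injective h hC he)
    · have he : z₁ d = z₀ S' := he
      have h1 : d.1 = S' := Subtype.ext ((H.map_z₁ d).symm.trans (he ▸ H.map_z₀ S'))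
      exact absurd (h1 ▸ he.symm) (H.z₀_ne_z₁ h hC d)
    · have he : z₀ S = z₁ d' := he
      have h1 : d'.1 = S := Subtype.ext ((H.map_z₁ d').symm.trans (he ▸ H.map_z₀ S))
      exact absurd (h1 ▸ he) (H.z₀_ne_z₁ h hC d')
    · have he : z₀ S = z₀ S' := he
      exact congrArg Sum.inr (Subtype.ext ((H.map_z₀ S).symm.trans (he ▸ H.map_z₀ S')))
  exists_node := by
    rintro (v | ⟨S, b⟩) (w | ⟨S', b'⟩) x hvw hxv hxw
    · have hxv : x ∈ strictTransform μ (v : Set C) := hxv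
      have hxw : x ∈ strictTransform μ (w : Set C) := hxw
      have hvw' : (v : Set C) ≠ w := fun he => hvw (congrArg Sum.inl (Subtype.ext he))
      have hv := Set.mem_image_of_mem μ hxv
      have hw := Set.mem_image_of_mem μ hxw
      rw [h.image_strictTransform hC v.2] at hv
      rw [h.image_strictTransform hC w.2] at hw
      -- Two strict transforms could only meet over a node, hence on an exceptional component, which
      -- meets just one of them.
      obtain ⟨b, hb⟩ := H.exists_mem (S := ⟨μ x, hC.isNode_of_mem v.2 w.2 hvw' hv hw⟩) rfl
      exact absurd (((H.eq_of_mem h hC hb hxv).trans (H.eq_of_mem h hC hb hxw).symm))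
        fun he => hvw (congrArg Sum.inl he)
    · refine ⟨(Sum.inl (S', b'), false), (H.eq_z₁ h hxw hxv).symm, ?_, rfl⟩
      exact congrArg Sum.inl (H.eq_of_mem h hC hxw hxv).symm
    · refine ⟨(Sum.inl (S, b), true), (H.eq_z₁ h hxv hxw).symm, rfl, ?_⟩
      exact congrArg Sum.inl (H.eq_of_mem h hC hxv hxw).symm
    · have hxS : μ x = S.1 := H.subset (S, b) hxv
      have hxS' : μ x = S'.1 := H.subset (S', b') hxw
      obtain rfl : S = S' := Subtype.ext (hxS.symm.trans hxS')
      have hbb : b ≠ b' := fun he => hvw (he ▸ rfl)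
      refine ⟨(Sum.inr S, b), (H.eq_z₀ hbb hxv hxw).symm, rfl, ?_⟩
      rw [Bool.eq_not.2 hbb.symm]
      rfl

/-- Over a self-intersection of one component both exceptional curves would meet its strict
transform; distinct ends leave only one. -/
lemma excComponent_eq {d} (hd : s (DualGraph.rev d) ≠ s d) :
    excComponent μ d.1.1 (s d : Set C) = E d := by
  refine Set.Subset.antisymm (Set.sUnion_subset ?_) (Set.subset_sUnion_of_mem ?_)
  · rintro Z ⟨hZ, hZS, y, hy, hyD⟩
    obtain ⟨b, rfl⟩ := H.exists_eq hZ hZS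
    have h1 := H.eq_of_mem h hC hy hyD
    obtain ⟨S, c⟩ := d
    by_cases hb : b = c
    · rw [hb]
    · rw [Bool.eq_not.2 hb] at h1
      exact absurd h1.symm hd
  · exact ⟨H.mem d, H.subset d, z₁ d, H.z₁_mem d, H.mem_strict d⟩

end IsChainSystem

end Contraction

end AbelJacobi

namespace AbelJacobi

/-! ### Distinguished points -/

section Double

variable {K : Type u} [Field K] {C 𝒞 T : Scheme.{u}} {p : C ⟶ Spec (.of K)}
  {π : 𝒞 ⟶ Spec (.of K⟦X⟧)} {ι : C ⟶ 𝒞}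

lemma IsSmoothing.isClosedImmersion (h : IsSmoothing K p π ι) : IsClosedImmersion ι := by
  have : IsClosedImmersion
      (Spec.map (CommRingCat.ofHom (PowerSeries.constantCoeff (R := K)))) :=
    IsClosedImmersion.spec_of_surjective _ PowerSeries.constantCoeff_surj
  exact MorphismProperty.of_isPullback h.isPullback.flip this

/-- A point on the strict transform of `D₁ × D₂` lies over `D₁ × D₂`. -/
lemma IsSmoothing.mem_of_mem_strictTransform (h : IsSmoothing K p π ι) {φ : T ⟶ pullback π π}
    {A : T} {R₁ R₂ : C} {D₁ D₂ : Set C} (h₁ : IsClosed D₁) (h₂ : IsClosed D₂)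
    (hA : A ∈ strictTransform φ (prodDivisor π ι D₁ D₂))
    (hR₁ : pullback.fst π π (φ A) = ι R₁) (hR₂ : pullback.snd π π (φ A) = ι R₂) :
    R₁ ∈ D₁ ∧ R₂ ∈ D₂ := by
  have hι := h.isClosedImmersion
  have hcl : IsClosed (prodDivisor π ι D₁ D₂) :=
    ((ι.isClosedEmbedding.isClosedMap _ h₁).preimage (pullback.fst π π).continuous).inter
      ((ι.isClosedEmbedding.isClosedMap _ h₂).preimage (pullback.snd π π).continuous)
  have hmem : φ A ∈ prodDivisor π ι D₁ D₂ :=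
    closure_minimal (Set.preimage_mono Set.inter_subset_left) (hcl.preimage φ.continuous) hA
  obtain ⟨⟨x, hx, hx'⟩, ⟨y, hy, hy'⟩⟩ := hmem
  rw [hR₁] at hx'
  rw [hR₂] at hy'
  exact ⟨ι.isClosedEmbedding.injective hx' ▸ hx, ι.isClosedEmbedding.injective hy' ▸ hy⟩

end Double

end AbelJacobi

theorem proposition6p2 {K : Type u} [Field K] [IsAlgClosed K] {C 𝒞 T Y : Scheme.{u}}
    -- a nodal curve `C`, a smoothing `π` of `C` and a section `σ` of `π` with `σ(0) = P` smooth
    (p : C ⟶ Spec (.of K)) (hC : AbelJacobi.IsNodalCurve K p)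
    (π : 𝒞 ⟶ Spec (.of K⟦X⟧)) (ι : C ⟶ 𝒞) (hπ : AbelJacobi.IsSmoothing K p π ι)
    (σ : Spec (.of K⟦X⟧) ⟶ 𝒞) (hσ : σ ≫ π = 𝟙 _)
    (P : C) (hσP : σ (IsLocalRing.closedPoint K⟦X⟧) = ι P) (hP : AbelJacobi.IsSmoothPoint K P)
    -- a good partial desingularization of `𝒞²` and a distinguished point `A` over `(R₁, R₂)`
    (φ : T ⟶ pullback π π) (hφ : AbelJacobi.IsGoodPartialDesingularization π ι φ)
    (A : T) (R₁ R₂ : C) (hR : R₁ ≠ R₂) (D₁ D₁' D₂ D₂' : Set C)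
    (hA : AbelJacobi.IsDistinguishedPoint π ι φ A R₁ R₂ D₁ D₁' D₂ D₂')
    -- the curve `Y = C(2)` with its contraction map and the point over `P`
    (q : Y ⟶ Spec (.of K)) (μ : Y ⟶ C) (hμ : AbelJacobi.IsContraction K p q μ)
    (P' : Y) (hP' : μ P' = P)
    (hq : AbelJacobi.IsQuasistable P R₁ R₂ D₁ D₁' D₂ D₂') :
    ∀ s ∈ ({1, 2, 3} : Set ℕ),
      AbelJacobi.IsSynchronizedAt μ P'
        (AbelJacobi.excComponent μ R₁ D₁) (AbelJacobi.excComponent μ R₂ D₂)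
        P D₁ D₁' D₂ D₂' s := by
  obtain ⟨E, z₀, z₁, s, H⟩ := hμ.exists_isChainSystem hC
  have hX := H.isDualGraph hμ hC
  have hY := H.isDualGraph_sub hμ hC
  have := hC.isNoetherian
  have : Finite (irreducibleComponents C) := hC.finite_irreducibleComponents
  have : Finite {x : C // AbelJacobi.IsNode K x} := hμ.finite_nodes hC
  have := hC.connected
  have := hμ.curve.connected
  -- the components containing the base points
  let vP : irreducibleComponents C := ⟨_, irreducibleComponent_mem_irreducibleComponents P⟩
  have hvP : ∀ v : irreducibleComponents C, P ∈ (v : Set C) ↔ v = vP := fun v =>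
    ⟨fun h => Subtype.ext (hP.eq v.2 vP.2 h mem_irreducibleComponent),
      fun h => h ▸ mem_irreducibleComponent⟩
  have hP'v : ∀ w, P' ∈ Sum.elim
      (fun D : irreducibleComponents C => AbelJacobi.strictTransform μ (D : Set C)) E w ↔
        w = Sum.inl vP := by
    rintro (v | d)
    · rw [Sum.inl.injEq, ← hvP]
      constructor
      · intro h
        rw [← hμ.image_strictTransform hC v.2, ← hP']
        exact Set.mem_image_of_mem μ h
      · intro h
        refine subset_closure ⟨hP'.symm ▸ h, ?_⟩
        rw [hμ.coe_isoLocus, hP']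
        exact hP.not_isNode
    · refine iff_of_false (fun h => ?_) (fun h => by cases h)
      have h1 : μ P' = d.1.1 := H.subset d h
      rw [hP'] at h1
      exact hP.not_isNode (h1 ▸ d.1.2)
  -- the nodes under the distinguished point
  have hcl : ∀ D ∈ irreducibleComponents C, IsClosed D := isClosed_of_mem_irreducibleComponents
  obtain ⟨h₁, h₂⟩ := hπ.mem_of_mem_strictTransform (hcl _ hA.comp₁) (hcl _ hA.comp₂) hA.mem
    hA.fst_eq hA.snd_eq
  have h₂' := (hπ.mem_of_mem_strictTransform (hcl _ hA.comp₁) (hcl _ hA.comp₂') hA.mem'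
    hA.fst_eq hA.snd_eq).2
  have h₁' := (hπ.mem_of_mem_strictTransform (hcl _ hA.comp₁') (hcl _ hA.comp₂) hA.mem''
    hA.fst_eq hA.snd_eq).1
  -- Distinctness of the three pairs makes R₁ and R₂ points on two different components, hence edges
  -- of the dual graph which are not loops.
  have hne : D₁ ≠ D₁' ∧ D₂ ≠ D₂' := by
    have := hA.distinct
    simp only [List.nodup_cons, List.mem_cons, Prod.mk.injEq, true_and, and_true] at this
    tauto
  obtain ⟨d₁, hR₁, hd₁, hd₁'⟩ := hX.exists_node ⟨D₁, hA.comp₁⟩ ⟨D₁', hA.comp₁'⟩ R₁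
    (fun h => hne.1 (congrArg Subtype.val h)) h₁ h₁'
  obtain ⟨d₂, hR₂, hd₂, hd₂'⟩ := hX.exists_node ⟨D₂, hA.comp₂⟩ ⟨D₂', hA.comp₂'⟩ R₂
    (fun h => hne.2 (congrArg Subtype.val h)) h₂ h₂'
  have hE₁ := H.excComponent_eq hμ hC (d := d₁)
    (fun h => hne.1 (congrArg Subtype.val (hd₁.symm.trans (h.symm.trans hd₁'))))
  have hE₂ := H.excComponent_eq hμ hC (d := d₂)
    (fun h => hne.2 (congrArg Subtype.val (hd₂.symm.trans (h.symm.trans hd₂'))))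
  have key := DualGraph.isSynchronizedAt (d₁ := d₁) (d₂ := d₂) (P := P) hX hY
    (fun v => hμ.image_strictTransform hC v.2) (fun d => H.image_eq d) hvP hP'v
    (fun h => hR (hR₁.symm.trans ((congrArg Subtype.val h).trans hR₂)))
  simp only [hd₁, hd₁', hd₂, hd₂'] at key hE₁ hE₂
  rw [hR₁] at hE₁ key
  rw [hR₂] at hE₂ key
  rw [hE₁, hE₂]
  exact key hq
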